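/- Let $K$ be a field, let $Q'$ and $Q''$ be quivers with finitely many vertices, and let $I'\subseteq KQ'$ and $I''\subseteq KQ''$ be two-sided ideals of the path algebras. Put $B=KQ'/I'$ and $C=KQ''/I''$. Let $v$ be a vertex of $Q'$ and $w$ a vertex of $Q''$, and let $Q$ be the quiver obtained from the disjoint union of $Q'$ and $Q''$ by adding one new arrow $w\to v$. Let $I$ be the two-sided ideal of $KQ$ generated by $I'$ and $I''$, and let $\Lambda=KQ/I$. (Paths are multiplied like functions, so that left modules are covariant representations of the quiver and $\Lambda$ is the upper triangular matrix algebra $\begin{pmatrix} B & M\\ 0 & C\end{pmatrix}$, where $M$ is spanned by the classes of the paths from $Q''$ to $Q'$.) A $K$-algebra $\Gamma$ is called Gorenstein if it is finite-dimensional, the left module $D(\Gamma_\Gamma)=\operatorname{Hom}_K(\Gamma,K)$ has finite projective dimension, and the left module $\Gamma$ has finite injective dimension. A left $\Gamma$-module $G$ is Gorenstein projective if $G\cong\operatorname{Ker} d^0$ for an exact sequence $\cdots\to P^{-1}\to P^0\xrightarrow{d^0}P^1\to\cdots$ of finitely generated projective left $\Gamma$-modules which stays exact under $\operatorname{Hom}_\Gamma(-,\Gamma)$.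 The stable category $\underline{\operatorname{Gproj}}(\Gamma)$ has the Gorenstein projective modules as objects, and homomorphisms modulo those that factor through finitely generated projective modules as morphisms. Its suspension $\Sigma X$ is the cokernel of an embedding of $X$ into a finitely generated projective module with Gorenstein projective cokernel, and its distinguished triangles are, up to isomorphism, those $X\to Y\to Z\to\Sigma X$ that come from short exact sequences $0\to X\to Y\to Z\to 0$ of Gorenstein projective modules. Suppose that $B$ and $C$ are Gorenstein. Then there is a $K$-linear triangle equivalence $$\underline{\operatorname{Gproj}}(\Lambda)\;\simeq\;\underline{\operatorname{Gproj}}(B)\coprod\underline{\operatorname{Gproj}}(C),$$ where the coproduct on the right is the product category with componentwise suspension and componentwise distinguished triangles. -/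

import Mathlib

open CategoryTheory

universe u

noncomputable section

/-! ## Path algebras -/

/-- The path algebra `KQ` of a quiver `Q` with finite vertex set `V`: an element assigns to every
pair of vertices `(a, b)` a finite `K`-linear combination of paths from `a` to `b`.  As `V` is
finite, the paths of `Q` form a `K`-basis. -/
def PathAlgebra (K V : Type u) [Field K] [Quiver.{u} V] : Type u :=
  ∀ a b : V, Quiver.Path a b →₀ K

namespace PathAlgebra

variable (K V : Type u) [Field K] [Quiver.{u} V]

instance : AddCommGroup (PathAlgebra K V) :=
  inferInstanceAs (AddCommGroup (∀ a b : V, Quiver.Path a b →₀ K))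

instance : Module K (PathAlgebra K V) :=
  inferInstanceAs (Module K (∀ a b : V, Quiver.Path a b →₀ K))

variable {K V}

@[ext]
theorem ext {x y : PathAlgebra K V} (h : ∀ a b, x a b = y a b) : x = y :=
  funext fun a => funext fun b => h a b

/-- The bilinear extension of the concatenation of paths: first `p`, then `q`. -/
def concat {a b c : V} (f : Quiver.Path a b →₀ K) (g : Quiver.Path b c →₀ K) :
    Quiver.Path a c →₀ K :=
  f.sum fun p s => g.sum fun q t => Finsupp.single (p.comp q) (s * t)

/-- The trivial path at `a`, if `a = b`. -/
def trivialPath (K : Type u) [Field K] (a b : V) : Quiver.Path a b →₀ K :=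
  open Classical in
  if h : a = b then Finsupp.single (h ▸ Quiver.Path.nil) 1 else 0

theorem concat_add_left {a b c : V} (f f' : Quiver.Path a b →₀ K) (g : Quiver.Path b c →₀ K) :
    concat (f + f') g = concat f g + concat f' g := by
  unfold concat
  rw [Finsupp.sum_add_index']
  · intro p; simp
  · intro p s s'
    simp only [add_mul, Finsupp.single_add, Finsupp.sum_add]

theorem concat_add_right {a b c : V} (f : Quiver.Path a b →₀ K) (g g' : Quiver.Path b c →₀ K) :
    concat f (g + g') = concat f g + concat f g' := by
  unfold concat
  rw [← Finsupp.sum_add]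
  congr 1
  funext p s
  rw [Finsupp.sum_add_index']
  · intro q; simp
  · intro q t t'
    simp only [mul_add, Finsupp.single_add]

@[simp] theorem concat_zero_left {a b c : V} (g : Quiver.Path b c →₀ K) :
    concat (0 : Quiver.Path a b →₀ K) g = 0 := by
  simp [concat]

@[simp] theorem concat_zero_right {a b c : V} (f : Quiver.Path a b →₀ K) :
    concat f (0 : Quiver.Path b c →₀ K) = 0 := by
  simp [concat]

@[simp] theorem concat_single {a b c : V} (p : Quiver.Path a b) (q : Quiver.Path b c) (s t : K) :
    concat (Finsupp.single p s) (Finsupp.single q t) = Finsupp.single (p.comp q) (s * t) := by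
  simp [concat]

theorem concat_smul_left {a b c : V} (r : K) (f : Quiver.Path a b →₀ K)
    (g : Quiver.Path b c →₀ K) : concat (r • f) g = r • concat f g := by
  induction f using Finsupp.induction_linear with
  | zero => simp
  | add f f' h h' => rw [smul_add, concat_add_left, h, h', concat_add_left, smul_add]
  | single p s =>
    induction g using Finsupp.induction_linear with
    | zero => simp
    | add g g' h h' => rw [concat_add_right, h, h', concat_add_right, smul_add]
    | single q t => simp only [Finsupp.smul_single', concat_single, mul_assoc]

theorem concat_smul_right {a b c : V} (r : K) (f : Quiver.Path a b →₀ K)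
    (g : Quiver.Path b c →₀ K) : concat f (r • g) = r • concat f g := by
  induction f using Finsupp.induction_linear with
  | zero => simp
  | add f f' h h' => rw [concat_add_left, h, h', concat_add_left, smul_add]
  | single p s =>
    induction g using Finsupp.induction_linear with
    | zero => simp
    | add g g' h h' => rw [smul_add, concat_add_right, h, h', concat_add_right, smul_add]
    | single q t => simp only [Finsupp.smul_single', concat_single, mul_left_comm]

theorem concat_assoc {a b c d : V} (f : Quiver.Path a b →₀ K) (g : Quiver.Path b c →₀ K)
    (h : Quiver.Path c d →₀ K) : concat (concat f g) h = concat f (concat g h) := by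
  induction f using Finsupp.induction_linear with
  | zero => simp
  | add f f' h h' => simp only [concat_add_left, h, h']
  | single p s =>
    induction g using Finsupp.induction_linear with
    | zero => simp
    | add g g' h h' => simp only [concat_add_left, concat_add_right, h, h']
    | single q t =>
      induction h using Finsupp.induction_linear with
      | zero => simp
      | add g g' h h' => simp only [concat_add_right, h, h']
      | single r t' => simp only [concat_single, Quiver.Path.comp_assoc, mul_assoc]

theorem concat_sum_left {a b c : V} {ι : Type*} (s : Finset ι) (f : ι → Quiver.Path a b →₀ K)
    (g : Quiver.Path b c →₀ K) : concat (∑ i ∈ s, f i) g = ∑ i ∈ s, concat (f i) g :=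
  map_sum (AddMonoidHom.mk' (fun f => concat f g) fun f f' => concat_add_left f f' g) f s

theorem concat_sum_right {a b c : V} {ι : Type*} (s : Finset ι) (f : Quiver.Path a b →₀ K)
    (g : ι → Quiver.Path b c →₀ K) : concat f (∑ i ∈ s, g i) = ∑ i ∈ s, concat f (g i) :=
  map_sum (AddMonoidHom.mk' (fun g => concat f g) fun g g' => concat_add_right f g g') g s

theorem trivialPath_self (a : V) :
    trivialPath K a a = Finsupp.single Quiver.Path.nil 1 := by
  simp [trivialPath]

theorem trivialPath_ne {a b : V} (h : a ≠ b) : trivialPath K a b = 0 := by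
  simp [trivialPath, h]

@[simp] theorem trivialPath_concat {a b : V} (f : Quiver.Path a b →₀ K) :
    concat (trivialPath K a a) f = f := by
  rw [trivialPath_self]
  induction f using Finsupp.induction_linear with
  | zero => simp
  | add f f' h h' => simp only [concat_add_right, h, h']
  | single p s => simp

@[simp] theorem concat_trivialPath {a b : V} (f : Quiver.Path a b →₀ K) :
    concat f (trivialPath K b b) = f := by
  rw [trivialPath_self]
  induction f using Finsupp.induction_linear with
  | zero => simp
  | add f f' h h' => simp only [concat_add_left, h, h']
  | single p s => simp

instance : One (PathAlgebra K V) := ⟨fun a b => trivialPath K a b⟩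

theorem one_apply (a b : V) : (1 : PathAlgebra K V) a b = trivialPath K a b := rfl

theorem add_apply (x y : PathAlgebra K V) (a b : V) : (x + y) a b = x a b + y a b := rfl

theorem zero_apply (a b : V) : (0 : PathAlgebra K V) a b = 0 := rfl

theorem smul_apply (r : K) (x : PathAlgebra K V) (a b : V) : (r • x) a b = r • x a b := rfl

variable [Fintype V]

/-- The product of two paths is `x * y = (first y, then x)`, or `0` if they do not compose; so
left modules are covariant representations of the quiver. -/
instance : Mul (PathAlgebra K V) := ⟨fun x y a c => ∑ b : V, concat (y a b) (x b c)⟩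

theorem mul_apply (x y : PathAlgebra K V) (a c : V) :
    (x * y) a c = ∑ b : V, concat (y a b) (x b c) := rfl

instance : Ring (PathAlgebra K V) :=
  { (inferInstance : AddCommGroup (PathAlgebra K V)) with
    left_distrib := fun x y z => by
      ext1 a c
      simp only [mul_apply, add_apply, concat_add_left, Finset.sum_add_distrib]
    right_distrib := fun x y z => by
      ext1 a c
      simp only [mul_apply, add_apply, concat_add_right, Finset.sum_add_distrib]
    zero_mul := fun x => by
      ext1 a c
      simp [mul_apply, zero_apply]
    mul_zero := fun x => by
      ext1 a c
      simp [mul_apply, zero_apply]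
    mul_assoc := fun x y z => by
      ext1 a d
      simp only [mul_apply, concat_sum_left, concat_sum_right, concat_assoc]
      exact Finset.sum_comm
    one_mul := fun x => by
      ext1 a c
      rw [mul_apply, Finset.sum_eq_single c]
      · rw [one_apply, concat_trivialPath]
      · intro b _ hb
        rw [one_apply, trivialPath_ne hb, concat_zero_right]
      · simp
    mul_one := fun x => by
      ext1 a c
      rw [mul_apply, Finset.sum_eq_single a]
      · rw [one_apply, trivialPath_concat]
      · intro b _ hb
        rw [one_apply, trivialPath_ne hb.symm, concat_zero_left]
      · simp }

instance : Algebra K (PathAlgebra K V) :=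
  Algebra.ofModule
    (fun r x y => by
      ext1 a c
      simp only [mul_apply, smul_apply, concat_smul_right, Finset.smul_sum])
    (fun r x y => by
      ext1 a c
      simp only [mul_apply, smul_apply, concat_smul_left, Finset.smul_sum])

end PathAlgebra

/-- The algebra `KQ/I` given by a quiver with a two-sided ideal `I` of its path algebra. -/
abbrev BoundQuiverAlgebra {K V : Type u} [Field K] [Quiver.{u} V] [Fintype V]
    (I : TwoSidedIdeal (PathAlgebra K V)) : Type u :=
  I.ringCon.Quotient

/-! ## Gluing two quivers by one arrow -/

/-- The vertices of the quiver glued from the quivers on `V'` and `V''` by one arrow `w ⟶ v`. -/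
def GluedVertex {V' V'' : Type u} (_v : V') (_w : V'') : Type u := V' ⊕ V''

/-- The arrows of the glued quiver: those of the two quivers and one new arrow `w ⟶ v`. -/
inductive GluedArrow {V' V'' : Type u} [Quiver.{u} V'] [Quiver.{u} V''] (v : V') (w : V'') :
    V' ⊕ V'' → V' ⊕ V'' → Type u
  | left {a b : V'} (f : a ⟶ b) : GluedArrow v w (Sum.inl a) (Sum.inl b)
  | right {a b : V''} (f : a ⟶ b) : GluedArrow v w (Sum.inr a) (Sum.inr b)
  | bridge : GluedArrow v w (Sum.inr w) (Sum.inl v)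

section Glue

variable {V' V'' : Type u} [Quiver.{u} V'] [Quiver.{u} V''] (v : V') (w : V'')

instance : Quiver.{u} (GluedVertex v w) := ⟨GluedArrow v w⟩

instance [Fintype V'] [Fintype V''] : Fintype (GluedVertex v w) :=
  inferInstanceAs (Fintype (V' ⊕ V''))

/-- The inclusion of the quiver `Q'` into the glued quiver. -/
def gluedInl : V' ⥤q GluedVertex v w where
  obj a := Sum.inl a
  map f := GluedArrow.left f

/-- The inclusion of the quiver `Q''` into the glued quiver. -/
def gluedInr : V'' ⥤q GluedVertex v w where
  obj a := Sum.inr a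
  map f := GluedArrow.right f

variable {K : Type u} [Field K]

/-- The inclusion `KQ' → KQ`, which sends each path of `Q'` to the same path in `Q`. -/
def pathAlgebraInl (x : PathAlgebra K V') : PathAlgebra K (GluedVertex v w)
  | Sum.inl a, Sum.inl b => Finsupp.mapDomain (fun p => (gluedInl v w).mapPath p) (x a b)
  | _, _ => 0

/-- The inclusion `KQ'' → KQ`, which sends each path of `Q''` to the same path in `Q`. -/
def pathAlgebraInr (x : PathAlgebra K V'') : PathAlgebra K (GluedVertex v w)
  | Sum.inr a, Sum.inr b => Finsupp.mapDomain (fun p => (gluedInr v w).mapPath p) (x a b)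
  | _, _ => 0

/-- The two-sided ideal of `KQ` generated by `I'` and `I''`. -/
def gluedIdeal [Fintype V'] [Fintype V''] (I' : TwoSidedIdeal (PathAlgebra K V'))
    (I'' : TwoSidedIdeal (PathAlgebra K V'')) :
    TwoSidedIdeal (PathAlgebra K (GluedVertex v w)) :=
  TwoSidedIdeal.span
    (pathAlgebraInl v w '' (I' : Set (PathAlgebra K V')) ∪
      pathAlgebraInr v w '' (I'' : Set (PathAlgebra K V'')))

end Glue

/-! ## Gorenstein algebras and Gorenstein projective modules -/

/-- The left module `D(Γ_Γ) = Hom_K(Γ, K)`, with `(a • φ) x = φ (x * a)`. -/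
def RegularDual (K Γ : Type u) [Field K] [Ring Γ] [Algebra K Γ] : Type u := Γ →ₗ[K] K

section RegularDual

variable (K Γ : Type u) [Field K] [Ring Γ] [Algebra K Γ]

instance : AddCommGroup (RegularDual K Γ) := inferInstanceAs (AddCommGroup (Γ →ₗ[K] K))

instance : Module Γ (RegularDual K Γ) where
  smul a φ := LinearMap.comp (R₁ := K) (M₁ := Γ) (M₂ := Γ) (M₃ := K) φ (LinearMap.mulRight K a)
  one_smul φ := LinearMap.ext fun x => by
    let ψ : Γ →ₗ[K] K := φ
    have h : ψ (x * 1) = ψ x := by rw [mul_one]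
    exact h
  mul_smul a b φ := LinearMap.ext fun x => by
    let ψ : Γ →ₗ[K] K := φ
    have h : ψ (x * (a * b)) = ψ (x * a * b) := by rw [mul_assoc]
    exact h
  smul_zero _ := rfl
  smul_add _ _ _ := rfl
  add_smul a b φ := LinearMap.ext fun x => by
    let ψ : Γ →ₗ[K] K := φ
    have h : ψ (x * (a + b)) = ψ (x * a) + ψ (x * b) := by rw [mul_add, map_add]
    exact h
  zero_smul φ := LinearMap.ext fun x => by
    let ψ : Γ →ₗ[K] K := φ
    have h : ψ (x * 0) = 0 := by rw [mul_zero, map_zero]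
    exact h

end RegularDual

/-- A finite-dimensional `K`-algebra `Γ` is Gorenstein if the left module `D(Γ_Γ)` has finite
projective dimension and the left module `Γ` has finite injective dimension. -/
structure IsGorensteinAlgebra (K Γ : Type u) [Field K] [Ring Γ] [Algebra K Γ] : Prop where
  finite : Module.Finite K Γ
  projectiveDimension : ∃ n : ℕ, HasProjectiveDimensionLE (ModuleCat.of Γ (RegularDual K Γ)) n
  injectiveDimension : ∃ n : ℕ, HasInjectiveDimensionLE (ModuleCat.of Γ Γ) n

variable (Γ : Type u) [Ring Γ]

/-- `G` is Gorenstein projective: it is isomorphic to `Ker d⁰` for an exact sequence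
`⋯ → P⁻¹ → P⁰ → P¹ → ⋯` of finitely generated projective left modules which stays exact under
`Hom(-, Γ)`. -/
def IsGorensteinProjective (G : ModuleCat.{u} Γ) : Prop :=
  ∃ (P : ℤ → ModuleCat.{u} Γ) (d : ∀ n : ℤ, P n →ₗ[Γ] P (n + 1)),
    (∀ n, Module.Finite Γ (P n)) ∧ (∀ n, Module.Projective Γ (P n)) ∧
    (∀ n, Function.Exact (d n) (d (n + 1))) ∧
    (∀ n, Function.Exact (fun g : P (n + 1 + 1) →ₗ[Γ] Γ => g ∘ₗ d (n + 1))
      (fun g : P (n + 1) →ₗ[Γ] Γ => g ∘ₗ d n)) ∧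
    Nonempty (G ≃ₗ[Γ] LinearMap.ker (d 0))

/-- The property of being Gorenstein projective. -/
def gprojProperty : ObjectProperty (ModuleCat.{u} Γ) := fun G => IsGorensteinProjective Γ G

/-- The category of (finitely generated) Gorenstein projective left `Γ`-modules. -/
abbrev GProj : Type (u + 1) := (gprojProperty Γ).FullSubcategory

variable {Γ}

/-! ## The stable category -/

/-- The homomorphism `f` factors through a finitely generated projective module. -/
def FactorsThroughProjective {M N : ModuleCat.{u} Γ} (f : M ⟶ N) : Prop :=
  ∃ (P : ModuleCat.{u} Γ) (_ : Module.Finite Γ P) (_ : Module.Projective Γ P)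
    (a : M ⟶ P) (b : P ⟶ N), f = a ≫ b

namespace FactorsThroughProjective

variable {L M N : ModuleCat.{u} Γ}

theorem zero : FactorsThroughProjective (0 : M ⟶ N) :=
  ⟨ModuleCat.of Γ PUnit, inferInstance, inferInstance, 0, 0, by simp⟩

theorem neg {f : M ⟶ N} (hf : FactorsThroughProjective f) : FactorsThroughProjective (-f) := by
  obtain ⟨P, h1, h2, a, b, rfl⟩ := hf
  exact ⟨P, h1, h2, -a, b, by simp⟩

theorem add {f g : M ⟶ N} (hf : FactorsThroughProjective f) (hg : FactorsThroughProjective g) :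
    FactorsThroughProjective (f + g) := by
  obtain ⟨P, h1, h2, a, b, rfl⟩ := hf
  obtain ⟨Q, h3, h4, c, d, rfl⟩ := hg
  refine ⟨ModuleCat.of Γ (P × Q), inferInstance, inferInstance,
    ModuleCat.ofHom (a.hom.prod c.hom), ModuleCat.ofHom (b.hom.coprod d.hom), ?_⟩
  ext x
  simp

theorem comp_left (h : L ⟶ M) {f : M ⟶ N} (hf : FactorsThroughProjective f) :
    FactorsThroughProjective (h ≫ f) := by
  obtain ⟨P, h1, h2, a, b, rfl⟩ := hf
  exact ⟨P, h1, h2, h ≫ a, b, by simp⟩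

theorem comp_right {f : L ⟶ M} (hf : FactorsThroughProjective f) (h : M ⟶ N) :
    FactorsThroughProjective (f ≫ h) := by
  obtain ⟨P, h1, h2, a, b, rfl⟩ := hf
  exact ⟨P, h1, h2, a, b ≫ h, by simp⟩

theorem smul {K : Type u} [Field K] [Algebra K Γ] (r : K) {f : M ⟶ N}
    (hf : FactorsThroughProjective f) : FactorsThroughProjective (r • f) := by
  obtain ⟨P, h1, h2, a, b, rfl⟩ := hf
  exact ⟨P, h1, h2, r • a, b, by simp⟩

end FactorsThroughProjective

variable (Γ)

/-- Two homomorphisms are stably equal if their difference factors through a projective. -/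
def stableRel : HomRel (GProj Γ) := fun _ _ f g => FactorsThroughProjective (f.hom - g.hom)

variable {Γ} in
theorem stableRel_iff {X Y : GProj Γ} (f g : X ⟶ Y) :
    stableRel Γ f g ↔ FactorsThroughProjective (f.hom - g.hom) := Iff.rfl

instance : Congruence (stableRel Γ) where
  equivalence :=
    { refl := fun f => by rw [stableRel_iff, sub_self]; exact .zero
      symm := fun {f g} h => by
        rw [stableRel_iff] at h ⊢
        simpa using h.neg
      trans := fun {f g k} h h' => by
        rw [stableRel_iff] at h h' ⊢
        simpa using h.add h' }
  comp_left f g g' h := by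
    rw [stableRel_iff] at h ⊢
    simpa using h.comp_left f.hom
  comp_right g h := by
    rw [stableRel_iff] at h ⊢
    simpa using h.comp_right g.hom

/-- The stable category of Gorenstein projective left `Γ`-modules. -/
def StableGProj : Type (u + 1) := CategoryTheory.Quotient (stableRel Γ)

namespace StableGProj

instance : Category.{u} (StableGProj Γ) :=
  inferInstanceAs (Category (CategoryTheory.Quotient (stableRel Γ)))

/-- The projection from Gorenstein projective modules to their stable category. -/
def proj : GProj Γ ⥤ StableGProj Γ := CategoryTheory.Quotient.functor (stableRel Γ)

theorem stableRel_add {X Y : GProj Γ} (f₁ f₂ g₁ g₂ : X ⟶ Y) (h : stableRel Γ f₁ f₂)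
    (h' : stableRel Γ g₁ g₂) : stableRel Γ (f₁ + g₁) (f₂ + g₂) := by
  rw [stableRel_iff] at h h' ⊢
  convert h.add h' using 1
  exact add_sub_add_comm f₁.hom g₁.hom f₂.hom g₂.hom

instance : Preadditive (StableGProj Γ) :=
  CategoryTheory.Quotient.preadditive (stableRel Γ) (fun _ _ => stableRel_add Γ)

instance : (proj Γ).Additive :=
  CategoryTheory.Quotient.functor_additive (stableRel Γ) (fun _ _ => stableRel_add Γ)

instance (K : Type u) [Field K] [Algebra K Γ] : Linear K (StableGProj Γ) :=
  letI : Preadditive (CategoryTheory.Quotient (stableRel Γ)) :=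
    inferInstanceAs (Preadditive (StableGProj Γ))
  letI : (CategoryTheory.Quotient.functor (stableRel Γ)).Additive :=
    inferInstanceAs ((proj Γ).Additive)
  CategoryTheory.Quotient.linear K (stableRel Γ) (fun r X Y f g h => by
    rw [stableRel_iff] at h ⊢
    convert h.smul r using 1
    rw [smul_sub]
    rfl)

end StableGProj

/-! ## The suspension of the stable category -/

/-- An exact sequence `0 → X → J → S → 0` with `J` finitely generated projective and `S`
Gorenstein projective; every homomorphism from `X` to a finitely generated projective module
extends to `J`.  Such a sequence exists for every `X` (see `nonempty_cosyzygy`). -/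
structure Cosyzygy {Γ : Type u} [Ring Γ] (X : GProj Γ) where
  J : ModuleCat.{u} Γ
  S : GProj Γ
  ι : X.obj ⟶ J
  π : J ⟶ S.obj
  finite : Module.Finite Γ J
  projective : Module.Projective Γ J
  injective : Function.Injective ι.hom
  exact : Function.Exact ι.hom π.hom
  surjective : Function.Surjective π.hom
  extend : ∀ (Q : ModuleCat.{u} Γ), Module.Finite Γ Q → Module.Projective Γ Q →
    ∀ f : X.obj ⟶ Q, ∃ g : J ⟶ Q, ι ≫ g = f

section Suspension

variable {Γ}

theorem exists_desc {A B C N : ModuleCat.{u} Γ} {i : A ⟶ B} {p : B ⟶ C}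
    (hip : Function.Exact i.hom p.hom) (hp : Function.Surjective p.hom) (k : B ⟶ N)
    (hk : i ≫ k = 0) : ∃ s : C ⟶ N, p ≫ s = k := by
  have hle : LinearMap.ker p.hom ≤ LinearMap.ker k.hom := by
    intro x hx
    obtain ⟨y, rfl⟩ := (hip x).1 hx
    have := congrArg (fun f => f.hom y) hk
    simpa using this
  refine ⟨ModuleCat.ofHom (((LinearMap.ker p.hom).liftQ k.hom hle).comp
    (LinearMap.quotKerEquivOfSurjective p.hom hp).symm.toLinearMap), ?_⟩
  ext x
  have h : (LinearMap.quotKerEquivOfSurjective p.hom hp).symm (p.hom x) =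
      (LinearMap.ker p.hom).mkQ x := by
    rw [LinearEquiv.symm_apply_eq]
    rfl
  simp only [ModuleCat.hom_comp, ModuleCat.hom_ofHom, LinearMap.comp_apply,
    LinearEquiv.coe_coe, h, Submodule.mkQ_apply, Submodule.liftQ_apply]

theorem nonempty_cosyzygy (X : GProj Γ) : Nonempty (Cosyzygy X) := by
  obtain ⟨P, d, hfin, hproj, hex, hdual, ⟨e₀⟩⟩ := X.property
  have hker : ∀ m : ℤ, m = 0 → Nonempty (X.obj ≃ₗ[Γ] LinearMap.ker (d m)) := by
    rintro _ rfl
    exact ⟨e₀⟩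
  have hker' : ∀ m : ℤ, m = 0 + 1 →
      Nonempty (LinearMap.ker (d m) ≃ₗ[Γ] LinearMap.ker (d (0 + 1))) := by
    rintro _ rfl
    exact ⟨LinearEquiv.refl _ _⟩
  obtain ⟨n, hn⟩ : ∃ n : ℤ, n + 1 + 1 = 0 := ⟨-2, by norm_num⟩
  obtain ⟨e⟩ := hker (n + 1 + 1) hn
  have hS : IsGorensteinProjective Γ (ModuleCat.of Γ (LinearMap.ker (d (n + 1 + 1 + 1)))) :=
    ⟨fun k => P (k + 1), fun k => d (k + 1), fun k => hfin _, fun k => hproj _,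
      fun k => hex _, fun k => hdual _, hker' _ (by rw [hn])⟩
  have hdd : ∀ x, d (n + 1 + 1 + 1) (d (n + 1 + 1) x) = 0 := fun x =>
    (hex (n + 1 + 1)).apply_apply_eq_zero x
  let i : X.obj →ₗ[Γ] P (n + 1 + 1) := (LinearMap.ker (d (n + 1 + 1))).subtype ∘ₗ e.toLinearMap
  have hi : ∀ x, d (n + 1 + 1) (i x) = 0 := fun x => (e x).2
  have hi' : ∀ z : P (n + 1 + 1), d (n + 1 + 1) z = 0 → ∃ x, i x = z := fun z hz =>
    ⟨e.symm ⟨z, hz⟩, by simp [i]⟩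
  have hinj : Function.Injective i := Subtype.val_injective.comp e.injective
  -- extension of homomorphisms with values in `Γ`
  have key : ∀ f : X.obj →ₗ[Γ] Γ, ∃ g : P (n + 1 + 1) →ₗ[Γ] Γ, g ∘ₗ i = f := by
    intro f
    let q : P (n + 1) →ₗ[Γ] X.obj := e.symm.toLinearMap ∘ₗ
      (LinearMap.codRestrict (LinearMap.ker (d (n + 1 + 1))) (d (n + 1))
        (fun x => (hex (n + 1)).apply_apply_eq_zero x))
    have hiq : ∀ x, i (q x) = d (n + 1) x := fun x => by
      simp only [i, q, LinearMap.comp_apply, LinearEquiv.coe_coe, LinearEquiv.apply_symm_apply]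
      rfl
    have hfq : (f ∘ₗ q) ∘ₗ d n = 0 := by
      ext x
      have : q (d n x) = 0 := by
        apply hinj
        rw [hiq, map_zero]
        exact (hex n).apply_apply_eq_zero x
      simp [this]
    obtain ⟨g, hg⟩ := (hdual n (f ∘ₗ q)).1 hfq
    have hg' : ∀ x, g (d (n + 1) x) = f (q x) := fun x => LinearMap.congr_fun hg x
    refine ⟨g, ?_⟩
    ext x
    obtain ⟨y, hy⟩ := (hex (n + 1) (i x)).1 (hi x)
    have hxy : q y = x := by
      apply hinj
      rw [hiq]
      exact hy
    change g (i x) = f x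
    rw [← hxy, hiq, hg']
  refine ⟨{
    J := P (n + 1 + 1)
    S := ⟨ModuleCat.of Γ (LinearMap.ker (d (n + 1 + 1 + 1))), hS⟩
    ι := ModuleCat.ofHom i
    π := ModuleCat.ofHom (LinearMap.codRestrict (LinearMap.ker (d (n + 1 + 1 + 1))) (d (n + 1 + 1)) hdd)
    finite := hfin _
    projective := hproj _
    injective := hinj
    exact := ?_
    surjective := ?_
    extend := ?_ }⟩
  · intro z
    constructor
    · intro hz
      exact hi' z (congrArg Subtype.val hz)
    · rintro ⟨x, rfl⟩
      exact Subtype.ext (hi x)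
  · rintro ⟨z, hz⟩
    obtain ⟨y, hy⟩ := (hex (n + 1 + 1) z).1 hz
    exact ⟨y, Subtype.ext hy⟩
  · intro Q hQ hQ' f
    obtain ⟨r, p, hp⟩ := Module.Finite.exists_fin' Γ Q
    obtain ⟨s, hs⟩ := Module.projective_lifting_property p LinearMap.id hp
    choose g hg using fun j : Fin r => key (LinearMap.proj j ∘ₗ s ∘ₗ f.hom)
    refine ⟨ModuleCat.ofHom (p ∘ₗ LinearMap.pi g), ?_⟩
    ext x
    have h1 : LinearMap.pi g (i x) = s (f.hom x) := by
      funext j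
      exact LinearMap.congr_fun (hg j) x
    change p (LinearMap.pi g (i x)) = f.hom x
    rw [h1]
    exact LinearMap.congr_fun hs _

/-- A chosen sequence `0 → X → J → S → 0`. -/
def cosyzygy (X : GProj Γ) : Cosyzygy X := (nonempty_cosyzygy X).some

namespace Cosyzygy

variable {X Y Z : GProj Γ}

theorem ι_π (c : Cosyzygy X) : c.ι ≫ c.π = 0 := by
  ext x
  exact c.exact.apply_apply_eq_zero x

theorem hom_ext_π (c : Cosyzygy X) {N : ModuleCat.{u} Γ} {s t : c.S.obj ⟶ N}
    (h : c.π ≫ s = c.π ≫ t) : s = t := by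
  ext y
  obtain ⟨x, rfl⟩ := c.surjective y
  exact congrArg (fun f => f.hom x) h

/-- The homomorphism `s` of cosyzygies is induced by `f`, through a morphism of the two exact
sequences. -/
def Induces (c : Cosyzygy X) (c' : Cosyzygy Y) (f : X ⟶ Y) (s : c.S ⟶ c'.S) : Prop :=
  ∃ e : c.J ⟶ c'.J, c.ι ≫ e = f.hom ≫ c'.ι ∧ c.π ≫ s.hom = e ≫ c'.π

theorem exists_induces (c : Cosyzygy X) (c' : Cosyzygy Y) (f : X ⟶ Y) :
    ∃ s : c.S ⟶ c'.S, Induces c c' f s := by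
  obtain ⟨e, he⟩ := c.extend c'.J c'.finite c'.projective (f.hom ≫ c'.ι)
  obtain ⟨s, hs⟩ := exists_desc c.exact c.surjective (e ≫ c'.π) (by
    rw [← Category.assoc, he, Category.assoc, ι_π, Limits.comp_zero])
  exact ⟨ObjectProperty.homMk s, e, he, hs⟩

theorem Induces.id (c : Cosyzygy X) : Induces c c (𝟙 X) (𝟙 c.S) :=
  ⟨𝟙 _, by simp, by simp⟩

theorem Induces.comp {c : Cosyzygy X} {c' : Cosyzygy Y} {c'' : Cosyzygy Z} {f : X ⟶ Y}
    {g : Y ⟶ Z} {s : c.S ⟶ c'.S} {t : c'.S ⟶ c''.S} (h : Induces c c' f s)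
    (h' : Induces c' c'' g t) : Induces c c'' (f ≫ g) (s ≫ t) := by
  obtain ⟨e, he, he'⟩ := h
  obtain ⟨k, hk, hk'⟩ := h'
  refine ⟨e ≫ k, ?_, ?_⟩
  · rw [← Category.assoc, he, Category.assoc, hk, ObjectProperty.FullSubcategory.comp_hom,
      Category.assoc]
  · rw [ObjectProperty.FullSubcategory.comp_hom, ← Category.assoc, he', Category.assoc, hk',
      Category.assoc]

/-- Stably equal homomorphisms induce stably equal homomorphisms of cosyzygies. -/
theorem Induces.stableRel {c : Cosyzygy X} {c' : Cosyzygy Y} {f g : X ⟶ Y} {s t : c.S ⟶ c'.S}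
    (hf : Induces c c' f s) (hg : Induces c c' g t) (hfg : stableRel Γ f g) :
    stableRel Γ s t := by
  obtain ⟨e, he, he'⟩ := hf
  obtain ⟨k, hk, hk'⟩ := hg
  obtain ⟨P, h1, h2, a, b, hab⟩ := hfg
  obtain ⟨a', ha'⟩ := c.extend P h1 h2 a
  obtain ⟨m, hm⟩ := exists_desc c.exact c.surjective (e - k - a' ≫ b ≫ c'.ι) (by
    rw [Preadditive.comp_sub, Preadditive.comp_sub, he, hk, ← Category.assoc c.ι, ha',
      ← Preadditive.sub_comp, hab, Category.assoc, sub_self])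
  refine ⟨c'.J, c'.finite, c'.projective, m, c'.π, c.hom_ext_π ?_⟩
  rw [← Category.assoc, hm, Preadditive.comp_sub, he', hk', Preadditive.sub_comp,
    Preadditive.sub_comp, Category.assoc, Category.assoc, ι_π]
  simp

end Cosyzygy

end Suspension

namespace StableGProj

/-- The map `f ↦ (the class of a homomorphism of cosyzygies induced by f)`. -/
def preSuspension : GProj Γ ⥤ StableGProj Γ where
  obj X := (proj Γ).obj (cosyzygy X).S
  map {X Y} f := (proj Γ).map ((cosyzygy X).exists_induces (cosyzygy Y) f).choose
  map_id X := by
    rw [← CategoryTheory.Functor.map_id]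
    exact CategoryTheory.Quotient.sound _
      (((cosyzygy X).exists_induces (cosyzygy X) (𝟙 X)).choose_spec.stableRel
        (Cosyzygy.Induces.id _) (Congruence.equivalence.refl _))
  map_comp {X Y Z} f g := by
    rw [← CategoryTheory.Functor.map_comp]
    exact CategoryTheory.Quotient.sound _
      (((cosyzygy X).exists_induces (cosyzygy Z) (f ≫ g)).choose_spec.stableRel
        (((cosyzygy X).exists_induces (cosyzygy Y) f).choose_spec.comp
          ((cosyzygy Y).exists_induces (cosyzygy Z) g).choose_spec)
        (Congruence.equivalence.refl _))

/-- The suspension functor `X ↦ S` of the stable category, for `0 → X → J → S → 0`. -/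
def suspension : StableGProj Γ ⥤ StableGProj Γ :=
  CategoryTheory.Quotient.lift (stableRel Γ) (preSuspension Γ) (fun X Y f g h =>
    CategoryTheory.Quotient.sound _
      (((cosyzygy X).exists_induces (cosyzygy Y) f).choose_spec.stableRel
        ((cosyzygy X).exists_induces (cosyzygy Y) g).choose_spec h))

end StableGProj

/-! ## Triangles and triangle equivalences -/

/-- A diagram `X ⟶ Y ⟶ Z ⟶ T X` for an endofunctor `T`. -/
structure SuspTriangle {C : Type*} [Category* C] (T : C ⥤ C) where
  {obj₁ obj₂ obj₃ : C}
  mor₁ : obj₁ ⟶ obj₂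
  mor₂ : obj₂ ⟶ obj₃
  mor₃ : obj₃ ⟶ T.obj obj₁

/-- Two such diagrams are isomorphic. -/
def SuspTriangle.IsIsomorphic {C : Type*} [Category* C] {T : C ⥤ C} (s t : SuspTriangle T) :
    Prop :=
  ∃ (a : s.obj₁ ≅ t.obj₁) (b : s.obj₂ ≅ t.obj₂) (c : s.obj₃ ≅ t.obj₃),
    s.mor₁ ≫ b.hom = a.hom ≫ t.mor₁ ∧ s.mor₂ ≫ c.hom = b.hom ≫ t.mor₂ ∧
    s.mor₃ ≫ T.map a.hom = c.hom ≫ t.mor₃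

/-- The data of a triangulated category: a suspension functor and the class of distinguished
triangles. -/
class TriangleData (C : Type*) [Category* C] where
  susp : C ⥤ C
  distinguished : Set (SuspTriangle susp)

/-- The standard triangle `X ⟶ Y ⟶ Z ⟶ ΣX` of an exact sequence `0 → X → Y → Z → 0` of Gorenstein
projective modules: the last morphism `w` is part of a morphism of exact sequences from
`0 → X → Y → Z → 0` to `0 → X → J → ΣX → 0` which is the identity on `X`. -/
inductive StableGProj.IsStandard : SuspTriangle (StableGProj.suspension Γ) → Prop
  | mk {X Y Z : GProj Γ} (f : X ⟶ Y) (g : Y ⟶ Z)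
      (injective : Function.Injective f.hom.hom) (exact : Function.Exact f.hom.hom g.hom.hom)
      (surjective : Function.Surjective g.hom.hom)
      (e : Y.obj ⟶ (cosyzygy X).J) (w : Z ⟶ (cosyzygy X).S)
      (he : f.hom ≫ e = (cosyzygy X).ι) (hw : g.hom ≫ w.hom = e ≫ (cosyzygy X).π) :
      StableGProj.IsStandard ⟨(proj Γ).map f, (proj Γ).map g, (proj Γ).map w⟩

/-- The triangulated structure of the stable category: the distinguished triangles are those
isomorphic to standard ones. -/
instance : TriangleData (StableGProj Γ) where
  susp := StableGProj.suspension Γ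
  distinguished := {t | ∃ s, StableGProj.IsStandard Γ s ∧ t.IsIsomorphic s}

section Coproduct

variable (C D : Type*) [Category* C] [Category* D]

/-- The coproduct of two preadditive categories is their product category. -/
instance [Preadditive C] [Preadditive D] : Preadditive (C × D) where
  homGroup X Y := inferInstanceAs (AddCommGroup ((X.1 ⟶ Y.1) × (X.2 ⟶ Y.2)))
  add_comp _ _ _ _ _ _ := Prod.ext (Preadditive.add_comp ..) (Preadditive.add_comp ..)
  comp_add _ _ _ _ _ _ := Prod.ext (Preadditive.comp_add ..) (Preadditive.comp_add ..)

instance (K : Type*) [Semiring K] [Preadditive C] [Preadditive D] [Linear K C] [Linear K D] :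
    Linear K (C × D) where
  homModule X Y := inferInstanceAs (Module K ((X.1 ⟶ Y.1) × (X.2 ⟶ Y.2)))
  smul_comp _ _ _ _ _ _ := Prod.ext (Linear.smul_comp ..) (Linear.smul_comp ..)
  comp_smul _ _ _ _ _ _ := Prod.ext (Linear.comp_smul ..) (Linear.comp_smul ..)

/-- In the coproduct, suspension and distinguished triangles are componentwise. -/
instance [TriangleData C] [TriangleData D] : TriangleData (C × D) where
  susp := (TriangleData.susp (C := C)).prod (TriangleData.susp (C := D))
  distinguished := {t |
    (⟨t.mor₁.1, t.mor₂.1, t.mor₃.1⟩ : SuspTriangle (TriangleData.susp (C := C))) ∈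
      TriangleData.distinguished ∧
    (⟨t.mor₁.2, t.mor₂.2, t.mor₃.2⟩ : SuspTriangle (TriangleData.susp (C := D))) ∈
      TriangleData.distinguished}

end Coproduct

/-- A `K`-linear triangle equivalence: a `K`-linear equivalence with a natural isomorphism
`F Σ ≅ Σ F` such that distinguished triangles are sent to distinguished triangles. -/
structure TriangleEquivalence (K : Type*) [Semiring K] (C D : Type*) [Category* C] [Category* D]
    [Preadditive C] [Preadditive D] [Linear K C] [Linear K D] [TriangleData C] [TriangleData D]
    where
  equiv : C ≌ D
  additive : equiv.functor.Additive
  linear : equiv.functor.Linear K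
  commSusp : TriangleData.susp ⋙ equiv.functor ≅ equiv.functor ⋙ TriangleData.susp
  map_distinguished : ∀ t : SuspTriangle (TriangleData.susp (C := C)),
    t ∈ TriangleData.distinguished →
      (⟨equiv.functor.map t.mor₁, equiv.functor.map t.mor₂,
        equiv.functor.map t.mor₃ ≫ commSusp.hom.app t.obj₁⟩ :
          SuspTriangle (TriangleData.susp (C := D))) ∈ TriangleData.distinguished

end

noncomputable section

/-! ## Totally acyclic complexes -/

/-! Write `ε_B` and `ε_C` for the images in `Λ` of the units of `B` and `C`, `e` and `f` for the
idempotents of the vertices `v` and `w`, and `M = ε_B Λ ε_C`. A path of `Q` crosses the new arrow at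
most once and only from `Q''` to `Q'`. Hence `ε_C Λ ε_B = 0` and `M = Be ⊗_K fC`. For every
`C`-module `W` the induced module `Λ ⊗_C W` is `(Be ⊗ fW) ⊕ W` as a vector space. The first summand
is a projective `B`-module, finitely generated when `W` is, because `fW` is then finite-dimensional.
The functor `W ↦ Λ ⊗ W` is exact because `K` is a field. The presentation of `Λ` by `B`, `C` and one
arrow is isolated in `OneArrowExtension`, and `gluedExtension` shows that the glued quiver algebra
has it.

A `Λ`-module `X` has two reductions: `X_C ≅ ε_C X`, which is exact in `X`, and `X_B = X / Λ ε_C X`,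
the cokernel of the counit `Λ ⊗ X_C → X`. The counit is injective when `X` is projective, hence when
`X` is a submodule of a projective, hence when `X` is Gorenstein projective. On modules with
injective counit, `X ↦ X_B` behaves like an exact functor (`mapB_exact`). Both reductions therefore
send totally acyclic complexes to exact complexes. Exactness after dualizing follows from
adjunction, since `B` is projective as a `Λ`-module and `C` has a resolution by finitely generated
projectives of length one. So both reductions induce triangle functors on stable categories
(`isStablyExact_cornerB`, `isStablyExact_cornerC`). In the other direction, a `B`-module viewed as a
`Λ`-module, and `Λ ⊗ W` for a `C`-module `W`, are Gorenstein projective if the given module is.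

The decisive point is that `0 → Λ ⊗ X_C → X → X_B → 0` splits for Gorenstein projective `X`
(`exists_splitting`). The kernel of `X → X_C` is an extension of `X_B` by `Be ⊗ f X_C`, a finitely
generated projective, and such an extension splits because `X_B` is Gorenstein projective. With
respect to `X ≅ X_B ⊕ Λ ⊗ X_C`, a homomorphism is a two by two matrix. There are no nonzero maps `Λ
⊗ X_C → Y_B`, and every map `X_B → Λ ⊗ Y_C` factors through the projective `Be ⊗ f Y_C`. Stably only
the diagonal remains, so the pair of reductions is full and faithful. It is dense because `U ⊕ Λ ⊗
W` reduces to `U` and `W`. -/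

/-- An exact complex of finitely generated projective modules which stays exact under
`Hom(-, Γ)`. -/
structure IsTotallyAcyclic (Γ : Type u) [Ring Γ] (P : ℤ → ModuleCat.{u} Γ)
    (d : ∀ n : ℤ, P n →ₗ[Γ] P (n + 1)) : Prop where
  finite : ∀ n, Module.Finite Γ (P n)
  projective : ∀ n, Module.Projective Γ (P n)
  exact : ∀ n, Function.Exact (d n) (d (n + 1))
  dual : ∀ n (g : P (n + 1) →ₗ[Γ] Γ), g ∘ₗ d n = 0 → ∃ h : P (n + 1 + 1) →ₗ[Γ] Γ, h ∘ₗ d (n + 1) = g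

theorem IsTotallyAcyclic.isGorensteinProjective {Γ : Type u} [Ring Γ] {P : ℤ → ModuleCat.{u} Γ}
    {d : ∀ n : ℤ, P n →ₗ[Γ] P (n + 1)} (h : IsTotallyAcyclic Γ P d) {G : ModuleCat.{u} Γ}
    (e : G ≃ₗ[Γ] LinearMap.ker (d 0)) : IsGorensteinProjective Γ G := by
  refine ⟨P, d, h.finite, h.projective, h.exact, fun n g => ⟨h.dual n g, ?_⟩, ⟨e⟩⟩
  rintro ⟨k, rfl⟩
  ext x
  simp [(h.exact n).apply_apply_eq_zero x]

theorem IsGorensteinProjective.exists_isTotallyAcyclic {Γ : Type u} [Ring Γ] {G : ModuleCat.{u} Γ}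
    (hG : IsGorensteinProjective Γ G) : ∃ (P : ℤ → ModuleCat.{u} Γ)
      (d : ∀ n : ℤ, P n →ₗ[Γ] P (n + 1)),
      IsTotallyAcyclic Γ P d ∧ Nonempty (G ≃ₗ[Γ] LinearMap.ker (d 0)) := by
  obtain ⟨P, d, h1, h2, h3, h4, h5⟩ := hG
  exact ⟨P, d, ⟨h1, h2, h3, fun n g hg => (h4 n g).1 hg⟩, h5⟩

/-- `Q` is a direct summand of some `Γ ^ r`, so the extension problem reduces to its `r`
coordinates, which have values in `Γ`. -/
theorem IsTotallyAcyclic.dual_projective {Γ : Type u} [Ring Γ] {P : ℤ → ModuleCat.{u} Γ}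
    {d : ∀ n : ℤ, P n →ₗ[Γ] P (n + 1)} (h : IsTotallyAcyclic Γ P d) {Q : Type*} [AddCommGroup Q]
    [Module Γ Q] [Module.Finite Γ Q] [Module.Projective Γ Q] (n : ℤ) (g : P (n + 1) →ₗ[Γ] Q)
    (hg : g ∘ₗ d n = 0) : ∃ h : P (n + 1 + 1) →ₗ[Γ] Q, h ∘ₗ d (n + 1) = g := by
  obtain ⟨r, p, hp⟩ := Module.Finite.exists_fin' Γ Q
  obtain ⟨s, hs⟩ := Module.projective_lifting_property p LinearMap.id hp
  choose k hk using fun j : Fin r => h.dual n (LinearMap.proj j ∘ₗ s ∘ₗ g) (by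
    rw [LinearMap.comp_assoc, LinearMap.comp_assoc, hg]
    simp)
  refine ⟨p ∘ₗ LinearMap.pi k, ?_⟩
  ext x
  have h1 : LinearMap.pi k (d (n + 1) x) = s (g x) := by
    funext j
    exact LinearMap.congr_fun (hk j) x
  change p (LinearMap.pi k (d (n + 1) x)) = g x
  rw [h1]
  exact LinearMap.congr_fun hs _

/-- A linear map factors over a surjection whose kernel it annihilates. -/
theorem LinearMap.exists_comp_eq_of_ker_le {Γ X Y Z : Type*} [Ring Γ] [AddCommGroup X] [Module Γ X]
    [AddCommGroup Y] [Module Γ Y] [AddCommGroup Z] [Module Γ Z] (p : X →ₗ[Γ] Y)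
    (hp : Function.Surjective p) (k : X →ₗ[Γ] Z) (hk : ∀ x, p x = 0 → k x = 0) :
    ∃ s : Y →ₗ[Γ] Z, s ∘ₗ p = k := by
  refine ⟨((LinearMap.ker p).liftQ k hk).comp (p.quotKerEquivOfSurjective hp).symm.toLinearMap, ?_⟩
  ext x
  have h : (p.quotKerEquivOfSurjective hp).symm (p x) = (LinearMap.ker p).mkQ x := by
    rw [LinearEquiv.symm_apply_eq]
    rfl
  change (LinearMap.ker p).liftQ k hk ((p.quotKerEquivOfSurjective hp).symm (p x)) = k x
  rw [h]
  exact Submodule.liftQ_apply _ _ _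

/-- A Gorenstein projective module is the end of an exact sequence of projectives which stays exact
under `Hom(-, Q)`, for `Q` finitely generated projective. -/
theorem IsGorensteinProjective.exists_presentation {Γ : Type u} [Ring Γ] {Z : ModuleCat.{u} Γ}
    (hZ : IsGorensteinProjective Γ Z) : ∃ (P₀ P₁ P₂ : ModuleCat.{u} Γ) (a : P₂ →ₗ[Γ] P₁)
      (b : P₁ →ₗ[Γ] P₀) (c : P₀ →ₗ[Γ] Z), Module.Finite Γ P₀ ∧ Module.Projective Γ P₀ ∧
      Module.Projective Γ P₁ ∧ Function.Exact a b ∧ Function.Exact b c ∧ Function.Surjective c ∧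
      ∀ (Q : Type u) [AddCommGroup Q] [Module Γ Q] [Module.Finite Γ Q] [Module.Projective Γ Q]
        (g : P₁ →ₗ[Γ] Q), g ∘ₗ a = 0 → ∃ h : P₀ →ₗ[Γ] Q, h ∘ₗ b = g := by
  obtain ⟨P, d, h, ⟨e₀⟩⟩ := hZ.exists_isTotallyAcyclic
  have hker : ∀ m : ℤ, m = 0 → Nonempty (Z ≃ₗ[Γ] LinearMap.ker (d m)) := by
    rintro _ rfl
    exact ⟨e₀⟩
  -- The kernel of `d 0` is the image of `d (-1)`, so the presentation uses the terms in degrees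
  -- `-3`, `-2`, `-1`. Writing `0` as `n + 1 + 1 + 1` avoids transport between degrees.
  obtain ⟨n, hn⟩ : ∃ n : ℤ, n + 1 + 1 + 1 = 0 := ⟨-3, by norm_num⟩
  obtain ⟨e⟩ := hker (n + 1 + 1 + 1) hn
  have hdd : ∀ x, d (n + 1 + 1) x ∈ LinearMap.ker (d (n + 1 + 1 + 1)) :=
    fun x => (h.exact _).apply_apply_eq_zero x
  refine ⟨P (n + 1 + 1), P (n + 1), P n, d n, d (n + 1),
    e.symm.toLinearMap ∘ₗ LinearMap.codRestrict _ (d (n + 1 + 1)) hdd,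
    h.finite _, h.projective _, h.projective _, h.exact _, ?_, ?_, fun Q _ _ _ _ g hg =>
      h.dual_projective n g hg⟩
  · intro x
    rw [← h.exact (n + 1) x]
    simp [Subtype.ext_iff]
  · intro z
    obtain ⟨y, hy⟩ := (h.exact (n + 1 + 1) (e z)).1 (e z).2
    refine ⟨y, ?_⟩
    simp only [LinearMap.comp_apply, LinearEquiv.coe_coe, LinearEquiv.symm_apply_eq]
    exact Subtype.ext hy

/-- Homomorphisms into a finitely generated projective module extend along an injection with
Gorenstein projective cokernel. -/
theorem IsGorensteinProjective.exists_extension {Γ : Type u} [Ring Γ] {Z : ModuleCat.{u} Γ}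
    (hZ : IsGorensteinProjective Γ Z) {X Y Q : Type u} [AddCommGroup X] [Module Γ X]
    [AddCommGroup Y] [Module Γ Y] [AddCommGroup Q] [Module Γ Q] [Module.Finite Γ Q]
    [Module.Projective Γ Q] {i : X →ₗ[Γ] Y} {p : Y →ₗ[Γ] Z} (hi : Function.Injective i)
    (hip : Function.Exact i p) (hp : Function.Surjective p) (f : X →ₗ[Γ] Q) :
    ∃ g : Y →ₗ[Γ] Q, g ∘ₗ i = f := by
  obtain ⟨P₀, P₁, P₂, a, b, c, _, _, _, hab, hbc, hc, hQ⟩ := hZ.exists_presentation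
  -- Lifting `c` to `Y` presents `Y` as the quotient of `X × P₀` by the pairs `(-v y, b y)`. A map
  -- on `Y` extending `f` is then a map `k` on `P₀` with `k ∘ b = f ∘ v`, and the exactness of the
  -- dual sequence provides it because `v ∘ a = 0`.
  obtain ⟨u, hu⟩ := Module.projective_lifting_property p c hp
  have hu' : ∀ x, p (u x) = c x := LinearMap.congr_fun hu
  obtain ⟨v, hv⟩ : ∃ v : P₁ →ₗ[Γ] X, ∀ x, i (v x) = u (b x) := by
    let e := LinearEquiv.ofInjective i hi
    have hr : ∀ x, u (b x) ∈ LinearMap.range i := fun x =>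
      (hip _).1 (by rw [hu', hbc.apply_apply_eq_zero])
    refine ⟨e.symm.toLinearMap ∘ₗ LinearMap.codRestrict _ (u ∘ₗ b) hr, fun x => ?_⟩
    exact congrArg Subtype.val (e.apply_symm_apply ⟨u (b x), hr x⟩)
  obtain ⟨k, hk⟩ := hQ Q (f ∘ₗ v) (by
    ext x
    have : v (a x) = 0 := hi (by rw [hv, hab.apply_apply_eq_zero, map_zero, map_zero])
    simp [this])
  have hk' : ∀ x, k (b x) = f (v x) := LinearMap.congr_fun hk
  have hsurj : Function.Surjective (i.coprod u) := fun y => by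
    obtain ⟨z, hz⟩ := hc (p y)
    obtain ⟨x, hx⟩ := (hip (y - u z)).1 (by rw [map_sub, hu', hz, sub_self])
    exact ⟨(x, z), by simp [hx]⟩
  obtain ⟨g, hg⟩ := LinearMap.exists_comp_eq_of_ker_le _ hsurj (f.coprod k) (by
    rintro ⟨x, z⟩ h
    simp only [LinearMap.coprod_apply] at h ⊢
    have hz : c z = 0 := by
      have h0 : p (i x) = 0 := hip.apply_apply_eq_zero x
      have h1 : p (i x + u z) = 0 := by rw [h, map_zero]
      rwa [map_add, h0, zero_add, hu'] at h1
    obtain ⟨y, rfl⟩ := (hbc z).1 hz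
    have : x + v y = 0 := hi (by rw [map_add, hv, h, map_zero])
    rw [hk', ← map_add, this, map_zero])
  refine ⟨g, ?_⟩
  ext x
  simpa using LinearMap.congr_fun hg (x, 0)

/-! ## Functors between stable categories -/

/-- A functor on modules which preserves Gorenstein projective modules, finitely generated
projective modules and exact sequences ending in a Gorenstein projective module. -/
structure IsStablyExact {Λ A : Type u} [Ring Λ] [Ring A] (H : ModuleCat.{u} Λ ⥤ ModuleCat.{u} A) :
    Prop where
  gproj : ∀ G, IsGorensteinProjective Λ G → IsGorensteinProjective A (H.obj G)
  finite : ∀ P : ModuleCat.{u} Λ, Module.Finite Λ P → Module.Projective Λ P → Module.Finite A (H.obj P)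
  projective : ∀ P : ModuleCat.{u} Λ, Module.Finite Λ P → Module.Projective Λ P → Module.Projective A (H.obj P)
  exact : ∀ {X Y Z : ModuleCat.{u} Λ} (f : X ⟶ Y) (g : Y ⟶ Z), IsGorensteinProjective Λ Z →
    Function.Injective f.hom → Function.Exact f.hom g.hom → Function.Surjective g.hom →
    Function.Injective (H.map f).hom ∧ Function.Exact (H.map f).hom (H.map g).hom ∧
      Function.Surjective (H.map g).hom

namespace IsStablyExact

variable {Λ A : Type u} [Ring Λ] [Ring A] {H : ModuleCat.{u} Λ ⥤ ModuleCat.{u} A}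

/-- The restriction to Gorenstein projective modules. -/
def gprojFunctor (h : IsStablyExact H) : GProj Λ ⥤ GProj A :=
  (gprojProperty A).lift ((gprojProperty Λ).ι ⋙ H) fun X => h.gproj _ X.property

theorem factorsThroughProjective (h : IsStablyExact H) {M N : ModuleCat.{u} Λ} {f : M ⟶ N}
    (hf : FactorsThroughProjective f) : FactorsThroughProjective (H.map f) := by
  obtain ⟨P, h1, h2, a, b, rfl⟩ := hf
  exact ⟨H.obj P, h.finite P h1 h2, h.projective P h1 h2, H.map a, H.map b, H.map_comp _ _⟩

theorem stableRel_map [H.Additive] (h : IsStablyExact H) {X Y : GProj Λ} {f g : X ⟶ Y}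
    (hfg : stableRel Λ f g) : stableRel A (h.gprojFunctor.map f) (h.gprojFunctor.map g) := by
  rw [stableRel_iff] at hfg ⊢
  have := h.factorsThroughProjective hfg
  rwa [H.map_sub] at this

/-- The induced functor on stable categories. -/
def stableFunctor [H.Additive] (h : IsStablyExact H) : StableGProj Λ ⥤ StableGProj A :=
  CategoryTheory.Quotient.lift (stableRel Λ) (h.gprojFunctor ⋙ StableGProj.proj A)
    fun _ _ _ _ hfg => CategoryTheory.Quotient.sound _ (h.stableRel_map hfg)

/-- The image of a cosyzygy. -/
def mapCosyzygy (h : IsStablyExact H) {X : GProj Λ} (c : Cosyzygy X) :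
    Cosyzygy (h.gprojFunctor.obj X) where
  J := H.obj c.J
  S := h.gprojFunctor.obj c.S
  ι := H.map c.ι
  π := H.map c.π
  finite := h.finite _ c.finite c.projective
  projective := h.projective _ c.finite c.projective
  injective := (h.exact c.ι c.π c.S.property c.injective c.exact c.surjective).1
  exact := (h.exact c.ι c.π c.S.property c.injective c.exact c.surjective).2.1
  surjective := (h.exact c.ι c.π c.S.property c.injective c.exact c.surjective).2.2
  extend Q _ _ f := by
    obtain ⟨h1, h2, h3⟩ := h.exact c.ι c.π c.S.property c.injective c.exact c.surjective
    obtain ⟨g, hg⟩ := (h.gproj _ c.S.property).exists_extension h1 h2 h3 f.hom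
    exact ⟨ModuleCat.ofHom g, ModuleCat.hom_ext hg⟩

theorem mapCosyzygy_induces (h : IsStablyExact H) {X Y : GProj Λ} {c : Cosyzygy X}
    {c' : Cosyzygy Y} {f : X ⟶ Y} {s : c.S ⟶ c'.S} (hs : Cosyzygy.Induces c c' f s) :
    Cosyzygy.Induces (h.mapCosyzygy c) (h.mapCosyzygy c') (h.gprojFunctor.map f)
      (h.gprojFunctor.map s) := by
  obtain ⟨e, he, he'⟩ := hs
  exact ⟨H.map e, (H.map_comp _ _).symm.trans ((congrArg H.map he).trans (H.map_comp _ _)),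
    (H.map_comp _ _).symm.trans ((congrArg H.map he').trans (H.map_comp _ _))⟩

end IsStablyExact

namespace Cosyzygy

variable {Γ : Type u} [Ring Γ] {X Y : GProj Γ}

/-- The comparison of two cosyzygies of a module. -/
def compare (c c' : Cosyzygy X) : c.S ⟶ c'.S := (c.exists_induces c' (𝟙 X)).choose

theorem compare_induces (c c' : Cosyzygy X) : Induces c c' (𝟙 X) (compare c c') :=
  (c.exists_induces c' (𝟙 X)).choose_spec

theorem Induces.proj_eq {c : Cosyzygy X} {c' : Cosyzygy Y} {f : X ⟶ Y} {s t : c.S ⟶ c'.S}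
    (hs : Induces c c' f s) (ht : Induces c c' f t) :
    (StableGProj.proj Γ).map s = (StableGProj.proj Γ).map t :=
  CategoryTheory.Quotient.sound _ (hs.stableRel ht (Congruence.equivalence.refl _))

/-- Two cosyzygies of a module are stably isomorphic. -/
def compareIso (c c' : Cosyzygy X) :
    (StableGProj.proj Γ).obj c.S ≅ (StableGProj.proj Γ).obj c'.S where
  hom := (StableGProj.proj Γ).map (compare c c')
  inv := (StableGProj.proj Γ).map (compare c' c)
  hom_inv_id := by
    rw [← Functor.map_comp, ← CategoryTheory.Functor.map_id]
    have := (compare_induces c c').comp (compare_induces c' c)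
    rw [Category.comp_id] at this
    exact this.proj_eq (Induces.id c)
  inv_hom_id := by
    rw [← Functor.map_comp, ← CategoryTheory.Functor.map_id]
    have := (compare_induces c' c).comp (compare_induces c c')
    rw [Category.comp_id] at this
    exact this.proj_eq (Induces.id c')

end Cosyzygy

namespace IsStablyExact

variable {Λ A : Type u} [Ring Λ] [Ring A] {H : ModuleCat.{u} Λ ⥤ ModuleCat.{u} A} [H.Additive]

/-- The induced functor commutes with the suspensions. -/
def commSusp (h : IsStablyExact H) :
    StableGProj.suspension Λ ⋙ h.stableFunctor ≅ h.stableFunctor ⋙ StableGProj.suspension A :=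
  CategoryTheory.Quotient.natIsoLift (stableRel Λ) <|
    NatIso.ofComponents (fun X => (h.mapCosyzygy (cosyzygy X)).compareIso
      (cosyzygy (h.gprojFunctor.obj X))) <| by
      intro X Y f
      have h1 := (h.mapCosyzygy_induces ((cosyzygy X).exists_induces (cosyzygy Y) f).choose_spec).comp
        ((h.mapCosyzygy (cosyzygy Y)).compare_induces (cosyzygy (h.gprojFunctor.obj Y)))
      have h2 := ((h.mapCosyzygy (cosyzygy X)).compare_induces
        (cosyzygy (h.gprojFunctor.obj X))).comp
        ((cosyzygy (h.gprojFunctor.obj X)).exists_induces (cosyzygy (h.gprojFunctor.obj Y))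
          (h.gprojFunctor.map f)).choose_spec
      rw [Category.comp_id] at h1
      rw [Category.id_comp] at h2
      have h3 := h1.proj_eq h2
      exact ((StableGProj.proj A).map_comp _ _).symm.trans
        (h3.trans ((StableGProj.proj A).map_comp _ _))

/-- `H` keeps the defining exact sequence exact and carries its map to `0 → X → J → S → 0` to a map
to the image cosyzygy. Composing with the comparison to the chosen cosyzygy gives a standard
triangle, and that comparison is the component of `commSusp`. Triangles isomorphic to standard ones
are handled by naturality. -/
theorem map_distinguished (h : IsStablyExact H)
    (t : SuspTriangle (TriangleData.susp (C := StableGProj Λ)))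
    (ht : t ∈ TriangleData.distinguished) :
    (⟨h.stableFunctor.map t.mor₁, h.stableFunctor.map t.mor₂,
      h.stableFunctor.map t.mor₃ ≫ h.commSusp.hom.app t.obj₁⟩ :
        SuspTriangle (TriangleData.susp (C := StableGProj A))) ∈ TriangleData.distinguished := by
  obtain ⟨s, hs, a, b, c, h1, h2, h3⟩ := ht
  refine ⟨⟨h.stableFunctor.map s.mor₁, h.stableFunctor.map s.mor₂,
      h.stableFunctor.map s.mor₃ ≫ h.commSusp.hom.app s.obj₁⟩, ?_,
    h.stableFunctor.mapIso a, h.stableFunctor.mapIso b, h.stableFunctor.mapIso c, ?_, ?_, ?_⟩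
  · obtain ⟨f, g, hf, hfg, hg, e, w, he, hw⟩ := hs
    rename_i X Y Z
    obtain ⟨k, hk, hk'⟩ := (h.mapCosyzygy (cosyzygy X)).compare_induces
      (cosyzygy (h.gprojFunctor.obj X))
    obtain ⟨e1, e2, e3⟩ := h.exact f.hom g.hom Z.property hf hfg hg
    have hk1 : H.map (cosyzygy X).ι ≫ k = (cosyzygy (h.gprojFunctor.obj X)).ι :=
      hk.trans (Category.id_comp _)
    -- `k` is the middle map of the comparison of cosyzygies. It is the identity on the image of
    -- `X`, so `H.map e ≫ k` extends the chosen embedding.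
    refine StableGProj.IsStandard.mk (h.gprojFunctor.map f) (h.gprojFunctor.map g) e1 e2 e3
      (H.map e ≫ k) (h.gprojFunctor.map w ≫ (h.mapCosyzygy (cosyzygy X)).compare _) ?_ ?_
    · refine Eq.trans (Category.assoc _ _ _).symm (Eq.trans ?_ hk1)
      exact congrArg (· ≫ k) ((H.map_comp _ _).symm.trans (congrArg H.map he))
    · refine Eq.trans ?_ ((congrArg (H.map e ≫ ·) hk').trans (Category.assoc _ _ _).symm)
      refine Eq.trans (Category.assoc _ _ _).symm (Eq.trans ?_ (Category.assoc _ _ _))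
      exact congrArg (· ≫ ((h.mapCosyzygy (cosyzygy X)).compare _).hom)
        ((H.map_comp _ _).symm.trans ((congrArg H.map hw).trans (H.map_comp _ _)))
  · exact (h.stableFunctor.map_comp _ _).symm.trans
      ((congrArg h.stableFunctor.map h1).trans (h.stableFunctor.map_comp _ _))
  · exact (h.stableFunctor.map_comp _ _).symm.trans
      ((congrArg h.stableFunctor.map h2).trans (h.stableFunctor.map_comp _ _))
  · have h4 := (congrArg h.stableFunctor.map h3)
    rw [Functor.map_comp, Functor.map_comp] at h4
    have h5 := h.commSusp.hom.naturality a.hom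
    dsimp only [Functor.mapIso_hom]
    change (h.stableFunctor.map t.mor₃ ≫ h.commSusp.hom.app t.obj₁) ≫
      (h.stableFunctor ⋙ StableGProj.suspension A).map a.hom =
      h.stableFunctor.map c.hom ≫ h.stableFunctor.map s.mor₃ ≫ h.commSusp.hom.app s.obj₁
    rw [Category.assoc, ← h5, ← Category.assoc]
    erw [h4]
    rw [Category.assoc]

theorem stableFunctor_additive (h : IsStablyExact H) : h.stableFunctor.Additive where
  map_add {X Y f g} := by
    obtain ⟨f, rfl⟩ := (CategoryTheory.Quotient.functor (stableRel Λ)).map_surjective f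
    obtain ⟨g, rfl⟩ := (CategoryTheory.Quotient.functor (stableRel Λ)).map_surjective g
    have h1 : h.gprojFunctor.map (f + g) = h.gprojFunctor.map f + h.gprojFunctor.map g :=
      ObjectProperty.hom_ext _ (H.map_add (f := f.hom) (g := g.hom))
    exact (congrArg h.stableFunctor.map ((StableGProj.proj Λ).map_add (f := f) (g := g)).symm).trans
      ((congrArg (StableGProj.proj A).map h1).trans (StableGProj.proj A).map_add)

theorem stableFunctor_linear (K : Type u) [Field K] [Algebra K Λ] [Algebra K A] [H.Linear K]
    (h : IsStablyExact H) : h.stableFunctor.Linear K where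
  map_smul {X Y} f r := by
    obtain ⟨f, rfl⟩ := (CategoryTheory.Quotient.functor (stableRel Λ)).map_surjective f
    have h1 : h.gprojFunctor.map (r • f) = r • h.gprojFunctor.map f :=
      ObjectProperty.hom_ext _ (CategoryTheory.Functor.map_smul H r f.hom)
    exact congrArg (StableGProj.proj A).map h1

/-- Turns faithfulness of the stable functors into a statement about factorizations of module
homomorphisms. -/
theorem stableFunctor_map_eq_iff (h : IsStablyExact H) {X Y : GProj Λ} (f g : X ⟶ Y) :
    h.stableFunctor.map ((StableGProj.proj Λ).map f) =
      h.stableFunctor.map ((StableGProj.proj Λ).map g) ↔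
    FactorsThroughProjective (H.map (f.hom - g.hom)) := by
  rw [H.map_sub]
  exact CategoryTheory.Quotient.functor_map_eq_iff (stableRel A) _ _

end IsStablyExact

/-! ## Reduction to a corner algebra -/

/-- An algebra `A` which is both a corner `ε Λ ε` and a quotient of `Λ`, compatibly. -/
structure CornerRetract (K A Λ : Type u) [Field K] [Ring A] [Ring Λ] [Algebra K A]
    [Algebra K Λ] where
  incl : A →ₙₐ[K] Λ
  ret : Λ →ₐ[K] A
  ret_incl : ∀ a, ret (incl a) = a
  corner : ∀ l, incl 1 * l * incl 1 = incl (ret l)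

namespace CornerRetract

variable {K A Λ : Type u} [Field K] [Ring A] [Ring Λ] [Algebra K A] [Algebra K Λ]
  (R : CornerRetract K A Λ)

/-- The `Λ`-module obtained from an `A`-module by restriction along `Λ → A`. -/
def Inflation (_R : CornerRetract K A Λ) (U : Type u) : Type u := U

/-! ### Modules over the quotient algebra viewed over `Λ` -/

section Inflation

variable (U V : Type u) [AddCommGroup U] [Module A U] [AddCommGroup V] [Module A V]

instance : AddCommGroup (R.Inflation U) := inferInstanceAs (AddCommGroup U)

instance : Module Λ (R.Inflation U) := Module.compHom U (R.ret : Λ →+* A)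

variable {U V}

/-- The identity map, from a module to its inflation. -/
def toInfl : U ≃+ R.Inflation U := AddEquiv.refl U

theorem smul_toInfl (l : Λ) (x : U) : l • R.toInfl x = R.toInfl (R.ret l • x) := rfl

theorem incl_smul_toInfl (a : A) (x : U) : R.incl a • R.toInfl x = R.toInfl (a • x) := by
  rw [smul_toInfl, ret_incl]

theorem incl_one_smul (x : R.Inflation U) : R.incl 1 • x = x := by
  obtain ⟨x, rfl⟩ := R.toInfl.surjective x
  rw [incl_smul_toInfl, one_smul]

/-- The inflation of a linear map. -/
def inflMap (g : U →ₗ[A] V) : R.Inflation U →ₗ[Λ] R.Inflation V where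
  toFun x := R.toInfl (g (R.toInfl.symm x))
  map_add' x y := by simp
  map_smul' l x := by
    obtain ⟨x, rfl⟩ := R.toInfl.surjective x
    simp [smul_toInfl]

/-- A linear map between inflations. -/
def deflMap (g : R.Inflation U →ₗ[Λ] R.Inflation V) : U →ₗ[A] V where
  toFun x := R.toInfl.symm (g (R.toInfl x))
  map_add' x y := by simp
  map_smul' a x := by
    rw [← incl_smul_toInfl, map_smul]
    obtain ⟨y, hy⟩ := R.toInfl.surjective (g (R.toInfl x))
    rw [← hy, incl_smul_toInfl]
    simp

theorem finite_inflation [Module.Finite A U] : Module.Finite Λ (R.Inflation U) := by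
  obtain ⟨n, p, hp⟩ := Module.Finite.exists_fin' A U
  let x : Fin n → R.Inflation U := fun j => R.toInfl (p (Pi.single j 1))
  refine Module.Finite.of_surjective (Fintype.linearCombination Λ x) fun y => ?_
  obtain ⟨y, rfl⟩ := R.toInfl.surjective y
  obtain ⟨c, rfl⟩ := hp y
  refine ⟨fun j => R.incl (c j), ?_⟩
  rw [Fintype.linearCombination_apply]
  simp only [x, incl_smul_toInfl, ← map_smul, ← map_sum]
  congr 2
  refine Eq.trans (Finset.sum_congr rfl fun i _ => ?_) (Finset.univ_sum_single c)
  rw [← Pi.single_smul, smul_eq_mul, mul_one]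

/-- By `hR` the image of `A` in `Λ` is the left ideal `Λ ε`, and its inflation is a projective
`Λ`-module. Concretely, a section of `A^(U) → U` is transported coefficientwise along `incl`, and
`hR` is what makes the result `Λ`-linear. -/
theorem projective_inflation (hR : ∀ l a, l * R.incl a = R.incl (R.ret l * a))
    [Module.Projective A U] : Module.Projective Λ (R.Inflation U) := by
  obtain ⟨s, hs⟩ := Module.Projective.out (R := A) (P := U)
  refine ⟨⟨?_, ?_⟩⟩
  · refine
    { toFun := fun x => ((s (R.toInfl.symm x)).mapRange R.incl (map_zero _)).mapDomain R.toInfl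
      map_add' := fun x y => ?_
      map_smul' := fun l x => ?_ }
    · rw [map_add, map_add, Finsupp.mapRange_add (by exact map_add _), Finsupp.mapDomain_add]
    · obtain ⟨x, rfl⟩ := R.toInfl.surjective x
      rw [smul_toInfl, AddEquiv.symm_apply_apply, AddEquiv.symm_apply_apply, map_smul,
        RingHom.id_apply, ← Finsupp.mapDomain_smul]
      congr 1
      ext y
      simp only [Finsupp.mapRange_apply, Finsupp.smul_apply, smul_eq_mul, hR]
  · intro x
    obtain ⟨x, rfl⟩ := R.toInfl.surjective x
    have h := hs x
    rw [Finsupp.linearCombination_apply] at h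
    change Finsupp.linearCombination Λ id (Finsupp.mapDomain R.toInfl
      (Finsupp.mapRange R.incl _ (s x))) = _
    rw [Finsupp.linearCombination_mapDomain, Finsupp.linearCombination_apply,
      Finsupp.sum_mapRange_index (by simp)]
    simp only [Function.comp, id, incl_smul_toInfl]
    conv_rhs => rw [← h]
    exact (map_finsuppSum R.toInfl (s x) fun i a => a • i).symm

end Inflation

/-! ### The left adjoint of inflation -/

section Reduction

variable (X Y Z : Type u) [AddCommGroup X] [Module Λ X] [AddCommGroup Y] [Module Λ Y]
  [AddCommGroup Z] [Module Λ Z]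

/-- The submodule generated by the elements `x - ε x`. -/
def relations : Submodule Λ X := Submodule.span Λ (Set.range fun x : X => x - R.incl 1 • x)

/-- The largest quotient of `X` which is an `A`-module. -/
def Reduction : Type u := X ⧸ R.relations X

instance : AddCommGroup (R.Reduction X) := inferInstanceAs (AddCommGroup (X ⧸ R.relations X))

variable {X Y Z}

theorem incl_one_smul_quotient (y : X ⧸ R.relations X) : R.incl 1 • y = y := by
  obtain ⟨x, rfl⟩ := Submodule.Quotient.mk_surjective _ y
  rw [← Submodule.Quotient.mk_smul, eq_comm, Submodule.Quotient.eq]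
  exact Submodule.subset_span ⟨x, rfl⟩

/-- Since `ε` acts as the identity on the quotient, `l` acts as `ε l ε`, which comes from `A`. This
makes the quotient an `A`-module whose inflation is the original `Λ`-module. -/
theorem smul_quotient (l : Λ) (y : X ⧸ R.relations X) : l • y = R.incl (R.ret l) • y := by
  rw [← R.corner, mul_smul, mul_smul, R.incl_one_smul_quotient, R.incl_one_smul_quotient]

variable (X) in
instance : Module A (R.Reduction X) :=
  let act (a : A) (y : X ⧸ R.relations X) : X ⧸ R.relations X := R.incl a • y
  have h1 : ∀ y, act 1 y = y := R.incl_one_smul_quotient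
  have h2 : ∀ a b y, act (a * b) y = act a (act b y) := fun a b y => by
    simp only [act, map_mul, mul_smul]
  have h3 : ∀ a, act a 0 = 0 := fun a => smul_zero _
  have h4 : ∀ a x y, act a (x + y) = act a x + act a y := fun a => smul_add _
  have h5 : ∀ a b y, act (a + b) y = act a y + act b y := fun a b y => by
    simp only [act, map_add, add_smul]
  have h6 : ∀ y, act 0 y = 0 := fun y => by simp only [act, map_zero, zero_smul]
  { smul := act, one_smul := h1, mul_smul := h2, smul_zero := h3, smul_add := h4, add_smul := h5
    zero_smul := h6 }

/-- The projection to the reduction. -/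
def quot : X →ₗ[Λ] R.Inflation (R.Reduction X) where
  toFun x := (Submodule.Quotient.mk x : X ⧸ R.relations X)
  map_add' _ _ := rfl
  map_smul' l x := R.smul_quotient l (Submodule.Quotient.mk x)

theorem quot_surjective : Function.Surjective (R.quot (X := X)) :=
  Submodule.Quotient.mk_surjective (R.relations X)

theorem quot_eq_zero {x : X} : R.quot x = 0 ↔ x ∈ R.relations X :=
  Submodule.Quotient.mk_eq_zero (R.relations X)

theorem quot_incl_one_smul (x : X) : R.quot (R.incl 1 • x) = R.quot x := by
  rw [map_smul, incl_one_smul]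

variable {U V : Type u} [AddCommGroup U] [Module A U] [AddCommGroup V] [Module A V]

/-- `ε` acts as the identity on an inflation, so every generator `x - ε x` of the relations is
killed. -/
theorem exists_lift (g : X →ₗ[Λ] R.Inflation U) :
    ∃ h : R.Inflation (R.Reduction X) →ₗ[Λ] R.Inflation U, h ∘ₗ R.quot = g :=
  LinearMap.exists_comp_eq_of_ker_le R.quot R.quot_surjective g fun x hx => by
    rw [quot_eq_zero] at hx
    revert x
    change R.relations X ≤ LinearMap.ker g
    rw [relations, Submodule.span_le]
    rintro _ ⟨x, rfl⟩
    simp [incl_one_smul]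

/-- A homomorphism to an inflation factors through the reduction. -/
def lift (g : X →ₗ[Λ] R.Inflation U) : R.Reduction X →ₗ[A] U :=
  R.deflMap (R.exists_lift g).choose

/-- The class of an element in the reduction. -/
def cls (x : X) : R.Reduction X := R.toInfl.symm (R.quot x)

theorem cls_surjective : Function.Surjective (R.cls (X := X)) := R.quot_surjective

theorem cls_smul (l : Λ) (x : X) : R.cls (l • x) = R.ret l • R.cls x :=
  map_smul R.quot l x

theorem cls_incl_smul (a : A) (x : X) : R.cls (R.incl a • x) = a • R.cls x := by
  rw [cls_smul, ret_incl]

theorem cls_add (x y : X) : R.cls (x + y) = R.cls x + R.cls y := map_add R.quot x y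

theorem cls_zero : R.cls (0 : X) = 0 := map_zero R.quot

theorem cls_sub (x y : X) : R.cls (x - y) = R.cls x - R.cls y := map_sub R.quot x y

theorem cls_eq_zero {x : X} : R.cls x = 0 ↔ x ∈ R.relations X := R.quot_eq_zero

theorem cls_incl_one_smul (x : X) : R.cls (R.incl 1 • x) = R.cls x := by
  rw [cls_incl_smul, one_smul]

theorem lift_cls (g : X →ₗ[Λ] R.Inflation U) (x : X) : R.lift g (R.cls x) = R.toInfl.symm (g x) :=
  congrArg R.toInfl.symm (LinearMap.congr_fun (R.exists_lift g).choose_spec x)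

variable {R} in
theorem reduction_hom_ext {g h : R.Reduction X →ₗ[A] U} (H : ∀ x, g (R.cls x) = h (R.cls x)) :
    g = h := by
  ext y
  obtain ⟨x, rfl⟩ := R.cls_surjective y
  exact H x

/-- The map on reductions. -/
def map (f : X →ₗ[Λ] Y) : R.Reduction X →ₗ[A] R.Reduction Y := R.lift (R.quot ∘ₗ f)

@[simp] theorem map_cls (f : X →ₗ[Λ] Y) (x : X) : R.map f (R.cls x) = R.cls (f x) :=
  R.lift_cls _ _

theorem finite_reduction [Module.Finite Λ X] : Module.Finite A (R.Reduction X) := by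
  let f : X →ₛₗ[(R.ret : Λ →+* A)] R.Reduction X :=
    { toFun := R.cls, map_add' := R.cls_add, map_smul' := R.cls_smul }
  have : RingHomSurjective (R.ret : Λ →+* A) := ⟨fun a => ⟨R.incl a, R.ret_incl a⟩⟩
  exact Module.Finite.of_surjective f R.cls_surjective

/-- Reduction is left adjoint to inflation, and inflation preserves surjections. -/
theorem projective_reduction [Module.Projective Λ X] : Module.Projective A (R.Reduction X) := by
  refine Module.Projective.of_lifting_property'' fun p hp => ?_
  obtain ⟨h, hh⟩ := Module.projective_lifting_property (R.inflMap p) R.quot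
    (fun y => (hp (R.toInfl.symm y)).imp fun _ h => congrArg R.toInfl h)
  refine ⟨R.lift h, reduction_hom_ext fun x => ?_⟩
  rw [LinearMap.comp_apply, lift_cls]
  exact LinearMap.congr_fun hh x

/-- Reduction as a functor. -/
def functor : ModuleCat.{u} Λ ⥤ ModuleCat.{u} A where
  obj X := ModuleCat.of A (R.Reduction X)
  map f := ModuleCat.ofHom (R.map f.hom)
  map_id X := ModuleCat.hom_ext (reduction_hom_ext fun x => by simp)
  map_comp f g := ModuleCat.hom_ext (reduction_hom_ext fun x => by simp)

instance : R.functor.Additive where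
  map_add {X Y f g} := ModuleCat.hom_ext <| reduction_hom_ext fun x => by
    change R.map (f + g).hom (R.cls x) = R.map f.hom (R.cls x) + R.map g.hom (R.cls x)
    simp [cls_add]

instance : R.functor.Linear K where
  map_smul {X Y} f r := ModuleCat.hom_ext <| reduction_hom_ext fun x => by
    change R.map (r • f).hom (R.cls x) = algebraMap K A r • R.map f.hom (R.cls x)
    rw [map_cls, map_cls]
    change R.cls (algebraMap K Λ r • f.hom x) = _
    rw [cls_smul, AlgHom.commutes]

end Reduction

end CornerRetract

/-! ## One-arrow extensions -/

/-- `Λ` is the algebra generated by the algebras `B` and `C`, with orthogonal units of sum `1`, and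
by an element `arrow` of `e Λ f`, for idempotents `e` of `B` and `f` of `C`, subject to no further
relations. -/
structure OneArrowExtension (K B C Λ : Type u) [Field K] [Ring B] [Ring C] [Ring Λ] [Algebra K B]
    [Algebra K C] [Algebra K Λ] where
  inB : B →ₙₐ[K] Λ
  inC : C →ₙₐ[K] Λ
  e : B
  f : C
  arrow : Λ
  e_mul_e : e * e = e
  f_mul_f : f * f = f
  inB_one_add : inB 1 + inC 1 = 1
  inC_mul_inB : ∀ c b, inC c * inB b = 0
  inB_mul_inC : ∀ b c, inB b * inC c = 0
  inB_e_mul_arrow : inB e * arrow = arrow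
  arrow_mul_inC_f : arrow * inC f = arrow
  induction : ∀ p : Λ → Prop, (∀ b, p (inB b)) → (∀ c, p (inC c)) →
    (∀ b c, p (inB b * arrow * inC c)) → (∀ x y, p x → p y → p (x + y)) → ∀ x, p x
  exists_lift : ∀ (A : Type u) [Ring A] [Algebra K A] (φ : B →ₙₐ[K] A) (ψ : C →ₙₐ[K] A) (a : A),
    φ 1 + ψ 1 = 1 → (∀ b c, φ b * ψ c = 0) → (∀ b c, ψ c * φ b = 0) → φ e * a = a → a * ψ f = a →
    ∃ ρ : Λ →ₐ[K] A, (∀ b, ρ (inB b) = φ b) ∧ (∀ c, ρ (inC c) = ψ c) ∧ ρ arrow = a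

namespace OneArrowExtension

variable {K B C Λ : Type u} [Field K] [Ring B] [Ring C] [Ring Λ] [Algebra K B] [Algebra K C]
  [Algebra K Λ] (T : OneArrowExtension K B C Λ)

theorem arrow_mul_inB (b : B) : T.arrow * T.inB b = 0 := by
  rw [← T.arrow_mul_inC_f, mul_assoc, T.inC_mul_inB, mul_zero]

theorem arrow_mul_inC_one : T.arrow * T.inC 1 = T.arrow := by
  rw [← T.arrow_mul_inC_f, mul_assoc, ← map_mul, mul_one]

/-- The triangular shape of `Λ`: none of the spanning elements has a component from the `B` side to
the `C` side. -/
theorem inC_mul_mul_inB (c : C) (l : Λ) (b : B) : T.inC c * l * T.inB b = 0 := by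
  refine T.induction (fun l => T.inC c * l * T.inB b = 0) ?_ ?_ ?_ ?_ l
  · intro b'; rw [T.inC_mul_inB, zero_mul]
  · intro c'; rw [mul_assoc, T.inC_mul_inB, mul_zero]
  · intro b' c'; rw [mul_assoc, mul_assoc, T.inC_mul_inB, mul_zero, mul_zero]
  · intro x y hx hy; rw [mul_add, add_mul, hx, hy, add_zero]

/-- The universal property allows both `C` and the arrow to be sent to zero. -/
theorem exists_retB : ∃ ρ : Λ →ₐ[K] B, (∀ b, ρ (T.inB b) = b) ∧ (∀ c, ρ (T.inC c) = 0) ∧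
    ρ T.arrow = 0 :=
  T.exists_lift B (NonUnitalAlgHom.id K B) 0 0 (by simp) (by simp) (by simp) (by simp) (by simp)

theorem exists_retC : ∃ ρ : Λ →ₐ[K] C, (∀ b, ρ (T.inB b) = 0) ∧ (∀ c, ρ (T.inC c) = c) ∧
    ρ T.arrow = 0 :=
  T.exists_lift C 0 (NonUnitalAlgHom.id K C) 0 (by simp) (by simp) (by simp) (by simp) (by simp)

/-- The corner `B`. -/
def cornerB : CornerRetract K B Λ where
  incl := T.inB
  ret := T.exists_retB.choose
  ret_incl := T.exists_retB.choose_spec.1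
  corner := by
    obtain ⟨h1, h2, h3⟩ := T.exists_retB.choose_spec
    refine T.induction _ ?_ ?_ ?_ ?_
    · intro b; rw [h1, ← map_mul, ← map_mul, one_mul, mul_one]
    · intro c; rw [h2, T.inB_mul_inC, zero_mul, map_zero]
    · intro b c
      rw [map_mul, h2, mul_zero, map_zero, mul_assoc, mul_assoc, T.inC_mul_inB, mul_zero, mul_zero]
    · intro x y hx hy; rw [mul_add, add_mul, hx, hy, map_add, map_add]

/-- The corner `C`. -/
def cornerC : CornerRetract K C Λ where
  incl := T.inC
  ret := T.exists_retC.choose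
  ret_incl := T.exists_retC.choose_spec.2.1
  corner := by
    obtain ⟨h1, h2, h3⟩ := T.exists_retC.choose_spec
    refine T.induction _ ?_ ?_ ?_ ?_
    · intro b; rw [h1, T.inC_mul_inB, zero_mul, map_zero]
    · intro c; rw [h2, ← map_mul, ← map_mul, one_mul, mul_one]
    · intro b c
      have h : T.exists_retC.choose (T.inB b * T.arrow * T.inC c) = 0 := by
        rw [map_mul, map_mul, h3, mul_zero, zero_mul]
      rw [h, map_zero, ← mul_assoc, ← mul_assoc, T.inC_mul_inB, zero_mul, zero_mul, zero_mul]
    · intro x y hx hy; rw [mul_add, add_mul, hx, hy, map_add, map_add]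

@[simp] theorem cornerB_incl : T.cornerB.incl = T.inB := rfl

@[simp] theorem cornerC_incl : T.cornerC.incl = T.inC := rfl

theorem retB_inC (c : C) : T.cornerB.ret (T.inC c) = 0 := T.exists_retB.choose_spec.2.1 c

theorem retB_arrow : T.cornerB.ret T.arrow = 0 := T.exists_retB.choose_spec.2.2

theorem retC_inB (b : B) : T.cornerC.ret (T.inB b) = 0 := T.exists_retC.choose_spec.1 b

/-- As `ε_C Λ ε_B = 0`, the right ideal `ε_C Λ` equals `ε_C Λ ε_C`, a copy of `C`. This is why `X ↦
ε_C X` describes the `C`-reduction. -/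
theorem inC_one_mul (l : Λ) : T.inC 1 * l = T.inC (T.cornerC.ret l) := by
  rw [← cornerC_incl, ← T.cornerC.corner, cornerC_incl]
  nth_rw 1 [← mul_one (T.inC 1 * l), ← T.inB_one_add]
  rw [mul_add, T.inC_mul_mul_inB, zero_add]

/-- Dually, `Λ ε_B = ε_B Λ ε_B` is a copy of `B`. This is the hypothesis of `projective_inflation`,
so projective `B`-modules stay projective over `Λ`. -/
theorem mul_inB (l : Λ) (b : B) : l * T.inB b = T.inB (T.cornerB.ret l * b) := by
  have h : T.inB b = T.inB 1 * T.inB b := by rw [← map_mul, one_mul]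
  have h' : l * T.inB b = T.inB 1 * (l * T.inB b) := by
    nth_rw 1 [← one_mul (l * T.inB b), ← T.inB_one_add]
    rw [add_mul, ← mul_assoc (T.inC 1), T.inC_mul_mul_inB, add_zero]
  rw [h', h, ← mul_assoc, ← mul_assoc, ← cornerB_incl, T.cornerB.corner, ← map_mul]

section Modules

variable {X Y : Type u} [AddCommGroup X] [Module Λ X] [AddCommGroup Y] [Module Λ Y]

theorem inB_add_inC_smul (x : X) : T.inB 1 • x + T.inC 1 • x = x := by
  rw [← add_smul, T.inB_one_add, one_smul]

/-- An additive map which commutes with the generators of `Λ` is linear. -/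
def linearMk (g : X →+ Y) (hB : ∀ b x, g (T.inB b • x) = T.inB b • g x)
    (hC : ∀ c x, g (T.inC c • x) = T.inC c • g x) (ha : ∀ x, g (T.arrow • x) = T.arrow • g x) :
    X →ₗ[Λ] Y where
  toFun := g
  map_add' := g.map_add
  map_smul' := by
    refine T.induction _ (fun b x => hB b x) (fun c x => hC c x) ?_ ?_
    · intro b c x
      simp only [mul_smul, hB, hC, ha, RingHom.id_apply]
    · intro l l' h h' x
      rw [add_smul, map_add, h, h', RingHom.id_apply, RingHom.id_apply, RingHom.id_apply, add_smul]

end Modules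

/-- The left ideal `B e`. -/
def projE : Submodule B B where
  carrier := {b | b * T.e = b}
  add_mem' {a b} ha hb := by
    change (a + b) * T.e = a + b
    rw [add_mul, ha, hb]
  zero_mem' := zero_mul _
  smul_mem' c x hx := by
    change c * x * T.e = c * x
    rw [mul_assoc, hx]

instance : Module.Projective B T.projE :=
  Module.Projective.of_split T.projE.subtype
    -- Right multiplication by the idempotent `e` retracts `B` onto `B e`.
    (LinearMap.codRestrict T.projE (LinearMap.toSpanSingleton B B T.e) fun b => by
      change b * T.e * T.e = b * T.e
      rw [mul_assoc, T.e_mul_e])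
    (LinearMap.ext fun x => Subtype.ext x.2)

/-- The generator `e` of `B e`. -/
def gen : T.projE := ⟨T.e, T.e_mul_e⟩

/-! ### The exact functor `W ↦ f W` -/

section Corner

variable (W W' W'' : Type u) [AddCommGroup W] [Module C W] [AddCommGroup W'] [Module C W']
  [AddCommGroup W''] [Module C W'']

/-- The vector space `f W`. -/
def cornerF : AddSubgroup W where
  carrier := {w | T.f • w = w}
  add_mem' {a b} ha hb := by
    change T.f • (a + b) = a + b
    rw [smul_add, ha, hb]
  zero_mem' := smul_zero _
  neg_mem' {a} ha := by
    change T.f • (-a) = -a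
    rw [smul_neg, ha]

variable {W} in
theorem smul_mem_cornerF (w : W) : T.f • w ∈ T.cornerF W := by
  change T.f • T.f • w = T.f • w
  rw [← mul_smul, T.f_mul_f]

instance : Module K (T.cornerF W) where
  smul r w := ⟨algebraMap K C r • (w : W), by
    change T.f • algebraMap K C r • (w : W) = algebraMap K C r • (w : W)
    rw [← mul_smul, ← Algebra.commutes, mul_smul, w.2]⟩
  one_smul w := Subtype.ext (by
    change algebraMap K C 1 • (w : W) = w
    rw [map_one, one_smul])
  mul_smul a b w := Subtype.ext (by
    change algebraMap K C (a * b) • (w : W) = algebraMap K C a • algebraMap K C b • (w : W)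
    rw [map_mul, mul_smul])
  smul_zero a := Subtype.ext (smul_zero (algebraMap K C a))
  smul_add a v w := Subtype.ext (smul_add (algebraMap K C a) (v : W) (w : W))
  add_smul a b w := Subtype.ext (by
    change algebraMap K C (a + b) • (w : W) = algebraMap K C a • (w : W) + algebraMap K C b • (w : W)
    rw [map_add, add_smul])
  zero_smul w := Subtype.ext (by
    change algebraMap K C 0 • (w : W) = 0
    rw [map_zero, zero_smul])

variable {W}

theorem coe_smul_cornerF (r : K) (w : T.cornerF W) :
    ((r • w : T.cornerF W) : W) = algebraMap K C r • (w : W) := rfl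

/-- The element `f w` of `f W`. -/
def toCornerF (w : W) : T.cornerF W := ⟨T.f • w, T.smul_mem_cornerF w⟩

theorem toCornerF_coe (w : T.cornerF W) : T.toCornerF (w : W) = w := Subtype.ext w.2

theorem finite_cornerF [Module.Finite K C] [Module.Finite C W] : Module.Finite K (T.cornerF W) := by
  let _ : Module K W := Module.restrictScalars K C W
  have : IsScalarTower K C W := IsScalarTower.restrictScalars K C W
  have hW : Module.Finite K W := Module.Finite.trans C W
  let i : T.cornerF W →ₗ[K] W :=
    { toFun := Subtype.val
      map_add' := fun _ _ => rfl
      map_smul' := fun r w => by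
        rw [coe_smul_cornerF, algebraMap_smul]
        rfl }
  exact Module.Finite.of_injective i Subtype.val_injective

variable {W' W''}

/-- The map `f W → f W'` induced by a linear map. -/
def cornerMap (g : W →ₗ[C] W') : T.cornerF W →ₗ[K] T.cornerF W' where
  toFun w := ⟨g w, by
    change T.f • g w = g w
    rw [← map_smul, w.2]⟩
  map_add' v w := Subtype.ext (map_add g _ _)
  map_smul' r w := Subtype.ext (map_smul g _ _)

theorem cornerMap_injective {g : W →ₗ[C] W'} (hg : Function.Injective g) :
    Function.Injective (T.cornerMap g) := fun _ _ h =>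
  Subtype.ext (hg (congrArg Subtype.val h))

theorem cornerMap_exact {g : W →ₗ[C] W'} {h : W' →ₗ[C] W''} (H : Function.Exact g h) :
    Function.Exact (T.cornerMap g) (T.cornerMap h) := by
  intro w
  constructor
  · intro hw
    obtain ⟨v, hv⟩ := (H (w : W')).1 (congrArg Subtype.val hw)
    refine ⟨T.toCornerF v, Subtype.ext ?_⟩
    change g (T.f • v) = w
    rw [map_smul, hv, w.2]
  · rintro ⟨v, rfl⟩
    exact Subtype.ext (H.apply_apply_eq_zero (v : W))

end Corner

open TensorProduct

/-! ### The induced module `Λ ⊗ W` -/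

section Extension

variable (W W' W'' : Type u) [AddCommGroup W] [Module C W] [AddCommGroup W'] [Module C W']
  [AddCommGroup W''] [Module C W'']

/-- The projective `B`-module `B e ⊗ f W`. -/
abbrev Bridge : Type u := T.projE ⊗[K] T.cornerF W

instance : Module.Projective B (T.Bridge W) := inferInstance

/-- Finite dimension of the algebras enters the argument here: `f W` is finite-dimensional, so `Be ⊗
f W` is finite over `K` and a fortiori over `B`. All applications of Gorenstein projectivity to the
bridge need it to be finitely generated. -/
theorem finite_bridge [Module.Finite K B] [Module.Finite K C] [Module.Finite C W] :
    Module.Finite B (T.Bridge W) := by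
  have := T.finite_cornerF (W := W)
  have : Module.Finite K T.projE :=
    Module.Finite.of_injective (T.projE.subtype.restrictScalars K) Subtype.val_injective
  exact Module.Finite.of_restrictScalars_finite K B _

/-- The action of `Λ` is built from its universal property: `B` acts on the first factor, `C` on the
second, and the arrow sends `w` to `e ⊗ f w`. The relations for the arrow hold because `e` is
idempotent and `f` is the identity on `f W`. -/
theorem exists_rep : letI : Module K W := Module.restrictScalars K C W
    ∃ ρ : Λ →ₐ[K] Module.End K (T.Bridge W × W),
      (∀ b n w, ρ (T.inB b) (n, w) = (b • n, 0)) ∧ (∀ c n w, ρ (T.inC c) (n, w) = (0, c • w)) ∧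
      ∀ n w, ρ T.arrow (n, w) = (T.gen ⊗ₜ[K] T.toCornerF w, 0) := by
  let _ : Module K W := Module.restrictScalars K C W
  have : IsScalarTower K C W := IsScalarTower.restrictScalars K C W
  let φ : B →ₙₐ[K] Module.End K (T.Bridge W × W) :=
    { toFun := fun b => (LinearMap.inl K _ _) ∘ₗ (Algebra.lsmul K K (T.Bridge W) b) ∘ₗ
        LinearMap.fst K _ _
      map_smul' := fun r b => by
        refine LinearMap.ext fun ⟨n, w⟩ => ?_
        simp
      map_zero' := by
        refine LinearMap.ext fun ⟨n, w⟩ => ?_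
        simp
      map_add' := fun a b => by
        refine LinearMap.ext fun ⟨n, w⟩ => ?_
        simp
      map_mul' := fun a b => by
        refine LinearMap.ext fun ⟨n, w⟩ => ?_
        simp }
  let ψ : C →ₙₐ[K] Module.End K (T.Bridge W × W) :=
    { toFun := fun b => (LinearMap.inr K _ _) ∘ₗ (Algebra.lsmul K K W b) ∘ₗ LinearMap.snd K _ _
      map_smul' := fun r b => by
        refine LinearMap.ext fun ⟨n, w⟩ => ?_
        simp
      map_zero' := by
        refine LinearMap.ext fun ⟨n, w⟩ => ?_
        simp
      map_add' := fun a b => by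
        refine LinearMap.ext fun ⟨n, w⟩ => ?_
        simp
      map_mul' := fun a b => by
        refine LinearMap.ext fun ⟨n, w⟩ => ?_
        simp }
  have hφ : ∀ b n w, φ b (n, w) = (b • n, 0) := fun b n w => rfl
  have hψ : ∀ c n w, ψ c (n, w) = (0, c • w) := fun b n w => rfl
  let t : W →ₗ[K] T.cornerF W :=
    { toFun := T.toCornerF
      map_add' := fun v w => Subtype.ext (smul_add T.f v w)
      map_smul' := fun r w => Subtype.ext (by
        change T.f • r • w = algebraMap K C r • T.f • w
        rw [algebraMap_smul, smul_comm]) }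
  let a : Module.End K (T.Bridge W × W) :=
    (LinearMap.inl K _ _) ∘ₗ (TensorProduct.mk K T.projE (T.cornerF W) T.gen) ∘ₗ t ∘ₗ
      LinearMap.snd K _ _
  have ha : ∀ n w, a (n, w) = (T.gen ⊗ₜ[K] T.toCornerF w, 0) := fun n w => rfl
  obtain ⟨ρ, h1, h2, h3⟩ := T.exists_lift _ φ ψ a
    (by
      refine LinearMap.ext fun ⟨n, w⟩ => ?_
      rw [LinearMap.add_apply, hφ, hψ]
      simp)
    (fun b c => by
      refine LinearMap.ext fun ⟨n, w⟩ => ?_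
      rw [Module.End.mul_apply, hψ, hφ]
      simp)
    (fun b c => by
      refine LinearMap.ext fun ⟨n, w⟩ => ?_
      rw [Module.End.mul_apply, hφ, hψ]
      simp)
    (by
      refine LinearMap.ext fun ⟨n, w⟩ => ?_
      rw [Module.End.mul_apply, ha, hφ, TensorProduct.smul_tmul']
      congr 2
      exact Subtype.ext T.e_mul_e)
    (by
      refine LinearMap.ext fun ⟨n, w⟩ => ?_
      rw [Module.End.mul_apply, hψ, ha, ha]
      congr 2
      exact T.toCornerF_coe (T.toCornerF w))
  exact ⟨ρ, fun b n w => by rw [h1, hφ], fun c n w => by rw [h2, hψ], fun n w => by rw [h3, ha]⟩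

/-- The `Λ`-module `Λ ⊗ W`, for a `C`-module `W`, realized on `(B e ⊗ f W) × W`. -/
def Extension : Type u := T.Bridge W × W

instance : AddCommGroup (T.Extension W) := inferInstanceAs (AddCommGroup (T.Bridge W × W))

instance : Module Λ (T.Extension W) :=
  letI : Module K W := Module.restrictScalars K C W
  Module.compHom (T.Bridge W × W) ((T.exists_rep W).choose : Λ →+* Module.End K (T.Bridge W × W))

variable {W}

/-- The element `(n, w)`. -/
def pair (n : T.Bridge W) (w : W) : T.Extension W := (n, w)

theorem exists_pair (x : T.Extension W) : ∃ n w, x = T.pair n w := ⟨x.1, x.2, rfl⟩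

theorem pair_add (n n' : T.Bridge W) (w w' : W) :
    T.pair n w + T.pair n' w' = T.pair (n + n') (w + w') := rfl

theorem pair_zero : T.pair (0 : T.Bridge W) 0 = 0 := rfl

theorem pair_inj {n n' : T.Bridge W} {w w' : W} :
    T.pair n w = T.pair n' w' ↔ n = n' ∧ w = w' := Prod.mk_inj

theorem pair_eq_zero {n : T.Bridge W} {w : W} : T.pair n w = 0 ↔ n = 0 ∧ w = 0 := Prod.mk_inj

theorem inB_smul_pair (b : B) (n : T.Bridge W) (w : W) :
    T.inB b • T.pair n w = T.pair (b • n) 0 := (T.exists_rep W).choose_spec.1 b n w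

theorem inC_smul_pair (c : C) (n : T.Bridge W) (w : W) :
    T.inC c • T.pair n w = T.pair 0 (c • w) := (T.exists_rep W).choose_spec.2.1 c n w

theorem arrow_smul_pair (n : T.Bridge W) (w : W) :
    T.arrow • T.pair n w = T.pair (T.gen ⊗ₜ T.toCornerF w) 0 :=
  (T.exists_rep W).choose_spec.2.2 n w

theorem pair_tmul (b : T.projE) (w : T.cornerF W) :
    T.pair (b ⊗ₜ w) 0 = T.inB b • T.arrow • T.pair 0 (w : W) := by
  rw [arrow_smul_pair, inB_smul_pair, TensorProduct.smul_tmul', toCornerF_coe]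
  congr 2
  exact Subtype.ext b.2.symm

/-- An additive predicate on `Λ ⊗ W` closed under `Λ` holds if it holds on `W`. -/
theorem submodule_eq_top (S : Submodule Λ (T.Extension W)) (h : ∀ w : W, T.pair 0 w ∈ S) :
    S = ⊤ := by
  rw [eq_top_iff]
  intro x hx
  clear hx
  obtain ⟨n, w, rfl⟩ := T.exists_pair x
  have hn : T.pair n 0 ∈ S := by
    induction n using TensorProduct.induction_on with
    | zero => exact S.zero_mem
    | tmul b v =>
      rw [pair_tmul]
      exact S.smul_mem _ (S.smul_mem _ (h _))
    | add x y hx hy =>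
      have := S.add_mem hx hy
      rwa [pair_add, add_zero] at this
  have := S.add_mem hn (h w)
  rwa [pair_add, add_zero, zero_add] at this

variable {Y : Type u} [AddCommGroup Y] [Module Λ Y]

variable {T} in
theorem extension_hom_ext {g h : T.Extension W →ₗ[Λ] Y} (H : ∀ w, g (T.pair 0 w) = h (T.pair 0 w)) :
    g = h :=
  LinearMap.eqLocus_eq_top.1 (T.submodule_eq_top _ H)

/-- The restriction to `B e ⊗ f W` of the extension of a `C`-equivariant map `W → Y`. -/
def bridgeLift (h : W →+ Y) (hh : ∀ c w, h (c • w) = T.inC c • h w) : T.Bridge W →+ Y :=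
  TensorProduct.liftAddHom
    (AddMonoidHom.mk' (fun b : T.projE => AddMonoidHom.mk'
      (fun w : T.cornerF W => T.inB b • T.arrow • h w) fun v w => by
        simp only [AddSubgroup.coe_add, map_add, smul_add]) fun a b => by
        ext w
        simp only [AddMonoidHom.mk'_apply, AddMonoidHom.add_apply, Submodule.coe_add, map_add,
          add_smul])
    fun r b w => by
      -- The map is balanced over `K`: a scalar acts on `f W` through `C`, where it becomes a
      -- multiple of `ε_C`, and the arrow absorbs `ε_C`.
      have h1 : T.inC (algebraMap K C r) = r • T.inC 1 := by
        rw [Algebra.algebraMap_eq_smul_one, map_smul]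
      simp only [AddMonoidHom.mk'_apply, coe_smul_cornerF, hh, h1, ← mul_smul]
      rw [mul_smul_comm, mul_assoc, arrow_mul_inC_one, ← smul_mul_assoc, ← map_smul T.inB]
      rfl

/-- The extension of a `C`-equivariant map `W → Y` to `Λ ⊗ W`. -/
def extLift (h : W →+ Y) (hh : ∀ c w, h (c • w) = T.inC c • h w) : T.Extension W →ₗ[Λ] Y :=
  let k : T.Bridge W →+ Y := T.bridgeLift h hh
  have hk : ∀ (b : T.projE) (w : T.cornerF W), k (b ⊗ₜ w) = T.inB b • T.arrow • h w :=
    fun b w => rfl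
  have hkB : ∀ b n, k (b • n) = T.inB b • k n := fun b n => by
    induction n using TensorProduct.induction_on with
    | zero => simp
    | tmul a w =>
      rw [TensorProduct.smul_tmul', hk, hk, ← mul_smul (T.inB b), ← map_mul]
      rfl
    | add x y hx hy => rw [smul_add, map_add, hx, hy, map_add, smul_add]
  -- `k` has values in `ε_B Y` and `h` in `ε_C Y`, so the cross terms vanish when linearity is
  -- checked on the generators of `Λ`.
  have hkB' : ∀ n, k n = T.inB 1 • k n := fun n => by rw [← hkB, one_smul]
  have hC1 : ∀ w, h w = T.inC 1 • h w := fun w => by rw [← hh, one_smul]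
  let g : T.Extension W →+ Y := AddMonoidHom.coprod k h
  have hg : ∀ n w, g (T.pair n w) = k n + h w := fun n w => rfl
  T.linearMk g
    (fun b x => by
      obtain ⟨n, w, rfl⟩ := T.exists_pair x
      rw [inB_smul_pair, hg, hg, hkB, map_zero, hC1 w, smul_add, ← mul_smul (T.inB b) (T.inC 1),
        T.inB_mul_inC, zero_smul])
    (fun c x => by
      obtain ⟨n, w, rfl⟩ := T.exists_pair x
      rw [inC_smul_pair, hg, hg, hh, map_zero, hkB' n, smul_add, ← mul_smul (T.inC c) (T.inB 1),
        T.inC_mul_inB, zero_smul])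
    (fun x => by
      obtain ⟨n, w, rfl⟩ := T.exists_pair x
      rw [arrow_smul_pair, hg, hg, hk, map_zero, hkB' n, smul_add, ← mul_smul T.arrow (T.inB 1),
        T.arrow_mul_inB, zero_smul, add_zero, zero_add]
      change T.inB T.e • T.arrow • h (T.f • w) = T.arrow • h w
      rw [hh, ← mul_smul, ← mul_smul, T.inB_e_mul_arrow, T.arrow_mul_inC_f])

theorem extLift_pair (h : W →+ Y) (hh : ∀ c w, h (c • w) = T.inC c • h w) (w : W) :
    T.extLift h hh (T.pair 0 w) = h w := by
  change T.bridgeLift h hh 0 + h w = h w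
  rw [map_zero, zero_add]

variable {W' W''}

/-- The inclusion of `W` in `Λ ⊗ W`. -/
def inW : W →+ T.Extension W where
  toFun w := T.pair 0 w
  map_zero' := rfl
  map_add' v w := by rw [pair_add, add_zero]

theorem inW_apply (w : W) : T.inW w = T.pair 0 w := rfl

theorem inW_smul (c : C) (w : W) : T.inW (c • w) = T.inC c • T.inW w := by
  rw [inW_apply, inW_apply, inC_smul_pair]

/-- The map `Λ ⊗ W → Λ ⊗ W'` induced by a linear map. -/
def extMap (g : W →ₗ[C] W') : T.Extension W →ₗ[Λ] T.Extension W' :=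
  T.extLift (T.inW.comp g.toAddMonoidHom) fun c w => by
    change T.inW (g (c • w)) = T.inC c • T.inW (g w)
    rw [← inW_smul, map_smul]

theorem extMap_pair (g : W →ₗ[C] W') (n : T.Bridge W) (w : W) :
    T.extMap g (T.pair n w) = T.pair (LinearMap.lTensor T.projE (T.cornerMap g) n) (g w) := by
  have h0 : ∀ w, T.extMap g (T.pair 0 w) = T.pair 0 (g w) := fun w => T.extLift_pair _ _ w
  have h1 : T.extMap g (T.pair n 0) =
      T.pair (LinearMap.lTensor T.projE (T.cornerMap g) n) 0 := by
    induction n using TensorProduct.induction_on with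
    | zero => rw [map_zero, pair_zero, pair_zero, map_zero]
    | tmul b v => rw [pair_tmul, map_smul, map_smul, h0, LinearMap.lTensor_tmul, pair_tmul]; rfl
    | add x y hx hy =>
      rw [← add_zero (0 : W), ← pair_add, map_add, hx, hy, map_add, pair_add, add_zero]
  rw [← add_zero n, ← zero_add w, ← pair_add, map_add, h0, h1, pair_add, add_zero, zero_add,
    add_zero, zero_add]

/-- On the first component the map is `Be ⊗ -` applied to the restriction of `g` to `f W`, and `Be`
is flat over the field `K`. The same reason makes `Λ ⊗ -` exact. -/
theorem extMap_injective {g : W →ₗ[C] W'} (hg : Function.Injective g) :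
    Function.Injective (T.extMap g) := by
  rw [injective_iff_map_eq_zero]
  intro x hx
  obtain ⟨n, w, rfl⟩ := T.exists_pair x
  rw [extMap_pair, pair_eq_zero] at hx
  rw [pair_eq_zero]
  exact ⟨Module.Flat.lTensor_preserves_injective_linearMap _ (T.cornerMap_injective hg)
    (hx.1.trans (map_zero _).symm), hg (hx.2.trans (map_zero g).symm)⟩

theorem extMap_exact {g : W →ₗ[C] W'} {h : W' →ₗ[C] W''} (H : Function.Exact g h) :
    Function.Exact (T.extMap g) (T.extMap h) := by
  have H' := Module.Flat.lTensor_exact T.projE (T.cornerMap_exact H)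
  intro x
  obtain ⟨n, w, rfl⟩ := T.exists_pair x
  rw [extMap_pair, pair_eq_zero]
  constructor
  · rintro ⟨h1, h2⟩
    obtain ⟨m, rfl⟩ := (H' n).1 h1
    obtain ⟨v, rfl⟩ := (H w).1 h2
    exact ⟨T.pair m v, T.extMap_pair _ _ _⟩
  · rintro ⟨y, hy⟩
    obtain ⟨m, v, rfl⟩ := T.exists_pair y
    rw [extMap_pair, pair_inj] at hy
    rw [← hy.1, ← hy.2]
    exact ⟨H'.apply_apply_eq_zero m, H.apply_apply_eq_zero v⟩

theorem extMap_comp (g : W →ₗ[C] W') (h : W' →ₗ[C] W'') :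
    T.extMap (h ∘ₗ g) = T.extMap h ∘ₗ T.extMap g :=
  extension_hom_ext fun w => by
    simp only [LinearMap.comp_apply, extMap_pair, map_zero]

theorem finite_extension [Module.Finite C W] : Module.Finite Λ (T.Extension W) := by
  obtain ⟨n, p, hp⟩ := Module.Finite.exists_fin' C W
  let x : Fin n → T.Extension W := fun j => T.inW (p (Pi.single j 1))
  refine Module.Finite.of_surjective (Fintype.linearCombination Λ x) ?_
  rw [← LinearMap.range_eq_top]
  refine T.submodule_eq_top _ fun w => ?_
  obtain ⟨c, rfl⟩ := hp w
  refine ⟨fun j => T.inC (c j), ?_⟩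
  rw [Fintype.linearCombination_apply, ← inW_apply]
  simp only [x, ← inW_smul, ← map_smul, ← map_sum]
  congr 2
  refine Eq.trans (Finset.sum_congr rfl fun i _ => ?_) (Finset.univ_sum_single c)
  rw [← Pi.single_smul, smul_eq_mul, mul_one]

/-- A `C`-linear section of `C^(W) → W`, with coefficients moved into `Λ`, extends from `W` to `Λ ⊗
W`. It is a section there because homomorphisms out of `Λ ⊗ W` are determined on `W`. -/
theorem projective_extension [Module.Projective C W] : Module.Projective Λ (T.Extension W) := by
  obtain ⟨s, hs⟩ := Module.Projective.out (R := C) (P := W)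
  let h : W →+ (T.Extension W →₀ Λ) :=
    (Finsupp.mapDomain.addMonoidHom T.inW).comp
      ((Finsupp.mapRange.addMonoidHom (T.inC : C →+ Λ)).comp s.toAddMonoidHom)
  have hh : ∀ w, h w = ((s w).mapRange T.inC (map_zero _)).mapDomain T.inW := fun w => rfl
  have hh' : ∀ c w, h (c • w) = T.inC c • h w := fun c w => by
    rw [hh, hh, map_smul, ← Finsupp.mapDomain_smul]
    congr 1
    ext y
    simp only [Finsupp.mapRange_apply, Finsupp.smul_apply, smul_eq_mul, map_mul]
  have H : Finsupp.linearCombination Λ id ∘ₗ T.extLift h hh' = LinearMap.id := by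
    refine extension_hom_ext fun w => ?_
    have h' := hs w
    rw [Finsupp.linearCombination_apply] at h'
    rw [LinearMap.comp_apply, extLift_pair, hh, Finsupp.linearCombination_mapDomain,
      Finsupp.linearCombination_apply, Finsupp.sum_mapRange_index (by simp)]
    simp only [Function.comp, id, ← inW_smul]
    conv_rhs => rw [← h']
    exact (map_finsuppSum T.inW (s w) fun i a => a • i).symm
  exact ⟨⟨T.extLift h hh', LinearMap.congr_fun H⟩⟩

/-- The inclusion of `B e ⊗ f W` in `Λ ⊗ W`. -/
def bridgeIncl : T.cornerB.Inflation (T.Bridge W) →ₗ[Λ] T.Extension W :=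
  T.linearMk (AddMonoidHom.mk' (fun n => T.pair (T.cornerB.toInfl.symm n) 0) fun m n => by
      rw [pair_add, add_zero, map_add])
    (fun b n => by
      obtain ⟨n, rfl⟩ := T.cornerB.toInfl.surjective n
      have := T.cornerB.incl_smul_toInfl b n
      rw [cornerB_incl] at this
      simp [this, inB_smul_pair])
    (fun c n => by
      obtain ⟨n, rfl⟩ := T.cornerB.toInfl.surjective n
      simp [T.cornerB.smul_toInfl, retB_inC, inC_smul_pair])
    (fun n => by
      obtain ⟨n, rfl⟩ := T.cornerB.toInfl.surjective n
      have : T.toCornerF (0 : W) = 0 := Subtype.ext (smul_zero T.f)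
      simp [T.cornerB.smul_toInfl, retB_arrow, arrow_smul_pair, this, pair_zero])

theorem bridgeIncl_apply (n : T.Bridge W) :
    T.bridgeIncl (T.cornerB.toInfl n) = T.pair n 0 := rfl

/-- The projection of `Λ ⊗ W` onto `W`. -/
def extProj : T.Extension W →ₗ[Λ] T.cornerC.Inflation W :=
  T.extLift (T.cornerC.toInfl (U := W)).toAddMonoidHom
    fun c w => (T.cornerC.incl_smul_toInfl c w).symm

theorem extProj_pair (n : T.Bridge W) (w : W) : T.extProj (T.pair n w) = T.cornerC.toInfl w := by
  have h : T.extProj (T.pair n 0) = 0 := by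
    -- The bridge is fixed by `ε_B`, which acts as zero on the inflation of a `C`-module.
    have : T.pair n (0 : W) = T.inB 1 • T.pair n 0 := by rw [inB_smul_pair, one_smul]
    rw [this, map_smul]
    obtain ⟨y, hy⟩ := T.cornerC.toInfl.surjective (T.extProj (T.pair n 0))
    rw [← hy, T.cornerC.smul_toInfl, retC_inB, zero_smul, map_zero]
  rw [← add_zero n, ← zero_add w, ← pair_add, map_add, h, zero_add, zero_add]
  exact T.extLift_pair _ _ w

end Extension

end OneArrowExtension

/-! ## Constructions on totally acyclic complexes -/

section TotallyAcyclic

variable {Γ : Type u} [Ring Γ] {P : ℤ → ModuleCat.{u} Γ} {d : ∀ n : ℤ, P n →ₗ[Γ] P (n + 1)}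

/-- The complex `P` stays exact under `Hom(-, N)`. -/
def DualExact (P : ℤ → ModuleCat.{u} Γ) (d : ∀ n : ℤ, P n →ₗ[Γ] P (n + 1)) (N : Type u)
    [AddCommGroup N] [Module Γ N] : Prop :=
  ∀ n (g : P (n + 1) →ₗ[Γ] N), g ∘ₗ d n = 0 → ∃ h : P (n + 1 + 1) →ₗ[Γ] N, h ∘ₗ d (n + 1) = g

theorem LinearMap.exists_comp_eq_of_range_le {X Y Z : Type*} [AddCommGroup X] [Module Γ X]
    [AddCommGroup Y] [Module Γ Y] [AddCommGroup Z] [Module Γ Z] {i : X →ₗ[Γ] Y}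
    (hi : Function.Injective i) (g : Z →ₗ[Γ] Y) (hg : ∀ z, ∃ x, i x = g z) :
    ∃ h : Z →ₗ[Γ] X, i ∘ₗ h = g := by
  let e := LinearEquiv.ofInjective i hi
  refine ⟨e.symm.toLinearMap ∘ₗ LinearMap.codRestrict (LinearMap.range i) g hg, ?_⟩
  ext z
  exact congrArg Subtype.val (e.apply_symm_apply ⟨g z, hg z⟩)

variable {N N₁ N₂ N₃ : Type u} [AddCommGroup N] [Module Γ N] [AddCommGroup N₁] [Module Γ N₁]
  [AddCommGroup N₂] [Module Γ N₂] [AddCommGroup N₃] [Module Γ N₃]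

/-- The terms of `P` are projective, so the short exact sequence of coefficients gives a short exact
sequence of Hom complexes. If two of these are exact, so is the third; the proof is the
corresponding diagram chase. -/
theorem DualExact.of_exact (hP : ∀ n, Module.Projective Γ (P n))
    (hd : ∀ n, Function.Exact (d n) (d (n + 1)))
    {i : N₁ →ₗ[Γ] N₂} {p : N₂ →ₗ[Γ] N₃} (hi : Function.Injective i)
    (hip : Function.Exact i p) (hp : Function.Surjective p)
    (h₁ : DualExact P d N₁) (h₂ : DualExact P d N₂) : DualExact P d N₃ := by
  have key : ∀ n (g : P (n + 1 + 1) →ₗ[Γ] N₃), g ∘ₗ d (n + 1) = 0 →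
      ∃ h : P (n + 1 + 1 + 1) →ₗ[Γ] N₃, h ∘ₗ d (n + 1 + 1) = g := by
    intro n g hg
    obtain ⟨k, hk⟩ := Module.projective_lifting_property p g hp
    obtain ⟨l, hl⟩ := LinearMap.exists_comp_eq_of_range_le hi (k ∘ₗ d (n + 1)) fun z => by
      refine (hip _).1 ?_
      exact (LinearMap.congr_fun hk (d (n + 1) z)).trans (LinearMap.congr_fun hg z)
    obtain ⟨m, hm⟩ := h₁ n l (by
      ext x
      apply hi
      refine (LinearMap.congr_fun hl (d n x)).trans ?_
      rw [LinearMap.comp_apply, (hd n).apply_apply_eq_zero, map_zero]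
      simp)
    obtain ⟨q, hq⟩ := h₂ (n + 1) (k - i ∘ₗ m) (by
      rw [LinearMap.sub_comp, LinearMap.comp_assoc, hm, hl, sub_self])
    refine ⟨p ∘ₗ q, ?_⟩
    rw [LinearMap.comp_assoc, hq, LinearMap.comp_sub, hk, ← LinearMap.comp_assoc,
      hip.linearMap_comp_eq_zero, LinearMap.zero_comp, sub_zero]
  intro n
  -- The chase uses `N₁` one degree below the target degree, and every integer is a successor.
  obtain ⟨m, rfl⟩ : ∃ m : ℤ, n = m + 1 := ⟨n - 1, by ring⟩
  exact key m

theorem DualExact.of_retract (h : DualExact P d N₁) (j : N →ₗ[Γ] N₁) (r : N₁ →ₗ[Γ] N)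
    (hrj : r ∘ₗ j = LinearMap.id) : DualExact P d N := by
  intro n g hg
  obtain ⟨k, hk⟩ := h n (j ∘ₗ g) (by rw [LinearMap.comp_assoc, hg, LinearMap.comp_zero])
  refine ⟨r ∘ₗ k, ?_⟩
  rw [LinearMap.comp_assoc, hk, ← LinearMap.comp_assoc, hrj, LinearMap.id_comp]

theorem DualExact.prod (h₁ : DualExact P d N₁) (h₂ : DualExact P d N₂) :
    DualExact P d (N₁ × N₂) := by
  intro n g hg
  obtain ⟨k, hk⟩ := h₁ n (LinearMap.fst _ _ _ ∘ₗ g) (by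
    rw [LinearMap.comp_assoc, hg, LinearMap.comp_zero])
  obtain ⟨l, hl⟩ := h₂ n (LinearMap.snd _ _ _ ∘ₗ g) (by
    rw [LinearMap.comp_assoc, hg, LinearMap.comp_zero])
  refine ⟨k.prod l, ?_⟩
  ext x
  · exact LinearMap.congr_fun hk x
  · exact LinearMap.congr_fun hl x

theorem IsTotallyAcyclic.dualExact (h : IsTotallyAcyclic Γ P d) [Module.Finite Γ N]
    [Module.Projective Γ N] : DualExact P d N := h.dual_projective

theorem IsTotallyAcyclic.isGorensteinProjective_of_exact (h : IsTotallyAcyclic Γ P d)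
    {G : ModuleCat.{u} Γ} (i : G →ₗ[Γ] P 0) (hi : Function.Injective i)
    (hid : Function.Exact i (d 0)) : IsGorensteinProjective Γ G :=
  h.isGorensteinProjective <| (LinearEquiv.ofInjective i hi).trans <|
    LinearEquiv.ofEq _ _ (LinearMap.exact_iff.1 hid).symm

theorem IsGorensteinProjective.exists_resolution {G : ModuleCat.{u} Γ}
    (hG : IsGorensteinProjective Γ G) : ∃ (P : ℤ → ModuleCat.{u} Γ)
      (d : ∀ n : ℤ, P n →ₗ[Γ] P (n + 1)) (i : G →ₗ[Γ] P 0),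
      IsTotallyAcyclic Γ P d ∧ Function.Injective i ∧ Function.Exact i (d 0) := by
  obtain ⟨P, d, h, ⟨e⟩⟩ := hG.exists_isTotallyAcyclic
  refine ⟨P, d, (LinearMap.ker (d 0)).subtype ∘ₗ e.toLinearMap, h,
    Subtype.val_injective.comp e.injective, ?_⟩
  rw [LinearMap.exact_iff, LinearMap.range_comp, LinearEquiv.range, Submodule.map_top,
    Submodule.range_subtype]

theorem IsTotallyAcyclic.prod (h : IsTotallyAcyclic Γ P d) {P' : ℤ → ModuleCat.{u} Γ}
    {d' : ∀ n : ℤ, P' n →ₗ[Γ] P' (n + 1)} (h' : IsTotallyAcyclic Γ P' d') :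
    IsTotallyAcyclic Γ (fun n => ModuleCat.of Γ (P n × P' n)) (fun n => (d n).prodMap (d' n)) where
  finite n := by
    have := h.finite n
    have := h'.finite n
    exact inferInstanceAs (Module.Finite Γ (P n × P' n))
  projective n := by
    have := h.projective n
    have := h'.projective n
    exact inferInstanceAs (Module.Projective Γ (P n × P' n))
  exact n := by
    rintro ⟨x, y⟩
    constructor
    · intro H
      obtain ⟨a, ha⟩ := (h.exact n x).1 (congrArg Prod.fst H)
      obtain ⟨b, hb⟩ := (h'.exact n y).1 (congrArg Prod.snd H)
      exact ⟨(a, b), Prod.ext ha hb⟩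
    · rintro ⟨⟨a, b⟩, H⟩
      obtain ⟨rfl, rfl⟩ := Prod.mk_inj.1 H
      exact Prod.ext ((h.exact n).apply_apply_eq_zero a) ((h'.exact n).apply_apply_eq_zero b)
  dual n g hg := by
    let g' : P (n + 1) × P' (n + 1) →ₗ[Γ] Γ := g
    have hg' : ∀ x : P n × P' n, g' (d n x.1, d' n x.2) = 0 := LinearMap.congr_fun hg
    obtain ⟨k, hk⟩ := h.dual n (g' ∘ₗ LinearMap.inl _ _ _) (by
      ext x
      simpa using hg' (x, 0))
    obtain ⟨l, hl⟩ := h'.dual n (g' ∘ₗ LinearMap.inr _ _ _) (by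
      ext x
      simpa using hg' (0, x))
    refine ⟨k.coprod l, ?_⟩
    change k.coprod l ∘ₗ (d (n + 1)).prodMap (d' (n + 1)) = g'
    ext x
    · simpa using LinearMap.congr_fun hk x
    · simpa using LinearMap.congr_fun hl x

theorem IsGorensteinProjective.prod {G G' : ModuleCat.{u} Γ} (h : IsGorensteinProjective Γ G)
    (h' : IsGorensteinProjective Γ G') : IsGorensteinProjective Γ (ModuleCat.of Γ (G × G')) := by
  obtain ⟨P, d, i, hP, hi, hid⟩ := h.exists_resolution
  obtain ⟨P', d', i', hP', hi', hid'⟩ := h'.exists_resolution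
  refine (hP.prod hP').isGorensteinProjective_of_exact (i.prodMap i') (hi.prodMap hi') ?_
  rintro ⟨x, y⟩
  constructor
  · intro H
    obtain ⟨a, ha⟩ := (hid x).1 (congrArg Prod.fst H)
    obtain ⟨b, hb⟩ := (hid' y).1 (congrArg Prod.snd H)
    exact ⟨(a, b), Prod.ext ha hb⟩
  · rintro ⟨⟨a, b⟩, H⟩
    obtain ⟨rfl, rfl⟩ := Prod.mk_inj.1 H
    exact Prod.ext (hid.apply_apply_eq_zero a) (hid'.apply_apply_eq_zero b)

theorem IsGorensteinProjective.finite {G : ModuleCat.{u} Γ} (h : IsGorensteinProjective Γ G) :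
    Module.Finite Γ G := by
  obtain ⟨P₀, P₁, P₂, a, b, c, _, _, _, _, _, hc, _⟩ := h.exists_presentation
  exact Module.Finite.of_surjective c hc

end TotallyAcyclic

/-! ### Complexes under inflation and reduction -/

namespace CornerRetract

variable {K A Λ : Type u} [Field K] [Ring A] [Ring Λ] [Algebra K A] [Algebra K Λ]
  (R : CornerRetract K A Λ) {X Y : Type u} [AddCommGroup X] [Module Λ X] [AddCommGroup Y]
  [Module Λ Y]

theorem map_surjective {f : X →ₗ[Λ] Y} (hf : Function.Surjective f) :
    Function.Surjective (R.map f) := fun y => by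
  obtain ⟨y, rfl⟩ := R.cls_surjective y
  obtain ⟨x, rfl⟩ := hf y
  exact ⟨R.cls x, R.map_cls f x⟩

/-- Inflation is fully faithful, so the two extension problems are the same. -/
theorem dualExact_inflation {P : ℤ → ModuleCat.{u} A} {d : ∀ n : ℤ, P n →ₗ[A] P (n + 1)}
    {N : Type u} [AddCommGroup N] [Module A N] (h : DualExact P d N) :
    DualExact (fun n => ModuleCat.of Λ (R.Inflation (P n))) (fun n => R.inflMap (U := P n) (V := P (n + 1)) (d n))
      (R.Inflation N) := by
  intro n g hg
  obtain ⟨k, hk⟩ := h n (R.deflMap (U := P (n + 1)) g) (LinearMap.ext fun x => LinearMap.congr_fun hg x)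
  exact ⟨R.inflMap (U := P (n + 1 + 1)) k, LinearMap.ext fun x => LinearMap.congr_fun hk x⟩

/-- By adjunction, maps from the reduction of `P n` to `A` are maps from `P n` to the inflation of
`A`; this is why `hA` is the condition required for the dual. -/
theorem isTotallyAcyclic_reduction {P : ℤ → ModuleCat.{u} Λ} {d : ∀ n : ℤ, P n →ₗ[Λ] P (n + 1)}
    (h : IsTotallyAcyclic Λ P d) (hd : ∀ n, Function.Exact (R.map (d n)) (R.map (d (n + 1))))
    (hA : DualExact P d (R.Inflation A)) :
    IsTotallyAcyclic A (fun n => ModuleCat.of A (R.Reduction (P n))) (fun n => R.map (d n)) where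
  finite n := by
    have := h.finite n
    exact R.finite_reduction (X := P n)
  projective n := by
    have := h.projective n
    exact R.projective_reduction (X := P n)
  exact := hd
  dual n g hg := by
    let g' : R.Reduction (P (n + 1)) →ₗ[A] A := g
    obtain ⟨k, hk⟩ := hA n (R.inflMap g' ∘ₗ R.quot) (by
      ext x
      have := LinearMap.congr_fun hg (R.cls x)
      rw [LinearMap.comp_apply, map_cls] at this
      exact congrArg R.toInfl this)
    refine ⟨R.lift k, reduction_hom_ext fun x => ?_⟩
    rw [LinearMap.comp_apply, map_cls, lift_cls]
    exact LinearMap.congr_fun hk x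

end CornerRetract

namespace OneArrowExtension

variable {K B C Λ : Type u} [Field K] [Ring B] [Ring C] [Ring Λ] [Algebra K B] [Algebra K C]
  [Algebra K Λ] (T : OneArrowExtension K B C Λ)

/-! ### The two reductions and the counit `Λ ⊗ X_C → X` -/

section Counit

variable {X Y Z V : Type u} [AddCommGroup X] [Module Λ X] [AddCommGroup Y] [Module Λ Y]
  [AddCommGroup Z] [Module Λ Z] [AddCommGroup V] [Module Λ V]

/-- The elements killed by `ε_C` form a `Λ`-submodule, because `ε_C Λ = ε_C Λ ε_C`. Hence `X_C` is
identified with `ε_C X`, from which the exactness of `X ↦ X_C` follows. -/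
theorem clsC_eq_zero {x : X} : T.cornerC.cls x = 0 ↔ T.inC 1 • x = 0 := by
  rw [CornerRetract.cls_eq_zero]
  constructor
  · intro h
    refine Submodule.span_induction ?_ (smul_zero _) ?_ ?_ h
    · rintro _ ⟨y, rfl⟩
      rw [smul_sub, cornerC_incl, ← mul_smul, ← map_mul, one_mul, sub_self]
    · intro x y _ _ hx hy
      rw [smul_add, hx, hy, add_zero]
    · intro l x _ hx
      rw [← mul_smul, inC_one_mul, ← mul_one (T.cornerC.ret l), map_mul, mul_smul, hx, smul_zero]
  · intro h
    refine Submodule.subset_span ⟨x, ?_⟩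
    simp only [cornerC_incl, h, sub_zero]

theorem clsC_eq {x y : X} : T.cornerC.cls x = T.cornerC.cls y ↔ T.inC 1 • x = T.inC 1 • y := by
  rw [← sub_eq_zero, ← CornerRetract.cls_sub, clsC_eq_zero, smul_sub, sub_eq_zero]

theorem exists_sec (X : Type u) [AddCommGroup X] [Module Λ X] :
    ∃ s : T.cornerC.Reduction X →+ X, ∀ x, s (T.cornerC.cls x) = T.inC 1 • x := by
  let s : T.cornerC.Reduction X → X := fun y =>
    T.inC 1 • Function.surjInv (T.cornerC.cls_surjective (X := X)) y
  have hs : ∀ x, s (T.cornerC.cls x) = T.inC 1 • x := fun x => by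
    rw [← clsC_eq]
    exact Function.surjInv_eq _ _
  refine ⟨AddMonoidHom.mk' s fun a b => ?_, hs⟩
  obtain ⟨a, rfl⟩ := T.cornerC.cls_surjective a
  obtain ⟨b, rfl⟩ := T.cornerC.cls_surjective b
  rw [← CornerRetract.cls_add, hs, hs, hs, smul_add]

/-- The section `X_C → X` of the projection with values in `ε X`. -/
def sec (X : Type u) [AddCommGroup X] [Module Λ X] : T.cornerC.Reduction X →+ X :=
  (T.exists_sec X).choose

theorem sec_cls (x : X) : T.sec X (T.cornerC.cls x) = T.inC 1 • x := (T.exists_sec X).choose_spec x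

theorem cls_sec (y : T.cornerC.Reduction X) : T.cornerC.cls (T.sec X y) = y := by
  obtain ⟨x, rfl⟩ := T.cornerC.cls_surjective y
  rw [sec_cls]
  exact T.cornerC.cls_incl_one_smul x

theorem sec_smul (c : C) (y : T.cornerC.Reduction X) : T.sec X (c • y) = T.inC c • T.sec X y := by
  obtain ⟨x, rfl⟩ := T.cornerC.cls_surjective y
  rw [← CornerRetract.cls_incl_smul, sec_cls, sec_cls, cornerC_incl, ← mul_smul, ← mul_smul,
    ← map_mul, ← map_mul, one_mul, mul_one]

variable (X) in
/-- The natural map `Λ ⊗ X_C → X`. -/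
def counit : T.Extension (T.cornerC.Reduction X) →ₗ[Λ] X := T.extLift (T.sec X) T.sec_smul

theorem counit_pair (y : T.cornerC.Reduction X) : T.counit X (T.pair 0 y) = T.sec X y :=
  T.extLift_pair _ _ y

theorem inC_one_smul_counit (n : T.Bridge (T.cornerC.Reduction X)) (y : T.cornerC.Reduction X) :
    T.inC 1 • T.counit X (T.pair n y) = T.sec X y := by
  rw [← map_smul, inC_smul_pair, one_smul, counit_pair]

theorem counit_naturality (f : X →ₗ[Λ] Y) :
    T.counit Y ∘ₗ T.extMap (T.cornerC.map f) = f ∘ₗ T.counit X := by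
  refine extension_hom_ext fun y => ?_
  obtain ⟨x, rfl⟩ := T.cornerC.cls_surjective y
  rw [LinearMap.comp_apply, LinearMap.comp_apply, extMap_pair, map_zero, counit_pair, counit_pair,
    CornerRetract.map_cls, sec_cls, sec_cls, map_smul]

theorem counit_extMap (f : X →ₗ[Λ] Y) (u : T.Extension (T.cornerC.Reduction X)) :
    T.counit Y (T.extMap (T.cornerC.map f) u) = f (T.counit X u) :=
  LinearMap.congr_fun (T.counit_naturality f) u

/-- Since `1 - ε_B = ε_C`, both sides are the submodule generated by `ε_C X`. Thus `X_B` is the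
cokernel of the counit. -/
theorem range_counit : LinearMap.range (T.counit X) = T.cornerB.relations X := by
  have h : ∀ x : X, x - T.inB 1 • x = T.inC 1 • x := fun x => by
    rw [sub_eq_iff_eq_add', inB_add_inC_smul]
  apply le_antisymm
  · rw [LinearMap.range_eq_map, Submodule.map_le_iff_le_comap, top_le_iff]
    refine T.submodule_eq_top _ fun y => ?_
    obtain ⟨x, rfl⟩ := T.cornerC.cls_surjective y
    rw [Submodule.mem_comap, counit_pair, sec_cls, ← h]
    exact Submodule.subset_span ⟨x, rfl⟩
  · rw [CornerRetract.relations, Submodule.span_le]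
    rintro _ ⟨x, rfl⟩
    refine ⟨T.pair 0 (T.cornerC.cls x), ?_⟩
    rw [counit_pair, sec_cls]
    exact (h x).symm

theorem clsB_eq_zero {x : X} : T.cornerB.cls x = 0 ↔ ∃ u, T.counit X u = x := by
  rw [CornerRetract.cls_eq_zero, ← range_counit]
  rfl

theorem clsB_counit (u : T.Extension (T.cornerC.Reduction X)) :
    T.cornerB.cls (T.counit X u) = 0 := T.clsB_eq_zero.2 ⟨u, rfl⟩

/-- Allows `f` itself to have a kernel outside the `C` part, as happens in `isMonic_of_projective`.
-/
theorem mapC_injective_of {f : X →ₗ[Λ] Y} (hf : ∀ x, T.inC 1 • f x = 0 → T.inC 1 • x = 0) :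
    Function.Injective (T.cornerC.map f) := by
  rw [injective_iff_map_eq_zero]
  intro y hy
  obtain ⟨x, rfl⟩ := T.cornerC.cls_surjective y
  rw [CornerRetract.map_cls, clsC_eq_zero] at hy
  rw [clsC_eq_zero]
  exact hf x hy

theorem mapC_injective {f : X →ₗ[Λ] Y} (hf : Function.Injective f) :
    Function.Injective (T.cornerC.map f) :=
  T.mapC_injective_of fun x hx => hf (by rw [map_smul, hx, map_zero])

theorem mapC_exact {f : X →ₗ[Λ] Y} {g : Y →ₗ[Λ] Z} (H : Function.Exact f g) :
    Function.Exact (T.cornerC.map f) (T.cornerC.map g) := by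
  intro y
  obtain ⟨y, rfl⟩ := T.cornerC.cls_surjective y
  rw [CornerRetract.map_cls, clsC_eq_zero]
  constructor
  · intro hy
    obtain ⟨x, hx⟩ := (H (T.inC 1 • y)).1 (by rw [map_smul, hy])
    refine ⟨T.cornerC.cls x, ?_⟩
    rw [CornerRetract.map_cls, hx]
    exact T.cornerC.cls_incl_one_smul y
  · rintro ⟨x, hx⟩
    obtain ⟨x, rfl⟩ := T.cornerC.cls_surjective x
    rw [CornerRetract.map_cls, clsC_eq] at hx
    rw [← map_smul, ← hx, ← map_smul, H.apply_apply_eq_zero]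

/-- The map `Λ ⊗ X_C → X` is injective. -/
def IsMonic (X : Type u) [AddCommGroup X] [Module Λ X] : Prop := Function.Injective (T.counit X)

variable {T}

/-- In the naturality square of the counit, the path through `Λ ⊗ Y_C` is injective, so the counit
of `X`, the first map of the other path, is injective too. -/
theorem IsMonic.of_mapC_injective (hY : T.IsMonic Y) (f : X →ₗ[Λ] Y)
    (hf : Function.Injective (T.cornerC.map f)) : T.IsMonic X := by
  have h := hY.comp (T.extMap_injective hf)
  have h' : ⇑(T.counit Y) ∘ ⇑(T.extMap (T.cornerC.map f)) = ⇑f ∘ ⇑(T.counit X) :=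
    congrArg DFunLike.coe (T.counit_naturality f)
  rw [h'] at h
  exact h.of_comp

theorem IsMonic.of_injective (hY : T.IsMonic Y) {f : X →ₗ[Λ] Y} (hf : Function.Injective f) :
    T.IsMonic X := hY.of_mapC_injective f (T.mapC_injective hf)

variable (T) in
-- The projection identifies the `C`-reduction of `Λ ⊗ W` with `W`, and under this identification
-- the counit is the identity.
theorem isMonic_extension (W : Type u) [AddCommGroup W] [Module C W] :
    T.IsMonic (T.Extension W) := by
  have h : ∀ n w, T.cornerC.lift T.extProj (T.cornerC.cls (T.pair n w)) = (w : W) := fun n w => by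
    rw [CornerRetract.lift_cls, extProj_pair, AddEquiv.symm_apply_apply]
  have hinj : Function.Injective (T.cornerC.lift (T.extProj (W := W))) := by
    rw [injective_iff_map_eq_zero]
    intro y hy
    obtain ⟨x, rfl⟩ := T.cornerC.cls_surjective y
    obtain ⟨n, w, rfl⟩ := T.exists_pair x
    rw [h] at hy
    rw [clsC_eq_zero, hy, inC_smul_pair, smul_zero, pair_zero]
  have heq : T.counit (T.Extension W) = T.extMap (T.cornerC.lift T.extProj) := by
    refine extension_hom_ext fun y => ?_
    obtain ⟨x, rfl⟩ := T.cornerC.cls_surjective y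
    obtain ⟨n, w, rfl⟩ := T.exists_pair x
    rw [counit_pair, sec_cls, extMap_pair, h, map_zero, inC_smul_pair, one_smul]
  rw [IsMonic, heq]
  exact T.extMap_injective hinj

variable (T) in
-- A projective embeds in a free module, and `Λ` maps onto `Λ ⊗ C` with no loss on the `C` part. So
-- the `C`-reduction of `X` embeds in that of an induced module.
theorem isMonic_of_projective [Module.Projective Λ X] : T.IsMonic X := by
  obtain ⟨s, hs⟩ := Module.Projective.out (R := Λ) (P := X)
  let q : (X →₀ Λ) →ₗ[Λ] T.Extension (X →₀ C) :=
    Finsupp.linearCombination Λ fun x => T.inW (Finsupp.single x 1)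
  let r : (X →₀ Λ) →+ (X →₀ C) := Finsupp.mapRange.addMonoidHom T.cornerC.ret
  -- After multiplication by `ε_C`, the map `q` is the coordinatewise retraction `Λ → C`, which is
  -- injective on `ε_C Λ`.
  have hq : ∀ a, T.inC 1 • q a = T.inW (r a) := by
    intro a
    induction a using Finsupp.induction_linear with
    | zero => simp
    | add a b ha hb => rw [map_add, smul_add, ha, hb, map_add, map_add]
    | single x l =>
      have : r (Finsupp.single x l) = T.cornerC.ret l • Finsupp.single x (1 : C) := by
        rw [Finsupp.smul_single, smul_eq_mul, mul_one]
        exact Finsupp.mapRange_single (hf := map_zero _)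
      rw [this, inW_smul, Finsupp.linearCombination_single, ← mul_smul, inC_one_mul]
  refine (T.isMonic_extension (X →₀ C)).of_mapC_injective (q ∘ₗ s)
    (T.mapC_injective_of fun x hx => ?_)
  rw [LinearMap.comp_apply, hq, inW_apply, pair_eq_zero] at hx
  apply hs.injective
  rw [map_smul, map_zero]
  ext y
  rw [Finsupp.smul_apply, smul_eq_mul, inC_one_mul]
  have := DFunLike.congr_fun hx.2 y
  rw [show r (s x) y = T.cornerC.ret (s x y) from rfl] at this
  rw [this]
  simp

/-- If the class of `g y` vanishes, then `g y` is the counit of some `u`. The counit of `V` sends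
the image of `u` to `h (g y) = 0`, so by injectivity and the exactness of `Λ ⊗ (-)_C` the element
`u` comes from some `t` over `Y`. Correcting `y` by the counit of `t` puts it in the image of `f`.
-/
theorem mapB_exact {f : X →ₗ[Λ] Y} {g : Y →ₗ[Λ] Z} {h : Z →ₗ[Λ] V} (hfg : Function.Exact f g)
    (hgh : Function.Exact g h) (hV : T.IsMonic V) :
    Function.Exact (T.cornerB.map f) (T.cornerB.map g) := by
  intro y
  obtain ⟨y, rfl⟩ := T.cornerB.cls_surjective y
  rw [CornerRetract.map_cls]
  constructor
  · intro hy
    obtain ⟨u, hu⟩ := T.clsB_eq_zero.1 hy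
    obtain ⟨t, rfl⟩ := (T.extMap_exact (T.mapC_exact hgh) u).1 (hV (by
      rw [counit_extMap, hu, hgh.apply_apply_eq_zero, map_zero]))
    rw [counit_extMap] at hu
    obtain ⟨x, hx⟩ := (hfg (y - T.counit Y t)).1 (by rw [map_sub, hu, sub_self])
    refine ⟨T.cornerB.cls x, ?_⟩
    rw [CornerRetract.map_cls, hx, CornerRetract.cls_sub, clsB_counit, sub_zero]
  · rintro ⟨x, hx⟩
    obtain ⟨x, rfl⟩ := T.cornerB.cls_surjective x
    have := congrArg (T.cornerB.map g) hx
    rw [CornerRetract.map_cls, CornerRetract.map_cls, CornerRetract.map_cls,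
      hfg.apply_apply_eq_zero, CornerRetract.cls_zero] at this
    exact this.symm

theorem mapB_injective {f : X →ₗ[Λ] Y} {g : Y →ₗ[Λ] Z} (hf : Function.Injective f)
    (hfg : Function.Exact f g) (hZ : T.IsMonic Z) : Function.Injective (T.cornerB.map f) := by
  have h0 : Function.Exact (0 : PUnit.{u + 1} →ₗ[Λ] X) f := by
    rw [LinearMap.exact_iff, LinearMap.range_zero, LinearMap.ker_eq_bot]
    exact hf
  rw [injective_iff_map_eq_zero]
  intro y hy
  obtain ⟨x, rfl⟩ := (mapB_exact h0 hfg hZ y).1 hy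
  obtain ⟨x, rfl⟩ := T.cornerB.cls_surjective x
  rw [CornerRetract.map_cls, LinearMap.zero_apply, CornerRetract.cls_zero]

end Counit

/-! ### Preservation of Gorenstein projective modules -/

section Gorenstein

instance projective_inflation_bridge (W : Type u) [AddCommGroup W] [Module C W] :
    Module.Projective Λ (T.cornerB.Inflation (T.Bridge W)) :=
  T.cornerB.projective_inflation T.mul_inB

theorem bridgeIncl_injective (W : Type u) [AddCommGroup W] [Module C W] :
    Function.Injective (T.bridgeIncl (W := W)) := by
  intro x y h
  obtain ⟨x, rfl⟩ := T.cornerB.toInfl.surjective x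
  obtain ⟨y, rfl⟩ := T.cornerB.toInfl.surjective y
  rw [bridgeIncl_apply, bridgeIncl_apply, pair_inj] at h
  rw [h.1]

theorem bridgeIncl_extProj_exact (W : Type u) [AddCommGroup W] [Module C W] :
    Function.Exact (T.bridgeIncl (W := W)) T.extProj := by
  intro x
  obtain ⟨n, w, rfl⟩ := T.exists_pair x
  rw [extProj_pair]
  constructor
  · intro h
    obtain rfl : w = 0 := T.cornerC.toInfl.injective (h.trans (map_zero _).symm)
    exact ⟨T.cornerB.toInfl n, rfl⟩
  · rintro ⟨y, hy⟩
    obtain ⟨y, rfl⟩ := T.cornerB.toInfl.surjective y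
    rw [bridgeIncl_apply, pair_inj] at hy
    rw [← hy.2, map_zero]

theorem extProj_surjective (W : Type u) [AddCommGroup W] [Module C W] :
    Function.Surjective (T.extProj (W := W)) := fun y => by
  obtain ⟨y, rfl⟩ := T.cornerC.toInfl.surjective y
  exact ⟨T.pair 0 y, T.extProj_pair _ _⟩

/-- An element of `Λ ⊗ W` fixed by the unit of `B` is in `B e ⊗ f W`. -/
theorem exists_bridgeIncl_eq {W : Type u} [AddCommGroup W] [Module C W] {x : T.Extension W}
    (hx : T.inB 1 • x = x) : ∃ n, T.bridgeIncl n = x := by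
  obtain ⟨n, w, rfl⟩ := T.exists_pair x
  rw [inB_smul_pair, pair_inj] at hx
  refine ⟨T.cornerB.toInfl n, ?_⟩
  rw [bridgeIncl_apply, hx.2]

/-- A Gorenstein projective module embeds in a projective one, and injectivity of the counit passes
to submodules. -/
theorem IsMonic.of_isGorensteinProjective {G : ModuleCat.{u} Λ}
    (hG : IsGorensteinProjective Λ G) : T.IsMonic G := by
  obtain ⟨P, d, i, hP, hi, hid⟩ := hG.exists_resolution
  have := hP.projective 0
  exact (T.isMonic_of_projective (X := P 0)).of_injective hi

/-- All terms of a totally acyclic complex have injective counit, so its `B`-reduction is exact. The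
dual condition holds because `B` over `Λ` is the finitely generated projective module `Λ ε_B`. -/
theorem isStablyExact_cornerB : IsStablyExact T.cornerB.functor where
  gproj G hG := by
    obtain ⟨P, d, i, hP, hi, hid⟩ := hG.exists_resolution
    have hmonic : ∀ n, T.IsMonic (P n) := fun n => by
      have := hP.projective n
      exact T.isMonic_of_projective
    have : Module.Finite Λ (T.cornerB.Inflation B) := T.cornerB.finite_inflation
    have : Module.Projective Λ (T.cornerB.Inflation B) := T.cornerB.projective_inflation T.mul_inB
    have h := T.cornerB.isTotallyAcyclic_reduction hP
      (fun n => mapB_exact (hP.exact n) (hP.exact (n + 1)) (hmonic _)) hP.dualExact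
    exact h.isGorensteinProjective_of_exact (T.cornerB.map i) (mapB_injective hi hid (hmonic _))
      (mapB_exact hid (hP.exact 0) (hmonic _))
  finite P _ _ := T.cornerB.finite_reduction (X := P)
  projective P _ _ := T.cornerB.projective_reduction (X := P)
  exact {X Y Z} f g hZ hf hfg hg := by
    have hZ' := IsMonic.of_isGorensteinProjective (T := T) hZ
    -- The sequence is prolonged by the zero module so that `mapB_exact` also applies at `Y`.
    have h0 : Function.Exact g.hom (0 : Z →ₗ[Λ] PUnit.{u + 1}) := by
      rw [LinearMap.exact_zero_iff_surjective]
      exact hg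
    have h1 : T.IsMonic PUnit.{u + 1} := hZ'.of_injective (f := (0 : PUnit.{u + 1} →ₗ[Λ] Z))
      (Function.injective_of_subsingleton _)
    exact ⟨mapB_injective hf hfg hZ', mapB_exact hfg h0 h1, T.cornerB.map_surjective hg⟩

/-- `X ↦ X_C` is exact, so only the dual condition needs an argument. Over `Λ`, the module `C` has
the resolution `0 → Be ⊗ fC → Λ ⊗ C → C → 0` by finitely generated projectives, and
`DualExact.of_exact` transfers exactness to `C`. -/
theorem isStablyExact_cornerC [Module.Finite K B] [Module.Finite K C] :
    IsStablyExact T.cornerC.functor where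
  gproj G hG := by
    obtain ⟨P, d, i, hP, hi, hid⟩ := hG.exists_resolution
    have : Module.Finite B (T.Bridge C) := T.finite_bridge C
    have : Module.Finite Λ (T.cornerB.Inflation (T.Bridge C)) := T.cornerB.finite_inflation
    have : Module.Finite Λ (T.Extension C) := T.finite_extension
    have : Module.Projective Λ (T.Extension C) := T.projective_extension
    have h := T.cornerC.isTotallyAcyclic_reduction hP (fun n => T.mapC_exact (hP.exact n))
      (DualExact.of_exact hP.projective hP.exact (T.bridgeIncl_injective C)
        (T.bridgeIncl_extProj_exact C) (T.extProj_surjective C) hP.dualExact hP.dualExact)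
    exact h.isGorensteinProjective_of_exact (T.cornerC.map i) (T.mapC_injective hi)
      (T.mapC_exact hid)
  finite P _ _ := T.cornerC.finite_reduction (X := P)
  projective P _ _ := T.cornerC.projective_reduction (X := P)
  exact f g _ hf hfg hg := ⟨T.mapC_injective hf, T.mapC_exact hfg, T.cornerC.map_surjective hg⟩

/-- A `Λ`-linear map `Λ ⊗ P → Λ` is a `C`-linear map from `P` to `ε_C Λ`, and `ε_C Λ` is a copy of
`C`. The dual complex is therefore the dual of `P` over `C`. -/
theorem isTotallyAcyclic_extension {P : ℤ → ModuleCat.{u} C} {d : ∀ n : ℤ, P n →ₗ[C] P (n + 1)}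
    (h : IsTotallyAcyclic C P d) :
    IsTotallyAcyclic Λ (fun n => ModuleCat.of Λ (T.Extension (P n))) (fun n => T.extMap (d n)) where
  finite n := by
    have := h.finite n
    exact T.finite_extension (W := P n)
  projective n := by
    have := h.projective n
    exact T.projective_extension (W := P n)
  exact n := T.extMap_exact (h.exact n)
  dual n g hg := by
    let g' : T.Extension (P (n + 1)) →ₗ[Λ] Λ := g
    have hgC : ∀ c w, g' (T.pair 0 (c • w)) = T.inC c * g' (T.pair 0 w) := fun c w => by
      rw [← smul_eq_mul, ← map_smul, inC_smul_pair]
    let k : P (n + 1) →ₗ[C] C :=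
      { toFun := fun w => T.cornerC.ret (g' (T.pair 0 w))
        map_add' := fun v w => by rw [← map_add, ← map_add, pair_add, add_zero]
        map_smul' := fun c w => by
          rw [hgC, map_mul]
          exact congrArg (· * _) (T.cornerC.ret_incl c) }
    have hk : ∀ w, g' (T.pair 0 w) = T.inC (k w) := fun w => by
      rw [← one_smul C w, hgC, inC_one_mul, one_smul]
      rfl
    obtain ⟨l, hl⟩ := h.dual n k (by
      ext w
      have h1 := LinearMap.congr_fun hg (T.pair 0 w)
      rw [LinearMap.comp_apply, extMap_pair, map_zero] at h1
      exact (congrArg T.cornerC.ret h1).trans (map_zero _))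
    let l' : P (n + 1 + 1) →+ Λ := (T.inC : C →+ Λ).comp l.toAddMonoidHom
    have hl' : ∀ w, l' w = T.inC (l w) := fun w => rfl
    refine ⟨T.extLift l' fun c w => ?_, extension_hom_ext (W := P (n + 1)) fun w => ?_⟩
    · rw [hl', hl', map_smul, smul_eq_mul, map_mul, smul_eq_mul]
    · rw [LinearMap.comp_apply, extMap_pair, map_zero, extLift_pair, hl']
      exact (congrArg T.inC (LinearMap.congr_fun hl w)).trans (hk w).symm

theorem isGorensteinProjective_extension {W : ModuleCat.{u} C} (hW : IsGorensteinProjective C W) :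
    IsGorensteinProjective Λ (ModuleCat.of Λ (T.Extension W)) := by
  obtain ⟨P, d, i, hP, hi, hid⟩ := hW.exists_resolution
  exact (T.isTotallyAcyclic_extension hP).isGorensteinProjective_of_exact (T.extMap i)
    (T.extMap_injective hi) (T.extMap_exact hid)

variable [Module.Finite K B] [Module.Finite K C]

/-- For the dual condition, `Λ` is a retract of `B ⊕ Λ ⊗ C`. A map from a `B`-module to `Λ ⊗ C` has
image fixed by `ε_B`, so it lands in `Be ⊗ fC`. Both coefficient modules `B` and `Be ⊗ fC` are
finitely generated projective over `B`. -/
theorem isTotallyAcyclic_inflation {P : ℤ → ModuleCat.{u} B} {d : ∀ n : ℤ, P n →ₗ[B] P (n + 1)}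
    (h : IsTotallyAcyclic B P d) :
    IsTotallyAcyclic Λ (fun n => ModuleCat.of Λ (T.cornerB.Inflation (P n)))
      (fun n => T.cornerB.inflMap (U := P n) (V := P (n + 1)) (d n)) where
  finite n := by
    have := h.finite n
    exact T.cornerB.finite_inflation (U := P n)
  projective n := by
    have := h.projective n
    exact T.cornerB.projective_inflation (U := P n) T.mul_inB
  exact n := h.exact n
  dual := by
    have : Module.Finite B (T.Bridge C) := T.finite_bridge C
    have h1 := T.cornerB.dualExact_inflation (h.dualExact (N := B))
    have h2 := T.cornerB.dualExact_inflation (h.dualExact (N := T.Bridge C))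
    have h3 : DualExact (fun n => ModuleCat.of Λ (T.cornerB.Inflation (P n)))
        (fun n => T.cornerB.inflMap (U := P n) (V := P (n + 1)) (d n)) (T.Extension C) := by
      intro n g hg
      obtain ⟨g', rfl⟩ := LinearMap.exists_comp_eq_of_range_le (T.bridgeIncl_injective C) g
        fun z => T.exists_bridgeIncl_eq (by
          rw [← map_smul]
          exact congrArg g (T.cornerB.incl_one_smul (U := P (n + 1)) z))
      obtain ⟨k, hk⟩ := h2 n g' (by
        ext x
        exact T.bridgeIncl_injective C ((LinearMap.congr_fun hg x).trans (map_zero _).symm))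
      exact ⟨T.bridgeIncl ∘ₗ k, by rw [LinearMap.comp_assoc, hk]⟩
    let r : T.cornerB.Inflation B →ₗ[Λ] Λ :=
      { toFun := fun b => T.inB (T.cornerB.toInfl.symm b)
        map_add' := fun a b => by rw [map_add, map_add]
        map_smul' := fun l b => by
          obtain ⟨b, rfl⟩ := T.cornerB.toInfl.surjective b
          rw [CornerRetract.smul_toInfl, RingHom.id_apply, AddEquiv.symm_apply_apply,
            AddEquiv.symm_apply_apply, smul_eq_mul, smul_eq_mul, mul_inB] }
    let s : T.Extension C →ₗ[Λ] Λ := T.extLift (T.inC : C →+ Λ) fun c w => map_mul T.inC c w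
    -- The retraction property is checked on the generator `1`, where it reads `ε_B + ε_C = 1`.
    refine (h1.prod h3).of_retract
      (LinearMap.toSpanSingleton Λ _ (T.cornerB.toInfl 1, T.pair 0 1)) (r.coprod s) ?_
    refine LinearMap.ext_ring ?_
    rw [LinearMap.comp_apply, LinearMap.toSpanSingleton_apply, one_smul, LinearMap.coprod_apply]
    refine Eq.trans (congrArg (r _ + ·) (T.extLift_pair _ _ 1)) T.inB_one_add

theorem isGorensteinProjective_inflation {U : ModuleCat.{u} B} (hU : IsGorensteinProjective B U) :
    IsGorensteinProjective Λ (ModuleCat.of Λ (T.cornerB.Inflation U)) := by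
  obtain ⟨P, d, i, hP, hi, hid⟩ := hU.exists_resolution
  exact (T.isTotallyAcyclic_inflation hP).isGorensteinProjective_of_exact
    (T.cornerB.inflMap (U := U) (V := P 0) i)
    hi hid

end Gorenstein

end OneArrowExtension

namespace OneArrowExtension

variable {K B C Λ : Type u} [Field K] [Ring B] [Ring C] [Ring Λ] [Algebra K B] [Algebra K C]
  [Algebra K Λ] (T : OneArrowExtension K B C Λ)

/-! ## Splitting Gorenstein projective modules -/

section Splitting

theorem clsC_counit {X : Type u} [AddCommGroup X] [Module Λ X]
    (n : T.Bridge (T.cornerC.Reduction X)) (y : T.cornerC.Reduction X) :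
    T.cornerC.cls (T.counit X (T.pair n y)) = y := by
  rw [← CornerRetract.cls_incl_one_smul, cornerC_incl, inC_one_smul_counit, cls_sec]

theorem inC_smul_inflation {U : Type u} [AddCommGroup U] [Module B U] (c : C)
    (x : T.cornerB.Inflation U) : T.inC c • x = 0 := by
  obtain ⟨x, rfl⟩ := T.cornerB.toInfl.surjective x
  rw [CornerRetract.smul_toInfl, retB_inC, zero_smul, map_zero]

variable [Module.Finite K B] [Module.Finite K C]

/-- Although `Λ ⊗ X_C` need not be projective, `X → X_B` splits. It is already surjective on the
kernel `S` of `X → X_C`, and there its kernel is the finitely generated projective `Be ⊗ f X_C`. As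
`X_B` is Gorenstein projective over `Λ`, the identity of that projective extends to `S`. -/
theorem exists_splitting {X : ModuleCat.{u} Λ} (hX : IsGorensteinProjective Λ X) :
    ∃ (s : T.cornerB.Inflation (T.cornerB.Reduction X) →ₗ[Λ] X)
      (r : X →ₗ[Λ] T.Extension (T.cornerC.Reduction X)),
      (∀ y, T.cornerB.quot (s y) = y) ∧ ∀ x, T.counit X (r x) + s (T.cornerB.quot x) = x := by
  have hmonic := IsMonic.of_isGorensteinProjective (T := T) hX
  have := hX.finite
  have : Module.Finite C (T.cornerC.Reduction X) := T.cornerC.finite_reduction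
  have : Module.Finite B (T.Bridge (T.cornerC.Reduction X)) := T.finite_bridge _
  have : Module.Finite Λ (T.cornerB.Inflation (T.Bridge (T.cornerC.Reduction X))) :=
    T.cornerB.finite_inflation
  let S : Submodule Λ X := LinearMap.ker (T.cornerC.quot (X := X))
  have hS : ∀ x, x ∈ S ↔ T.inC 1 • x = 0 := fun x => T.clsC_eq_zero
  have hcounit : ∀ n, T.counit X (T.bridgeIncl n) ∈ S := fun n => by
    rw [hS, ← map_smul, ← map_smul, inC_smul_inflation, map_zero, map_zero]
  let i : T.cornerB.Inflation (T.Bridge (T.cornerC.Reduction X)) →ₗ[Λ] S :=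
    LinearMap.codRestrict S (T.counit X ∘ₗ T.bridgeIncl) hcounit
  let p : S →ₗ[Λ] ModuleCat.of Λ (T.cornerB.Inflation (T.cornerB.Reduction X)) :=
    T.cornerB.quot ∘ₗ S.subtype
  have hi : Function.Injective i := fun x y h =>
    T.bridgeIncl_injective _ (hmonic (congrArg Subtype.val h))
  have hp : Function.Surjective p := fun y => by
    obtain ⟨x, rfl⟩ := T.cornerB.quot_surjective y
    refine ⟨⟨T.inB 1 • x, ?_⟩, T.cornerB.quot_incl_one_smul x⟩
    rw [hS, ← mul_smul, T.inC_mul_inB, zero_smul]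
  have hpz : ∀ x : S, p x = 0 → ∃ n, i n = x := by
    rintro ⟨x, hx⟩ h
    obtain ⟨u, rfl⟩ := T.clsB_eq_zero.1 h
    obtain ⟨n, y, rfl⟩ := T.exists_pair u
    rw [hS, inC_one_smul_counit] at hx
    -- An element of `Λ ⊗ X_C` whose counit lies in `S` has no `W` component, hence lies in the
    -- bridge.
    obtain rfl : y = 0 := by rw [← T.cls_sec y, hx, CornerRetract.cls_zero]
    exact ⟨T.cornerB.toInfl n, rfl⟩
  have hpi : ∀ n, p (i n) = 0 := fun n => T.clsB_counit _
  have hip : Function.Exact i p := fun x =>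
    ⟨hpz x, by rintro ⟨n, rfl⟩; exact hpi n⟩
  have hZ := T.isGorensteinProjective_inflation (T.isStablyExact_cornerB.gproj X hX)
  obtain ⟨t, ht⟩ := IsGorensteinProjective.exists_extension hZ hi hip hp LinearMap.id
  have ht' : ∀ n, t (i n) = n := LinearMap.congr_fun ht
  -- The projection `x ↦ x - i (t x)` along the retraction `t` vanishes on the kernel of `p`, so it
  -- descends to a section on `X_B`.
  obtain ⟨s, hs⟩ := LinearMap.exists_comp_eq_of_ker_le p hp (S.subtype - S.subtype ∘ₗ i ∘ₗ t) (by
    intro x hx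
    obtain ⟨n, rfl⟩ := hpz x hx
    simp [ht'])
  have hs' : ∀ x, s (p x) = x - i (t x) := LinearMap.congr_fun hs
  have hqs : ∀ y, T.cornerB.quot (s y) = y := fun y => by
    obtain ⟨x, rfl⟩ := hp y
    rw [hs', map_sub]
    exact (congrArg (p x - ·) (hpi (t x))).trans (sub_zero _)
  -- What remains of `x` after subtracting its `X_B` component dies in `X_B`, so it comes from a
  -- unique element of `Λ ⊗ X_C`.
  obtain ⟨r, hr⟩ := LinearMap.exists_comp_eq_of_range_le hmonic
    (LinearMap.id - s ∘ₗ T.cornerB.quot) fun x => by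
      refine T.clsB_eq_zero.1 ?_
      change T.cornerB.quot (x - s (T.cornerB.quot x)) = 0
      rw [map_sub, hqs, sub_self]
  refine ⟨s, r, hqs, fun x => ?_⟩
  have : T.counit X (r x) = x - s (T.cornerB.quot x) := LinearMap.congr_fun hr x
  rw [this, sub_add_cancel]

/-- Fullness on the level of modules: `f` is the diagonal matrix with entries `g` and `Λ ⊗ h` in the
two splittings. -/
theorem exists_map_eq {X Y : ModuleCat.{u} Λ} (hX : IsGorensteinProjective Λ X)
    (hY : IsGorensteinProjective Λ Y) (g : T.cornerB.Reduction X →ₗ[B] T.cornerB.Reduction Y)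
    (h : T.cornerC.Reduction X →ₗ[C] T.cornerC.Reduction Y) :
    ∃ f : X →ₗ[Λ] Y, T.cornerB.map f = g ∧ T.cornerC.map f = h := by
  obtain ⟨s, r, hs, hr⟩ := T.exists_splitting hX
  obtain ⟨s', r', hs', hr'⟩ := T.exists_splitting hY
  have hsC : ∀ y, T.cornerC.cls (s' y) = 0 := fun y => by
    rw [clsC_eq_zero, ← map_smul, inC_smul_inflation, map_zero]
  have hsC' : ∀ y, T.cornerC.cls (s y) = 0 := fun y => by
    rw [clsC_eq_zero, ← map_smul, inC_smul_inflation, map_zero]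
  let f : X →ₗ[Λ] Y := T.counit Y ∘ₗ T.extMap h ∘ₗ r + s' ∘ₗ T.cornerB.inflMap g ∘ₗ T.cornerB.quot
  have hf : ∀ x, f x = T.counit Y (T.extMap h (r x)) +
    s' (T.cornerB.inflMap g (T.cornerB.quot x)) := fun x => rfl
  refine ⟨f, CornerRetract.reduction_hom_ext fun x => ?_,
    CornerRetract.reduction_hom_ext fun x => ?_⟩
  · rw [CornerRetract.map_cls, hf, CornerRetract.cls_add, clsB_counit, zero_add]
    exact hs' (T.cornerB.inflMap g (T.cornerB.quot x))
  · have hx := congrArg T.cornerC.cls (hr x)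
    rw [CornerRetract.map_cls, hf, CornerRetract.cls_add, hsC, add_zero]
    rw [CornerRetract.cls_add, hsC', add_zero] at hx
    obtain ⟨n, y, hy⟩ := T.exists_pair (r x)
    rw [hy, clsC_counit] at hx
    rw [hy, extMap_pair, clsC_counit, hx]

/-- Faithfulness: in the splittings of `X` and `Y`, the diagonal entries of `f` factor through the
inflation of `P` and through `Λ ⊗ Q`. The entry `X_B → Λ ⊗ Y_C` factors through the bridge, which is
projective, and the remaining entry is zero. -/
theorem factorsThroughProjective_of_map {X Y : ModuleCat.{u} Λ} (hX : IsGorensteinProjective Λ X)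
    (hY : IsGorensteinProjective Λ Y) (f : X ⟶ Y)
    (hB : FactorsThroughProjective (T.cornerB.functor.map f))
    (hC : FactorsThroughProjective (T.cornerC.functor.map f)) : FactorsThroughProjective f := by
  obtain ⟨s, r, hs, hr⟩ := T.exists_splitting hX
  obtain ⟨s', r', hs', hr'⟩ := T.exists_splitting hY
  have := hY.finite
  have : Module.Finite C (T.cornerC.Reduction Y) := T.cornerC.finite_reduction
  have : Module.Finite B (T.Bridge (T.cornerC.Reduction Y)) := T.finite_bridge _
  obtain ⟨P, _, _, a, b, hab⟩ := hB
  obtain ⟨Q, _, _, c, d, hcd⟩ := hC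
  -- The source is fixed by `ε_B`, so the off-diagonal entry has values in `Be ⊗ f Y_C`.
  obtain ⟨m, hm⟩ := LinearMap.exists_comp_eq_of_range_le (T.bridgeIncl_injective _)
    (r' ∘ₗ f.hom ∘ₗ s) fun z => T.exists_bridgeIncl_eq (by
      rw [← map_smul]
      exact congrArg _ (T.cornerB.incl_one_smul z))
  have h₁ : FactorsThroughProjective (ModuleCat.ofHom
      ((s' ∘ₗ T.cornerB.inflMap (U := P) b.hom) ∘ₗ
        T.cornerB.inflMap (V := P) a.hom ∘ₗ T.cornerB.quot) : X ⟶ Y) :=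
    ⟨ModuleCat.of Λ (T.cornerB.Inflation P), T.cornerB.finite_inflation (U := P),
      T.cornerB.projective_inflation (U := P) T.mul_inB, ModuleCat.ofHom _, ModuleCat.ofHom _, rfl⟩
  have h₂ : FactorsThroughProjective (ModuleCat.ofHom
      ((T.counit Y ∘ₗ T.extMap (W := Q) d.hom) ∘ₗ T.extMap (W' := Q) c.hom ∘ₗ r) : X ⟶ Y) :=
    ⟨ModuleCat.of Λ (T.Extension Q), T.finite_extension (W := Q),
      T.projective_extension (W := Q), ModuleCat.ofHom _, ModuleCat.ofHom _, rfl⟩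
  have h₃ : FactorsThroughProjective (ModuleCat.ofHom
      ((T.counit Y ∘ₗ T.bridgeIncl) ∘ₗ m ∘ₗ T.cornerB.quot) : X ⟶ Y) :=
    ⟨ModuleCat.of Λ (T.cornerB.Inflation (T.Bridge (T.cornerC.Reduction Y))),
      T.cornerB.finite_inflation (U := T.Bridge (T.cornerC.Reduction Y)),
      T.projective_inflation_bridge _, ModuleCat.ofHom _, ModuleCat.ofHom _, rfl⟩
  convert (h₁.add h₂).add h₃ using 1
  ext x
  have hB' : T.cornerB.map f.hom = b.hom ∘ₗ a.hom := congrArg ModuleCat.Hom.hom hab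
  have hC' : T.cornerC.map f.hom = d.hom ∘ₗ c.hom := congrArg ModuleCat.Hom.hom hcd
  have e₁ : T.cornerB.inflMap (U := P) b.hom (T.cornerB.inflMap (V := P) a.hom
      (T.cornerB.quot x)) = T.cornerB.quot (f.hom (s (T.cornerB.quot x))) := by
    have h := LinearMap.congr_fun hB' (T.cornerB.cls (s (T.cornerB.quot x)))
    rw [CornerRetract.map_cls] at h
    refine Eq.trans ?_ (congrArg T.cornerB.toInfl h).symm
    have h' := hs (T.cornerB.quot x)
    exact congrArg (fun y => T.cornerB.toInfl (b.hom (a.hom (T.cornerB.toInfl.symm y)))) h'.symm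
  have e₂ : T.counit Y (T.extMap (W := Q) d.hom (T.extMap (W' := Q) c.hom (r x))) =
      f.hom (T.counit X (r x)) := by
    rw [← counit_extMap, hC']
    exact congrArg _ (LinearMap.congr_fun (T.extMap_comp (W' := Q) c.hom d.hom) (r x)).symm
  have e₃ : T.bridgeIncl (m (T.cornerB.quot x)) = r' (f.hom (s (T.cornerB.quot x))) :=
    LinearMap.congr_fun hm _
  change f.hom x = s' (T.cornerB.inflMap (U := P) b.hom (T.cornerB.inflMap (V := P) a.hom
      (T.cornerB.quot x))) +
    T.counit Y (T.extMap (W := Q) d.hom (T.extMap (W' := Q) c.hom (r x))) +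
    T.counit Y (T.bridgeIncl (m (T.cornerB.quot x)))
  rw [e₁, e₂, e₃, add_right_comm, add_comm (s' _), hr', ← map_add, add_comm, hr]

end Splitting

/-! ## Modules with prescribed reductions -/

section Sum

variable (U : Type u) [AddCommGroup U] [Module B U] (W : Type u) [AddCommGroup W] [Module C W]

/-- The `B`-reduction of `U ⊕ Λ ⊗ W`. -/
def reductionBEquiv : T.cornerB.Reduction (T.cornerB.Inflation U × T.Extension W) ≃ₗ[B] U :=
  -- `Λ ⊗ W` is generated by elements fixed by `ε_C`, and `ε_C` acts as zero on a `B`-module.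
  have h0 : ∀ z : T.Extension W, T.cornerB.cls ((0, z) : T.cornerB.Inflation U × T.Extension W) = 0 :=
    fun z => by
      have h : LinearMap.ker (T.cornerB.quot ∘ₗ LinearMap.inr Λ (T.cornerB.Inflation U)
          (T.Extension W)) = ⊤ := T.submodule_eq_top _ fun w => by
        have h1 : T.pair 0 w = T.inC 1 • T.pair 0 w := by rw [inC_smul_pair, one_smul]
        rw [LinearMap.mem_ker, h1, map_smul, inC_smul_inflation]
      exact LinearMap.congr_fun (LinearMap.ker_eq_top.1 h) z
  LinearEquiv.ofLinearMap
    (T.cornerB.lift (LinearMap.fst Λ (T.cornerB.Inflation U) (T.Extension W)))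
    (T.cornerB.deflMap (T.cornerB.quot ∘ₗ LinearMap.inl Λ (T.cornerB.Inflation U) (T.Extension W)))
    (LinearMap.ext fun x => T.cornerB.lift_cls _ _)
    (CornerRetract.reduction_hom_ext fun x => by
      obtain ⟨u, z⟩ := x
      rw [LinearMap.comp_apply, CornerRetract.lift_cls]
      change T.cornerB.cls ((u, 0) : T.cornerB.Inflation U × T.Extension W) = T.cornerB.cls (u, z)
      rw [← sub_eq_zero, ← CornerRetract.cls_sub, Prod.mk_sub_mk, sub_self, zero_sub, h0])

/-- The `C`-reduction of `U ⊕ Λ ⊗ W`. -/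
def reductionCEquiv : T.cornerC.Reduction (T.cornerB.Inflation U × T.Extension W) ≃ₗ[C] W :=
  LinearEquiv.ofLinearMap
    (T.cornerC.lift (T.extProj ∘ₗ LinearMap.snd Λ (T.cornerB.Inflation U) (T.Extension W)))
    { toFun := fun w => T.cornerC.cls ((0, T.pair 0 w) : T.cornerB.Inflation U × T.Extension W)
      map_add' := fun v w => by
        rw [← CornerRetract.cls_add, Prod.mk_add_mk, pair_add, add_zero, add_zero]
      map_smul' := fun c w => by
        rw [RingHom.id_apply, ← CornerRetract.cls_incl_smul, Prod.smul_mk, smul_zero, cornerC_incl,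
          inC_smul_pair] }
    (LinearMap.ext fun w => by
      change T.cornerC.lift _ (T.cornerC.cls _) = w
      rw [CornerRetract.lift_cls, LinearMap.comp_apply, LinearMap.snd_apply, extProj_pair,
        AddEquiv.symm_apply_apply])
    (CornerRetract.reduction_hom_ext fun x => by
      obtain ⟨u, z⟩ := x
      obtain ⟨n, w, rfl⟩ := T.exists_pair z
      rw [LinearMap.comp_apply, CornerRetract.lift_cls, LinearMap.comp_apply, LinearMap.snd_apply,
        extProj_pair, AddEquiv.symm_apply_apply]
      change T.cornerC.cls ((0, T.pair 0 w) : T.cornerB.Inflation U × T.Extension W) =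
        T.cornerC.cls (u, T.pair n w)
      rw [clsC_eq, Prod.smul_mk, Prod.smul_mk, inC_smul_pair, inC_smul_pair, inC_smul_inflation,
        inC_smul_inflation])

end Sum

/-! ## The equivalence -/

section Equivalence

variable [Module.Finite K B] [Module.Finite K C]

/-- The functor from the stable category of `Λ` to the product of those of `B` and `C`. -/
def stableReduction : StableGProj Λ ⥤ StableGProj B × StableGProj C :=
  T.isStablyExact_cornerB.stableFunctor.prod' T.isStablyExact_cornerC.stableFunctor

theorem stableReduction_full : T.stableReduction.Full where
  map_surjective {X Y} := by
    rintro ⟨g, h⟩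
    obtain ⟨g, rfl⟩ := (CategoryTheory.Quotient.functor (stableRel B)).map_surjective g
    obtain ⟨h, rfl⟩ := (CategoryTheory.Quotient.functor (stableRel C)).map_surjective h
    obtain ⟨f, hf, hf'⟩ := T.exists_map_eq X.as.property Y.as.property g.hom.hom h.hom.hom
    let f' : X.as ⟶ Y.as := ObjectProperty.homMk (ModuleCat.ofHom f)
    refine ⟨(StableGProj.proj Λ).map f', Prod.ext ?_ ?_⟩
    · refine congrArg (StableGProj.proj B).map (?_ : T.isStablyExact_cornerB.gprojFunctor.map f' = g)
      exact ObjectProperty.hom_ext _ (ModuleCat.hom_ext hf)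
    · refine congrArg (StableGProj.proj C).map (?_ : T.isStablyExact_cornerC.gprojFunctor.map f' = h)
      exact ObjectProperty.hom_ext _ (ModuleCat.hom_ext hf')

theorem stableReduction_faithful : T.stableReduction.Faithful where
  map_injective {X Y f g} hfg := by
    obtain ⟨f, rfl⟩ := (CategoryTheory.Quotient.functor (stableRel Λ)).map_surjective f
    obtain ⟨g, rfl⟩ := (CategoryTheory.Quotient.functor (stableRel Λ)).map_surjective g
    exact CategoryTheory.Quotient.sound _ (T.factorsThroughProjective_of_map X.as.property
      Y.as.property _
      ((T.isStablyExact_cornerB.stableFunctor_map_eq_iff f g).1 (congrArg Prod.fst hfg))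
      ((T.isStablyExact_cornerC.stableFunctor_map_eq_iff f g).1 (congrArg Prod.snd hfg)))

theorem stableReduction_essSurj : T.stableReduction.EssSurj where
  mem_essImage := by
    rintro ⟨U, W⟩
    let X : GProj Λ := ⟨ModuleCat.of Λ (T.cornerB.Inflation U.as.obj × T.Extension W.as.obj),
      (T.isGorensteinProjective_inflation U.as.property).prod
        (T.isGorensteinProjective_extension W.as.property)⟩
    let a : T.isStablyExact_cornerB.gprojFunctor.obj X ≅ U.as :=
      (gprojProperty B).isoMk (T.reductionBEquiv U.as.obj W.as.obj).toModuleIso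
    let b : T.isStablyExact_cornerC.gprojFunctor.obj X ≅ W.as :=
      (gprojProperty C).isoMk (T.reductionCEquiv U.as.obj W.as.obj).toModuleIso
    exact ⟨(StableGProj.proj Λ).obj X,
      ⟨Iso.prod ((StableGProj.proj B).mapIso a) ((StableGProj.proj C).mapIso b)⟩⟩

theorem stableReduction_isEquivalence : T.stableReduction.IsEquivalence where
  full := T.stableReduction_full
  faithful := T.stableReduction_faithful
  essSurj := T.stableReduction_essSurj

/-- The stable category of `Λ` is the coproduct of those of `B` and `C`. -/
def triangleEquivalence :
    TriangleEquivalence K (StableGProj Λ) (StableGProj B × StableGProj C) where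
  equiv :=
    letI := T.stableReduction_isEquivalence
    T.stableReduction.asEquivalence
  additive := ⟨Prod.ext T.isStablyExact_cornerB.stableFunctor_additive.map_add
    T.isStablyExact_cornerC.stableFunctor_additive.map_add⟩
  linear := ⟨fun f r => Prod.ext ((T.isStablyExact_cornerB.stableFunctor_linear K).map_smul f r)
    ((T.isStablyExact_cornerC.stableFunctor_linear K).map_smul f r)⟩
  commSusp := NatIso.ofComponents
    (fun X => Iso.prod (T.isStablyExact_cornerB.commSusp.app X)
      (T.isStablyExact_cornerC.commSusp.app X))
    fun f => Prod.ext (T.isStablyExact_cornerB.commSusp.hom.naturality f)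
      (T.isStablyExact_cornerC.commSusp.hom.naturality f)
  map_distinguished t ht := ⟨T.isStablyExact_cornerB.map_distinguished t ht,
    T.isStablyExact_cornerC.map_distinguished t ht⟩

end Equivalence

end OneArrowExtension

/-! ## The path algebra as a universal algebra -/

namespace PathAlgebra

section Paths

variable (K : Type u) {V : Type u} [Field K] [Quiver.{u} V]

open Classical in
/-- The basis element given by a path. -/
def ofPath {a b : V} (p : Quiver.Path a b) : PathAlgebra K V :=
  Function.update (0 : ∀ a b : V, Quiver.Path a b →₀ K) a
    (Function.update (0 : ∀ b : V, Quiver.Path a b →₀ K) b (Finsupp.single p 1))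

variable {K}

theorem ofPath_apply_self {a b : V} (p : Quiver.Path a b) :
    ofPath K p a b = Finsupp.single p 1 := by
  classical
  unfold ofPath
  rw [Function.update_self, Function.update_self]

theorem ofPath_apply_of_left_ne {a b : V} (p : Quiver.Path a b) {a' : V} (b' : V) (h : a' ≠ a) :
    ofPath K p a' b' = 0 := by
  classical
  unfold ofPath
  rw [Function.update_of_ne h]
  rfl

theorem ofPath_apply_of_right_ne {a b : V} (p : Quiver.Path a b) (a' : V) {b' : V} (h : b' ≠ b) :
    ofPath K p a' b' = 0 := by
  classical
  by_cases h' : a' = a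
  · subst h'
    unfold ofPath
    rw [Function.update_self, Function.update_of_ne h]
    rfl
  · exact ofPath_apply_of_left_ne p b' h'

variable [Fintype V]

/-- The coefficients of the paths from `a` to `b`. -/
def component (a b : V) : PathAlgebra K V →ₗ[K] (Quiver.Path a b →₀ K) where
  toFun x := x a b
  map_add' _ _ := rfl
  map_smul' _ _ := rfl

variable (K) in
/-- The linear map with given values on the paths. -/
def liftLinear {A : Type u} [AddCommGroup A] [Module K A] (g : ∀ ⦃a b : V⦄, Quiver.Path a b → A) :
    PathAlgebra K V →ₗ[K] A where
  toFun x := ∑ a, ∑ b, Finsupp.linearCombination K (@g a b) (x a b)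
  map_add' x y := by simp only [add_apply, map_add, Finset.sum_add_distrib]
  map_smul' r x := by simp only [smul_apply, map_smul, Finset.smul_sum, RingHom.id_apply]

@[simp] theorem liftLinear_ofPath {A : Type u} [AddCommGroup A] [Module K A]
    (g : ∀ ⦃a b : V⦄, Quiver.Path a b → A) {a b : V} (p : Quiver.Path a b) :
    liftLinear K g (ofPath K p) = g p := by
  change ∑ a', ∑ b', Finsupp.linearCombination K (@g a' b') (ofPath K p a' b') = g p
  rw [Finset.sum_eq_single a, Finset.sum_eq_single b, ofPath_apply_self,
    Finsupp.linearCombination_single, one_smul]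
  · intro b' _ h
    rw [ofPath_apply_of_right_ne p a h, map_zero]
  · simp
  · intro a' _ h
    exact Finset.sum_eq_zero fun b' _ => by rw [ofPath_apply_of_left_ne p b' h, map_zero]
  · simp

theorem liftLinear_ofPath_self (x : PathAlgebra K V) :
    liftLinear K (fun _ _ p => ofPath K p) x = x := by
  ext1 a b
  have h : ∀ a' b' (y : Quiver.Path a' b' →₀ K),
      component a b (Finsupp.linearCombination K (fun p => ofPath K p) y) =
        y.sum fun p r => r • component a b (ofPath K p) := fun a' b' y => by
    rw [Finsupp.linearCombination_apply, map_finsuppSum]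
    simp only [map_smul]
  change component a b (∑ a', ∑ b', Finsupp.linearCombination K (fun p => ofPath K p) (x a' b')) =
    x a b
  simp only [map_sum, h]
  rw [Finset.sum_eq_single a, Finset.sum_eq_single b]
  · have h' : ∀ (p : Quiver.Path a b) (r : K),
        r • component a b (ofPath K p) = Finsupp.single p r := fun p r => by
      change r • ofPath K p a b = _
      rw [ofPath_apply_self, Finsupp.smul_single, smul_eq_mul, mul_one]
    simp only [h']
    exact Finsupp.sum_single _
  · intro b' _ hb
    refine Finset.sum_eq_zero fun p _ => ?_
    change _ • ofPath K p a b = 0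
    rw [ofPath_apply_of_right_ne p a hb.symm, smul_zero]
  · simp
  · intro a' _ ha
    refine Finset.sum_eq_zero fun b' _ => Finset.sum_eq_zero fun p _ => ?_
    change _ • ofPath K p a b = 0
    rw [ofPath_apply_of_left_ne p b ha.symm, smul_zero]
  · simp

/-- The paths span, by `liftLinear_ofPath_self`; multiplicativity and equality of homomorphisms are
thereby checked on paths only. -/
theorem induction_paths {P : PathAlgebra K V → Prop} (h0 : P 0)
    (hs : ∀ (r : K) ⦃a b : V⦄ (p : Quiver.Path a b), P (r • ofPath K p))
    (ha : ∀ x y, P x → P y → P (x + y)) (x : PathAlgebra K V) : P x := by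
  rw [← liftLinear_ofPath_self x]
  refine Finset.sum_induction _ P ha h0 fun a _ => Finset.sum_induction _ P ha h0 fun b _ => ?_
  rw [Finsupp.linearCombination_apply]
  exact Finset.sum_induction _ P ha h0 fun p _ => hs _ p

theorem congr_of_paths {A : Type u} [Ring A] [Algebra K A] {f g : PathAlgebra K V →ₙₐ[K] A}
    (h : ∀ ⦃a b : V⦄ (p : Quiver.Path a b), f (ofPath K p) = g (ofPath K p))
    (x : PathAlgebra K V) : f x = g x := by
  induction x using induction_paths with
  | h0 => rw [map_zero, map_zero]
  | hs r p => rw [map_smul, map_smul, h]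
  | ha x y hx hy => rw [map_add, map_add, hx, hy]

theorem map_mul_of_paths {A : Type u} [Ring A] [Algebra K A] (f : PathAlgebra K V →ₗ[K] A)
    (h : ∀ ⦃a b c d : V⦄ (p : Quiver.Path a b) (q : Quiver.Path c d),
      f (ofPath K q * ofPath K p) = f (ofPath K q) * f (ofPath K p)) (x y : PathAlgebra K V) :
    f (x * y) = f x * f y := by
  induction x using induction_paths with
  | h0 => rw [zero_mul, map_zero, zero_mul]
  | ha x x' hx hx' => rw [add_mul, map_add, map_add, add_mul, hx, hx']
  | hs r q =>
    induction y using induction_paths with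
    | h0 => rw [mul_zero, map_zero, mul_zero]
    | ha y y' hy hy' => rw [mul_add, map_add, map_add, mul_add, hy, hy']
    | hs s p => rw [smul_mul_smul_comm, map_smul, map_smul, map_smul, smul_mul_smul_comm, h]

theorem ofPath_mul {a b c : V} (p : Quiver.Path a b) (q : Quiver.Path b c) :
    ofPath K q * ofPath K p = ofPath K (p.comp q) := by
  ext1 a' c'
  rw [mul_apply, Finset.sum_eq_single b]
  · by_cases ha : a' = a
    · subst ha
      by_cases hc : c' = c
      · subst hc
        simp only [ofPath_apply_self, concat_single, mul_one]
      · rw [ofPath_apply_of_right_ne q b hc, ofPath_apply_of_right_ne _ _ hc, concat_zero_right]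
    · rw [ofPath_apply_of_left_ne p b ha, ofPath_apply_of_left_ne _ _ ha, concat_zero_left]
  · intro b' _ h
    rw [ofPath_apply_of_right_ne p a' h, concat_zero_left]
  · simp

theorem ofPath_mul_of_ne {a b c d : V} (p : Quiver.Path a b) (q : Quiver.Path c d) (h : b ≠ c) :
    ofPath K q * ofPath K p = 0 := by
  ext1 a' d'
  rw [mul_apply, zero_apply]
  refine Finset.sum_eq_zero fun b' _ => ?_
  by_cases hb : b' = b
  · subst hb
    rw [ofPath_apply_of_left_ne q d' h, concat_zero_right]
  · rw [ofPath_apply_of_right_ne p a' hb, concat_zero_left]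

theorem one_eq_sum : (1 : PathAlgebra K V) = ∑ a, ofPath K (Quiver.Path.nil : Quiver.Path a a) := by
  ext1 a b
  change _ = component a b (∑ c, ofPath K (Quiver.Path.nil : Quiver.Path c c))
  rw [map_sum, Finset.sum_eq_single a]
  · change trivialPath K a b = ofPath K _ a b
    by_cases h : a = b
    · subst h
      rw [trivialPath_self, ofPath_apply_self]
    · rw [trivialPath_ne h, ofPath_apply_of_right_ne _ _ (Ne.symm h)]
  · intro x _ hx
    exact ofPath_apply_of_left_ne _ _ hx.symm
  · simp

theorem ofPath_cons {a b c : V} (p : Quiver.Path a b) (g : b ⟶ c) :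
    ofPath K (p.cons g) = ofPath K g.toPath * ofPath K p := by
  rw [ofPath_mul, Quiver.Path.comp_toPath_eq_cons]

end Paths

/-! ### Homomorphisms out of the path algebra -/

/-- A representation of the quiver on `V` by elements of the ring `A`: orthogonal idempotents of
sum `1` for the vertices, and elements of the corresponding Peirce components for the arrows. -/
structure Family (V A : Type u) [Quiver.{u} V] [Fintype V] [Ring A] where
  vertex : V → A
  arrow : ∀ ⦃a b : V⦄, (a ⟶ b) → A
  sum_vertex : ∑ a, vertex a = 1
  vertex_mul_of_ne : ∀ a b, a ≠ b → vertex a * vertex b = 0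
  vertex_mul_arrow : ∀ ⦃a b : V⦄ (g : a ⟶ b), vertex b * arrow g = arrow g
  arrow_mul_vertex : ∀ ⦃a b : V⦄ (g : a ⟶ b), arrow g * vertex a = arrow g

namespace Family

variable {K V A : Type u} [Field K] [Quiver.{u} V] [Fintype V] [Ring A] (F : Family V A)

/-- The element represented by a path. -/
def path {a : V} : ∀ {b : V}, Quiver.Path a b → A
  | _, .nil => F.vertex a
  | _, .cons p g => F.arrow g * path p

/-- Idempotence need not be required in `Family`: multiply `∑ b, vertex b = 1` by `vertex a` and use
orthogonality. -/
theorem vertex_mul_self (a : V) : F.vertex a * F.vertex a = F.vertex a := by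
  have h := mul_one (F.vertex a)
  rw [← F.sum_vertex, Finset.mul_sum, Finset.sum_eq_single a
    (fun b _ hb => F.vertex_mul_of_ne a b hb.symm) (by simp)] at h
  exact h

theorem path_mul_vertex {a b : V} (p : Quiver.Path a b) : F.path p * F.vertex a = F.path p := by
  induction p with
  | nil => exact F.vertex_mul_self a
  | cons p g h => rw [path, mul_assoc, h]

theorem vertex_mul_path {a b : V} (p : Quiver.Path a b) : F.vertex b * F.path p = F.path p := by
  cases p with
  | nil => exact F.vertex_mul_self a
  | cons p g => rw [path, ← mul_assoc, F.vertex_mul_arrow]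

theorem path_comp {a b c : V} (p : Quiver.Path a b) (q : Quiver.Path b c) :
    F.path (p.comp q) = F.path q * F.path p := by
  induction q with
  | nil => exact (F.vertex_mul_path p).symm
  | cons q g h => rw [Quiver.Path.comp_cons, path, path, h, mul_assoc]

theorem path_mul_path_of_ne {a b c d : V} (p : Quiver.Path a b) (q : Quiver.Path c d)
    (h : b ≠ c) : F.path q * F.path p = 0 := by
  rw [← F.path_mul_vertex q, ← F.vertex_mul_path p, mul_assoc, ← mul_assoc (F.vertex c),
    F.vertex_mul_of_ne c b h.symm, zero_mul, mul_zero]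

variable (K) in
/-- The homomorphism from the path algebra given by a representation of the quiver. -/
def lift [Algebra K A] : PathAlgebra K V →ₐ[K] A :=
  AlgHom.ofLinearMap (liftLinear K fun _ _ p => F.path p)
    (by
      rw [one_eq_sum, map_sum, ← F.sum_vertex]
      exact Finset.sum_congr rfl fun a _ => liftLinear_ofPath _ _)
    (map_mul_of_paths _ fun a b c d p q => by
      rw [liftLinear_ofPath, liftLinear_ofPath]
      by_cases h : b = c
      · subst h
        rw [ofPath_mul, liftLinear_ofPath, path_comp]
      · rw [ofPath_mul_of_ne p q h, map_zero, F.path_mul_path_of_ne p q h])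

@[simp] theorem lift_ofPath [Algebra K A] {a b : V} (p : Quiver.Path a b) :
    F.lift K (ofPath K p) = F.path p :=
  liftLinear_ofPath _ p

end Family

/-! ### Functoriality -/

section Map

variable {K V W : Type u} [Field K] [Quiver.{u} V] [Quiver.{u} W] [Fintype V] [Fintype W]

variable (K) in
/-- The homomorphism of path algebras given by a morphism of quivers that is injective on
vertices. -/
def map (F : V ⥤q W) (hF : Function.Injective F.obj) : PathAlgebra K V →ₙₐ[K] PathAlgebra K W where
  toFun := liftLinear K fun _ _ p => ofPath K (F.mapPath p)
  map_smul' r x := map_smul _ r x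
  map_zero' := map_zero _
  map_add' := map_add _
  map_mul' := map_mul_of_paths _ fun a b c d p q => by
    rw [liftLinear_ofPath, liftLinear_ofPath]
    by_cases h : b = c
    · subst h
      rw [ofPath_mul, ofPath_mul, liftLinear_ofPath, Prefunctor.mapPath_comp]
    -- Injectivity on vertices keeps noncomposable paths noncomposable.
    · rw [ofPath_mul_of_ne p q h, map_zero, ofPath_mul_of_ne _ _ fun h' => h (hF h')]

@[simp] theorem map_ofPath (F : V ⥤q W) (hF : Function.Injective F.obj) {a b : V}
    (p : Quiver.Path a b) : map K F hF (ofPath K p) = ofPath K (F.mapPath p) :=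
  liftLinear_ofPath _ p

theorem map_apply_obj (F : V ⥤q W) (hF : Function.Injective F.obj) (x : PathAlgebra K V)
    (a b : V) : map K F hF x (F.obj a) (F.obj b) = Finsupp.mapDomain F.mapPath (x a b) := by
  induction x using induction_paths with
  | h0 => rw [map_zero, zero_apply, zero_apply, Finsupp.mapDomain_zero]
  | ha x y hx hy => rw [map_add, add_apply, add_apply, Finsupp.mapDomain_add, hx, hy]
  | @hs r c d p =>
    rw [map_smul, smul_apply, smul_apply, Finsupp.mapDomain_smul, map_ofPath]
    congr 1
    by_cases ha : a = c
    · by_cases hb : b = d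
      · subst ha hb
        rw [ofPath_apply_self, ofPath_apply_self, Finsupp.mapDomain_single]
      · rw [ofPath_apply_of_right_ne p a hb, ofPath_apply_of_right_ne _ _ fun h => hb (hF h),
          Finsupp.mapDomain_zero]
    · rw [ofPath_apply_of_left_ne p b ha, ofPath_apply_of_left_ne _ _ fun h => ha (hF h),
        Finsupp.mapDomain_zero]

theorem map_apply_of_forall_left_ne (F : V ⥤q W) (hF : Function.Injective F.obj)
    (x : PathAlgebra K V) {a : W} (b : W) (h : ∀ c, a ≠ F.obj c) : map K F hF x a b = 0 := by
  induction x using induction_paths with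
  | h0 => rw [map_zero, zero_apply]
  | ha x y hx hy => rw [map_add, add_apply, hx, hy, add_zero]
  | hs r p => rw [map_smul, smul_apply, map_ofPath, ofPath_apply_of_left_ne _ _ (h _), smul_zero]

theorem map_apply_of_forall_right_ne (F : V ⥤q W) (hF : Function.Injective F.obj)
    (x : PathAlgebra K V) (a : W) {b : W} (h : ∀ c, b ≠ F.obj c) : map K F hF x a b = 0 := by
  induction x using induction_paths with
  | h0 => rw [map_zero, zero_apply]
  | ha x y hx hy => rw [map_add, add_apply, hx, hy, add_zero]
  | hs r p => rw [map_smul, smul_apply, map_ofPath, ofPath_apply_of_right_ne _ _ (h _), smul_zero]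

end Map

end PathAlgebra

/-! ## Quotients by two-sided ideals -/

namespace TwoSidedIdeal

variable {K R A : Type u} [Field K] [Ring R] [Algebra K R] [Ring A] [Algebra K A]
  (I : TwoSidedIdeal R)

variable (K) in
/-- The projection to the quotient algebra. -/
abbrev toQuotient : R →ₐ[K] I.ringCon.Quotient := RingCon.mkₐ K I.ringCon

/-- The projection to the quotient algebra, as a non-unital homomorphism. -/
abbrev toNonUnitalQuotient : R →ₙₐ[K] I.ringCon.Quotient :=
  (RingCon.mkₐ K I.ringCon : R →ₙₐ[K] I.ringCon.Quotient)

theorem toQuotient_surjective : Function.Surjective (I.toQuotient K) :=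
  RingCon.mkₐ_surjective _

theorem toQuotient_eq_zero {x : R} (hx : x ∈ I) : I.toQuotient K x = 0 :=
  (RingCon.eq I.ringCon).2 ((I.mem_iff x).1 hx)

/-- The homomorphism from the quotient algebra given by one that vanishes on the ideal. -/
def liftQuotient (φ : R →ₙₐ[K] A) (h : ∀ x ∈ I, φ x = 0) : I.ringCon.Quotient →ₙₐ[K] A where
  toFun := Quotient.lift (s := I.ringCon.toSetoid) φ fun x y hxy => by
    rw [← sub_eq_zero, ← map_sub]
    exact h _ ((I.rel_iff x y).1 hxy)
  map_smul' r x := by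
    obtain ⟨x, rfl⟩ := I.toQuotient_surjective (K := K) x
    exact map_smul φ r x
  map_zero' := map_zero φ
  map_add' x y := by
    obtain ⟨x, rfl⟩ := I.toQuotient_surjective (K := K) x
    obtain ⟨y, rfl⟩ := I.toQuotient_surjective (K := K) y
    exact map_add φ x y
  map_mul' x y := by
    obtain ⟨x, rfl⟩ := I.toQuotient_surjective (K := K) x
    obtain ⟨y, rfl⟩ := I.toQuotient_surjective (K := K) y
    exact map_mul φ x y

end TwoSidedIdeal

/-! ## The glued path algebra -/

section Gluing

open PathAlgebra

variable {K V' V'' : Type u} [Field K] [Quiver.{u} V'] [Quiver.{u} V''] (v : V') (w : V'')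

theorem gluedInl_obj_injective : Function.Injective (gluedInl v w).obj := fun _ _ h =>
  Sum.inl_injective h

theorem gluedInr_obj_injective : Function.Injective (gluedInr v w).obj := fun _ _ h =>
  Sum.inr_injective h

theorem gluedInl_obj_ne (a : V') (b : V'') : (gluedInl v w).obj a ≠ (gluedInr v w).obj b :=
  Sum.inl_ne_inr

variable [Fintype V'] [Fintype V'']

variable (K) in
/-- The inclusion `KQ' → KQ` as a homomorphism. -/
def gluedMapInl : PathAlgebra K V' →ₙₐ[K] PathAlgebra K (GluedVertex v w) :=
  PathAlgebra.map K (gluedInl v w) (gluedInl_obj_injective v w)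

variable (K) in
/-- The inclusion `KQ'' → KQ` as a homomorphism. -/
def gluedMapInr : PathAlgebra K V'' →ₙₐ[K] PathAlgebra K (GluedVertex v w) :=
  PathAlgebra.map K (gluedInr v w) (gluedInr_obj_injective v w)

/-- Links the entrywise inclusion that defines the glued ideal to a multiplicative map determined on
paths. -/
theorem pathAlgebraInl_eq (x : PathAlgebra K V') : pathAlgebraInl v w x = gluedMapInl K v w x := by
  ext1 a b
  rcases a with a | a
  · rcases b with b | b
    · exact (map_apply_obj (gluedInl v w) (gluedInl_obj_injective v w) x a b).symm
    · exact (map_apply_of_forall_right_ne _ _ x _ fun c => (gluedInl_obj_ne v w c b).symm).symm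
  · exact (map_apply_of_forall_left_ne _ _ x _ fun c => (gluedInl_obj_ne v w c a).symm).symm

theorem pathAlgebraInr_eq (x : PathAlgebra K V'') :
    pathAlgebraInr v w x = gluedMapInr K v w x := by
  ext1 a b
  rcases a with a | a
  · exact (map_apply_of_forall_left_ne _ _ x _ fun c => gluedInl_obj_ne v w a c).symm
  · rcases b with b | b
    · exact (map_apply_of_forall_right_ne _ _ x _ fun c => gluedInl_obj_ne v w b c).symm
    · exact (map_apply_obj (gluedInr v w) (gluedInr_obj_injective v w) x a b).symm

theorem gluedMapInl_ofPath {a b : V'} (p : Quiver.Path a b) :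
    gluedMapInl K v w (ofPath K p) = ofPath K ((gluedInl v w).mapPath p) :=
  map_ofPath _ _ p

theorem gluedMapInr_ofPath {a b : V''} (p : Quiver.Path a b) :
    gluedMapInr K v w (ofPath K p) = ofPath K ((gluedInr v w).mapPath p) :=
  map_ofPath _ _ p

theorem gluedMap_one_add : gluedMapInl K v w 1 + gluedMapInr K v w 1 = 1 := by
  rw [one_eq_sum, one_eq_sum, one_eq_sum, map_sum, map_sum]
  simp only [gluedMapInl_ofPath, gluedMapInr_ofPath]
  exact (Fintype.sum_sum_type (fun a : V' ⊕ V'' =>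
    ofPath K (V := GluedVertex v w) (Quiver.Path.nil : Quiver.Path (V := GluedVertex v w) a a))).symm

theorem gluedMapInl_mul_gluedMapInr (x : PathAlgebra K V') (y : PathAlgebra K V'') :
    gluedMapInl K v w x * gluedMapInr K v w y = 0 := by
  induction x using induction_paths with
  | h0 => rw [map_zero, zero_mul]
  | ha x x' hx hx' => rw [map_add, add_mul, hx, hx', add_zero]
  | hs r p =>
    induction y using induction_paths with
    | h0 => rw [map_zero, mul_zero]
    | ha y y' hy hy' => rw [map_add, mul_add, hy, hy', add_zero]
    | hs s q =>
      rw [map_smul, map_smul, gluedMapInl_ofPath, gluedMapInr_ofPath, smul_mul_smul_comm,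
        ofPath_mul_of_ne _ _ (gluedInl_obj_ne v w _ _).symm, smul_zero]

theorem gluedMapInr_mul_gluedMapInl (x : PathAlgebra K V'') (y : PathAlgebra K V') :
    gluedMapInr K v w x * gluedMapInl K v w y = 0 := by
  induction x using induction_paths with
  | h0 => rw [map_zero, zero_mul]
  | ha x x' hx hx' => rw [map_add, add_mul, hx, hx', add_zero]
  | hs r p =>
    induction y using induction_paths with
    | h0 => rw [map_zero, mul_zero]
    | ha y y' hy hy' => rw [map_add, mul_add, hy, hy', add_zero]
    | hs s q =>
      rw [map_smul, map_smul, gluedMapInl_ofPath, gluedMapInr_ofPath, smul_mul_smul_comm,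
        ofPath_mul_of_ne _ _ (gluedInl_obj_ne v w _ _), smul_zero]

variable (K) in
/-- The new arrow, as an element of the path algebra. -/
def gluedBridge : PathAlgebra K (GluedVertex v w) :=
  ofPath K (Quiver.Hom.toPath (V := GluedVertex v w) (a := Sum.inr w) (b := Sum.inl v)
    GluedArrow.bridge)

theorem gluedMapInl_nil_mul_gluedBridge :
    gluedMapInl K v w (ofPath K (Quiver.Path.nil : Quiver.Path v v)) * gluedBridge K v w =
      gluedBridge K v w := by
  rw [gluedMapInl_ofPath]
  exact ofPath_mul (V := GluedVertex v w) _ _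

theorem gluedBridge_mul_gluedMapInr_nil :
    gluedBridge K v w * gluedMapInr K v w (ofPath K (Quiver.Path.nil : Quiver.Path w w)) =
      gluedBridge K v w := by
  rw [gluedMapInr_ofPath]
  exact ofPath_mul (V := GluedVertex v w) _ _

/-- A path of the glued quiver lies in `Q'`, lies in `Q''`, or crosses the new arrow once. -/
theorem ofPath_glued_cases {a b : GluedVertex v w} (p : Quiver.Path a b) :
    (∃ x, ofPath K p = gluedMapInl K v w x) ∨ (∃ y, ofPath K p = gluedMapInr K v w y) ∨
      ∃ x y, ofPath K p = gluedMapInl K v w x * gluedBridge K v w * gluedMapInr K v w y := by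
  induction p with
  | nil =>
    rcases a with a | a
    · exact Or.inl ⟨_, (gluedMapInl_ofPath v w (Quiver.Path.nil : Quiver.Path a a)).symm⟩
    · exact Or.inr (Or.inl ⟨_, (gluedMapInr_ofPath v w (Quiver.Path.nil : Quiver.Path a a)).symm⟩)
  | cons p g h =>
    rw [ofPath_cons]
    change GluedArrow v w _ _ at g
    cases g with
    | left f =>
      have hf : ofPath K (Quiver.Hom.toPath (V := GluedVertex v w) (GluedArrow.left f)) =
          gluedMapInl K v w (ofPath K f.toPath) := (gluedMapInl_ofPath v w f.toPath).symm
      rcases h with ⟨x, hx⟩ | ⟨y, hy⟩ | ⟨x, y, hxy⟩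
      · exact Or.inl ⟨ofPath K f.toPath * x, by rw [hx, map_mul, ← hf]⟩
      -- The induction hypothesis does not record where the path ends, so combinations that cannot
      -- occur are absorbed as zero products, here by orthogonality of `KQ'` and `KQ''`.
      · refine Or.inl ⟨0, ?_⟩
        rw [hy, map_zero, ← gluedMapInl_mul_gluedMapInr v w (ofPath K f.toPath) y, ← hf]
      · refine Or.inr (Or.inr ⟨ofPath K f.toPath * x, y, ?_⟩)
        rw [hxy, map_mul, ← hf]
        simp only [mul_assoc]
    | right f =>
      have hf : ofPath K (Quiver.Hom.toPath (V := GluedVertex v w) (GluedArrow.right f)) =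
          gluedMapInr K v w (ofPath K f.toPath) := (gluedMapInr_ofPath v w f.toPath).symm
      rcases h with ⟨x, hx⟩ | ⟨y, hy⟩ | ⟨x, y, hxy⟩
      · refine Or.inl ⟨0, ?_⟩
        rw [hx, map_zero, ← gluedMapInr_mul_gluedMapInl v w (ofPath K f.toPath) x, ← hf]
      · exact Or.inr (Or.inl ⟨ofPath K f.toPath * y, by rw [hy, map_mul, ← hf]⟩)
      · refine Or.inl ⟨0, ?_⟩
        rw [hxy, map_zero, ← zero_mul (gluedBridge K v w * gluedMapInr K v w y),
          ← gluedMapInr_mul_gluedMapInl v w (ofPath K f.toPath) x, ← hf, mul_assoc, mul_assoc]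
    | bridge =>
      -- The new arrow starts in `Q''`, so it cannot follow a path that ends in `Q'`; in particular
      -- it is crossed only once.
      have hl : ∀ x, gluedBridge K v w * gluedMapInl K v w x = 0 := fun x => by
        rw [← gluedBridge_mul_gluedMapInr_nil, mul_assoc, gluedMapInr_mul_gluedMapInl, mul_zero]
      rcases h with ⟨x, hx⟩ | ⟨y, hy⟩ | ⟨x, y, hxy⟩
      · refine Or.inl ⟨0, ?_⟩
        rw [hx, map_zero]
        exact hl x
      · refine Or.inr (Or.inr ⟨ofPath K (Quiver.Path.nil : Quiver.Path v v), y, ?_⟩)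
        rw [gluedMapInl_nil_mul_gluedBridge, hy]
        rfl
      · refine Or.inl ⟨0, ?_⟩
        rw [hxy, map_zero, mul_assoc (gluedMapInl K v w x), ← mul_assoc]
        exact (congrArg (· * _) (hl x)).trans (zero_mul _)

/-- The representation of the glued quiver given by compatible homomorphisms from `KQ'` and `KQ''`
and a value of the new arrow. -/
def gluedFamily {A : Type u} [Ring A] [Algebra K A] (φ : PathAlgebra K V' →ₙₐ[K] A)
    (ψ : PathAlgebra K V'' →ₙₐ[K] A) (a : A) (hone : φ 1 + ψ 1 = 1)
    (hφψ : ∀ x y, φ x * ψ y = 0) (hψφ : ∀ x y, ψ y * φ x = 0)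
    (hφ : φ (ofPath K (Quiver.Path.nil : Quiver.Path v v)) * a = a)
    (hψ : a * ψ (ofPath K (Quiver.Path.nil : Quiver.Path w w)) = a) :
    Family (GluedVertex v w) A where
  vertex x := Sum.elim (fun x : V' => φ (ofPath K (Quiver.Path.nil : Quiver.Path x x)))
    (fun y : V'' => ψ (ofPath K (Quiver.Path.nil : Quiver.Path y y))) x
  arrow _ _ g := match g with
    | GluedArrow.left f => φ (ofPath K f.toPath)
    | GluedArrow.right f => ψ (ofPath K f.toPath)
    | GluedArrow.bridge => a
  sum_vertex := by
    rw [← hone, one_eq_sum, one_eq_sum, map_sum, map_sum]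
    exact Fintype.sum_sum_type _
  vertex_mul_of_ne x y h := by
    rcases x with x | x <;> rcases y with y | y
    · refine (map_mul φ _ _).symm.trans ?_
      rw [ofPath_mul_of_ne _ _ fun h' => h (congrArg Sum.inl h'.symm), map_zero]
    · exact hφψ _ _
    · exact hψφ _ _
    · refine (map_mul ψ _ _).symm.trans ?_
      rw [ofPath_mul_of_ne _ _ fun h' => h (congrArg Sum.inr h'.symm), map_zero]
  vertex_mul_arrow x y g := by
    change GluedArrow v w _ _ at g
    cases g with
    | left f => exact (map_mul φ _ _).symm.trans (congrArg φ (ofPath_mul _ _))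
    | right f => exact (map_mul ψ _ _).symm.trans (congrArg ψ (ofPath_mul _ _))
    | bridge => exact hφ
  arrow_mul_vertex x y g := by
    change GluedArrow v w _ _ at g
    cases g with
    | left f => exact (map_mul φ _ _).symm.trans (congrArg φ (ofPath_mul _ _))
    | right f => exact (map_mul ψ _ _).symm.trans (congrArg ψ (ofPath_mul _ _))
    | bridge => exact hψ

/-- The values on vertices and arrows define a homomorphism on `KQ`; it agrees with `φ` and `ψ` on
paths by induction on their length. -/
theorem exists_glued_lift {A : Type u} [Ring A] [Algebra K A] (φ : PathAlgebra K V' →ₙₐ[K] A)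
    (ψ : PathAlgebra K V'' →ₙₐ[K] A) (a : A) (hone : φ 1 + ψ 1 = 1)
    (hφψ : ∀ x y, φ x * ψ y = 0) (hψφ : ∀ x y, ψ y * φ x = 0)
    (hφ : φ (ofPath K (Quiver.Path.nil : Quiver.Path v v)) * a = a)
    (hψ : a * ψ (ofPath K (Quiver.Path.nil : Quiver.Path w w)) = a) :
    ∃ ρ : PathAlgebra K (GluedVertex v w) →ₐ[K] A, (∀ x, ρ (gluedMapInl K v w x) = φ x) ∧
      (∀ y, ρ (gluedMapInr K v w y) = ψ y) ∧ ρ (gluedBridge K v w) = a := by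
  let F := gluedFamily v w φ ψ a hone hφψ hψφ hφ hψ
  refine ⟨F.lift K, fun x => ?_, fun y => ?_, ?_⟩
  · refine congr_of_paths (f := (F.lift K : PathAlgebra K (GluedVertex v w) →ₙₐ[K] A).comp
      (gluedMapInl K v w)) (g := φ) (fun a b p => ?_) x
    change F.lift K (gluedMapInl K v w (ofPath K p)) = φ (ofPath K p)
    rw [gluedMapInl_ofPath, Family.lift_ofPath]
    induction p with
    | nil => rfl
    | cons p g h =>
      rw [ofPath_cons, map_mul, ← h]
      rfl
  · refine congr_of_paths (f := (F.lift K : PathAlgebra K (GluedVertex v w) →ₙₐ[K] A).comp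
      (gluedMapInr K v w)) (g := ψ) (fun a b p => ?_) y
    change F.lift K (gluedMapInr K v w (ofPath K p)) = ψ (ofPath K p)
    rw [gluedMapInr_ofPath, Family.lift_ofPath]
    induction p with
    | nil => rfl
    | cons p g h =>
      rw [ofPath_cons, map_mul, ← h]
      rfl
  -- A path of length one is represented by its arrow times the idempotent of its source.
  · exact (F.lift_ofPath _).trans (hψ : a * F.vertex (Sum.inr w) = a)

variable (I' : TwoSidedIdeal (PathAlgebra K V')) (I'' : TwoSidedIdeal (PathAlgebra K V''))

theorem gluedMapInl_mem {x : PathAlgebra K V'} (hx : x ∈ I') :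
    gluedMapInl K v w x ∈ gluedIdeal v w I' I'' :=
  TwoSidedIdeal.subset_span (Or.inl ⟨x, hx, pathAlgebraInl_eq v w x⟩)

theorem gluedMapInr_mem {y : PathAlgebra K V''} (hy : y ∈ I'') :
    gluedMapInr K v w y ∈ gluedIdeal v w I' I'' :=
  TwoSidedIdeal.subset_span (Or.inr ⟨y, hy, pathAlgebraInr_eq v w y⟩)

/-- The kernel of `ρ` is a two-sided ideal, so it suffices that it contains the generators. -/
theorem map_eq_zero_of_mem_gluedIdeal {A : Type u} [Ring A] [Algebra K A]
    (ρ : PathAlgebra K (GluedVertex v w) →ₐ[K] A) (h' : ∀ x ∈ I', ρ (gluedMapInl K v w x) = 0)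
    (h'' : ∀ y ∈ I'', ρ (gluedMapInr K v w y) = 0) {x : PathAlgebra K (GluedVertex v w)}
    (hx : x ∈ gluedIdeal v w I' I'') : ρ x = 0 := by
  have hle : gluedIdeal v w I' I'' ≤ TwoSidedIdeal.ker ρ := TwoSidedIdeal.span_le.2 (by
    rintro _ (⟨x, hx, rfl⟩ | ⟨y, hy, rfl⟩)
    · rw [pathAlgebraInl_eq]
      exact (TwoSidedIdeal.mem_ker ρ).2 (h' x hx)
    · rw [pathAlgebraInr_eq]
      exact (TwoSidedIdeal.mem_ker ρ).2 (h'' y hy))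
  exact (TwoSidedIdeal.mem_ker ρ).1 (hle hx)

/-- The algebra of the glued quiver is the one-arrow extension of the two algebras. -/
def gluedExtension : OneArrowExtension K (BoundQuiverAlgebra I') (BoundQuiverAlgebra I'')
    (BoundQuiverAlgebra (gluedIdeal v w I' I'')) where
  inB := I'.liftQuotient ((gluedIdeal v w I' I'').toNonUnitalQuotient.comp
    (gluedMapInl K v w)) fun _ hx =>
      TwoSidedIdeal.toQuotient_eq_zero (K := K) _ (gluedMapInl_mem v w I' I'' hx)
  inC := I''.liftQuotient ((gluedIdeal v w I' I'').toNonUnitalQuotient.comp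
    (gluedMapInr K v w)) fun _ hy =>
      TwoSidedIdeal.toQuotient_eq_zero (K := K) _ (gluedMapInr_mem v w I' I'' hy)
  e := I'.toQuotient K (ofPath K (Quiver.Path.nil : Quiver.Path v v))
  f := I''.toQuotient K (ofPath K (Quiver.Path.nil : Quiver.Path w w))
  arrow := (gluedIdeal v w I' I'').toQuotient K (gluedBridge K v w)
  e_mul_e := by rw [← map_mul, ofPath_mul, Quiver.Path.comp_nil]
  f_mul_f := by rw [← map_mul, ofPath_mul, Quiver.Path.comp_nil]
  inB_one_add := congrArg ((gluedIdeal v w I' I'').toQuotient K) (gluedMap_one_add v w)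
  inC_mul_inB c b := by
    obtain ⟨x, rfl⟩ := I'.toQuotient_surjective (K := K) b
    obtain ⟨y, rfl⟩ := I''.toQuotient_surjective (K := K) c
    exact congrArg ((gluedIdeal v w I' I'').toQuotient K) (gluedMapInr_mul_gluedMapInl v w y x)
  inB_mul_inC b c := by
    obtain ⟨x, rfl⟩ := I'.toQuotient_surjective (K := K) b
    obtain ⟨y, rfl⟩ := I''.toQuotient_surjective (K := K) c
    exact congrArg ((gluedIdeal v w I' I'').toQuotient K) (gluedMapInl_mul_gluedMapInr v w x y)
  inB_e_mul_arrow :=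
    congrArg ((gluedIdeal v w I' I'').toQuotient K) (gluedMapInl_nil_mul_gluedBridge v w)
  arrow_mul_inC_f :=
    congrArg ((gluedIdeal v w I' I'').toQuotient K) (gluedBridge_mul_gluedMapInr_nil v w)
  induction p hB hC hM hadd x := by
    obtain ⟨x, rfl⟩ := (gluedIdeal v w I' I'').toQuotient_surjective (K := K) x
    induction x using induction_paths with
    | h0 =>
      have h := hB 0
      rw [map_zero] at h
      rwa [map_zero]
    | ha x y hx hy =>
      rw [map_add]
      exact hadd _ _ hx hy
    | hs r q =>
      -- The three kinds of path match the three kinds of spanning element of a one-arrow extension;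
      -- the scalar is moved into the first factor.
      rcases ofPath_glued_cases (K := K) v w q with ⟨x, hx⟩ | ⟨y, hy⟩ | ⟨x, y, hxy⟩
      · rw [hx, ← map_smul]
        exact hB (I'.toQuotient K (r • x))
      · rw [hy, ← map_smul]
        exact hC (I''.toQuotient K (r • y))
      · rw [hxy, ← smul_mul_assoc, ← smul_mul_assoc, ← map_smul]
        exact hM (I'.toQuotient K (r • x)) (I''.toQuotient K y)
  exists_lift A _ _ φ ψ a hone hφψ hψφ hφ hψ := by
    obtain ⟨ρ, h₁, h₂, h₃⟩ := exists_glued_lift v w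
      (φ.comp I'.toNonUnitalQuotient) (ψ.comp I''.toNonUnitalQuotient) a hone
      (fun _ _ => hφψ _ _) (fun _ _ => hψφ _ _) hφ hψ
    -- On `KQ'` and `KQ''` the lift is `φ` and `ψ` after the projections to the quotients, so it
    -- kills `I'` and `I''` and descends to `Λ`.
    have hρ : ∀ x ∈ gluedIdeal v w I' I'', (ρ : _ →ₙₐ[K] A) x = 0 := fun x hx =>
      map_eq_zero_of_mem_gluedIdeal v w I' I'' ρ
        (fun x hx => (h₁ x).trans
          ((congrArg φ (TwoSidedIdeal.toQuotient_eq_zero (K := K) I' hx)).trans (map_zero φ)))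
        (fun y hy => (h₂ y).trans
          ((congrArg ψ (TwoSidedIdeal.toQuotient_eq_zero (K := K) I'' hy)).trans (map_zero ψ))) hx
    let σ := (gluedIdeal v w I' I'').liftQuotient (ρ : _ →ₙₐ[K] A) hρ
    refine ⟨AlgHom.ofLinearMap (σ : _ →ₗ[K] A) (map_one ρ) (map_mul σ), fun b => ?_, fun c => ?_, ?_⟩
    · obtain ⟨x, rfl⟩ := I'.toQuotient_surjective (K := K) b
      exact h₁ x
    · obtain ⟨y, rfl⟩ := I''.toQuotient_surjective (K := K) c
      exact h₂ y
    · exact h₃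

end Gluing

end

theorem lemma3p7 (K V' V'' : Type u) [Field K] [Fintype V'] [Fintype V'']
    [Quiver.{u} V'] [Quiver.{u} V''] (v : V') (w : V'')
    (I' : TwoSidedIdeal (PathAlgebra K V')) (I'' : TwoSidedIdeal (PathAlgebra K V''))
    (hB : IsGorensteinAlgebra K (BoundQuiverAlgebra I'))
    (hC : IsGorensteinAlgebra K (BoundQuiverAlgebra I'')) :
    Nonempty (TriangleEquivalence K
      (StableGProj (BoundQuiverAlgebra (gluedIdeal v w I' I'')))
      (StableGProj (BoundQuiverAlgebra I') × StableGProj (BoundQuiverAlgebra I''))) := by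
  have := hB.finite
  have := hC.finite
  exact ⟨(gluedExtension v w I' I'').triangleEquivalence⟩
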